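/- Let $\mathbb K$ be an algebraic closure of $\mathbb C(q)$, let $A=(a_{ij})_{i,j\in I}$, $I=\{0,\dots,n\}$, be the Cartan matrix of type $\mathrm A^{(1)}_n$ ($n\ge1$), $\mathrm B^{(1)}_n$ ($n\ge3$), $\mathrm C^{(1)}_n$ ($n\ge2$) or $\mathrm D^{(1)}_n$ ($n\ge4$), normalised by $d_i=1$ except $d_n=\frac12$ for $\mathrm B^{(1)}_n$ and $d_0=d_n=2$ for $\mathrm C^{(1)}_n$, so that $(\alpha_i,\alpha_j)=d_ia_{ij}=d_ja_{ji}$, and put $q_i=q^{d_i}$. Let $U_q(\mathfrak g)$ be the Drinfeld–Jimbo quantum group over $\mathbb K$ with generators $x_i,y_i,k_i^{\pm1}$ $(i\in I)$, let $Q=\bigoplus_{i\in I}\mathbb Z\alpha_i$, and for $\chi\in\widetilde H_q=\mathrm{Hom}(Q,\mathbb K^\times)$ let $\mathrm{Ad}(\chi)$ be the automorphism $x_i\mapsto\chi(\alpha_i)x_i$, $y_i\mapsto\chi(\alpha_i)^{-1}y_i$, $k_i\mapsto k_i$. A generalized Satake diagram is a pair $(X,\tau)$ with $X\subseteq I$,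 $A_X$ of finite type, and $\tau$ a diagram automorphism of $A$ with $\tau^2=\mathrm{id}$, such that $-w_X(\alpha_i)=\alpha_{\tau(i)}$ for all $i\in X$ ($w_X$ the longest element of $W_X=\langle r_i\rangle_{i\in X}$) and, with $\theta=-w_X\tau$ on $Q$, for all $i\in X$, $j\in I\setminus X$: if $\theta(\alpha_j)=-(\alpha_i+\alpha_j)$ then $a_{ji}\ne-1$. Let $I^*\subseteq I\setminus X$ contain exactly one element of each $\tau$-orbit in $I\setminus X$, and put $$I_{\rm diff}=\{j\in I^*: j\ne\tau(j),\ (\alpha_j,\theta(\alpha_j))\ne0\},\quad I_{\rm ns}=\{j\in I^*: j=\tau(j),\ a_{ij}=0\ \forall i\in X\},\quad I_{\rm nsf}=\{j\in I_{\rm ns}: a_{ij}\in2\mathbb Z\ \forall i\in I_{\rm ns}\},$$ $$\mathcal C=\{\mathbf c\in(\mathbb K^\times)^{I\setminus X}: \forall j\in I^*,\ c_j\ne c_{\tau(j)}\Rightarrow j\in I_{\rm diff}\},\qquad \mathcal S=\{\mathbf s\in\mathbb K^{I\setminus X}: \forall j\in I\setminus X,\ s_j\ne0\Rightarrow j\in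 I_{\rm nsf}\}.$$ Let $\omega_q$ be the automorphism $x_i\mapsto-k_i^{-1}y_i$, $y_i\mapsto-x_ik_i$, $k_i\mapsto k_i^{-1}$ of $U_q(\mathfrak g)$, let $T_{w_X}$ be the composition of Lusztig's automorphisms $T_i=T''_{i,1}$ along a reduced decomposition of $w_X$, and let $\theta_q=T_{w_X}\tau\omega_q$. For $\mathbf c\in\mathcal C$, $\mathbf s\in\mathcal S$ the quantum pair (QP) algebra $B_{\mathbf c,\mathbf s}=B_{\mathbf c,\mathbf s}(X,\tau)$ is the subalgebra of $U_q(\mathfrak g)$ generated by $x_i$ $(i\in X)$, by $\{a\in\langle k_i^{\pm1}\rangle_{i\in I}:\theta_q(a)=a\}$, and by $b_i=y_i$ $(i\in X)$, $b_i=y_i+c_i\theta_q(y_ik_i)k_i^{-1}-s_ik_i^{-1}$ $(i\in I\setminus X)$. **Statement.** Let $(X,\tau)$ be a generalized Satake diagram for $A$ and let $I^*$ be as above. Then $|I_{\rm diff}\cup I_{\rm nsf}|\le2$, and for all $\mathbf c\in\mathcal C$, $\mathbf s\in\mathcal S$ the algebra $B_{\mathbf c,\mathbf s}$ is $\mathrm{Ad}(\widetilde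 H_q)$-equivalent to a QP algebra with at most two free parameters. More precisely, consider tuples $p=(p_j)_{j\in I_{\rm diff}\cup I_{\rm nsf}}$ in $\mathbb K$ with $p_j\ne0$ for $j\in I_{\rm diff}$, and let $\mathbf c(p)$, $\mathbf s(p)$ be given by $c_{\tau(j)}=p_j$ for $j\in I_{\rm diff}$, $s_j=p_j$ for $j\in I_{\rm nsf}$, all other $c_i$ equal to $1$ and all other $s_i$ equal to $0$. Then $\mathbf c(p)\in\mathcal C$ and $\mathbf s(p)\in\mathcal S$ for every such $p$, and for all $\mathbf c\in\mathcal C$, $\mathbf s\in\mathcal S$ there are such a $p$ and some $\chi\in\widetilde H_q$ with $\mathrm{Ad}(\chi)(B_{\mathbf c,\mathbf s})=B_{\mathbf c(p),\mathbf s(p)}$. -/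

import Mathlib

open scoped BigOperators

noncomputable section

set_option linter.unusedSectionVars false

namespace QuantumPair

/-! ### Untwisted affine Cartan matrices of classical type -/

/-- The four classical families of untwisted affine type. -/
inductive ClassicalType
  | A | B | C | D

namespace ClassicalType

/-- The smallest rank in each family: `A_n` for `n ≥ 1`, `B_n` for `n ≥ 3`, `C_n` for `n ≥ 2`,
`D_n` for `n ≥ 4`. -/
def minRank : ClassicalType → ℕ
  | A => 1
  | B => 3
  | C => 2
  | D => 4

/-- Edges `i - j` (with `i < j`) of the affine Dynkin diagram on the nodes `0, …, n`. -/
def Edge : ClassicalType → ℕ → ℕ → ℕ → Prop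
  | A, n, i, j => j = i + 1 ∨ (i = 0 ∧ j = n)
  | B, _, i, j => (1 ≤ i ∧ j = i + 1) ∨ (i = 0 ∧ j = 2)
  | C, _, i, j => j = i + 1
  | D, n, i, j => (1 ≤ i ∧ i + 2 ≤ n ∧ j = i + 1) ∨ (i = 0 ∧ j = 2) ∨ (i + 2 = n ∧ j = n)

/-- The ordered pairs `(i, j)` for which `a_{ij} = -2`. -/
def DoubleEntry : ClassicalType → ℕ → ℕ → ℕ → Prop
  | A, n, i, j => n = 1 ∧ i ≠ j
  | B, n, i, j => i = n ∧ j + 1 = n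
  | C, n, i, j => (i = 1 ∧ j = 0) ∨ (i + 1 = n ∧ j = n)
  | D, _, _, _ => False

open Classical in
/-- The affine Cartan matrix of type `A_n^{(1)}`, `B_n^{(1)}`, `C_n^{(1)}` or `D_n^{(1)}` with
rows and columns labelled by `0, …, n`. -/
def cartan (t : ClassicalType) (n : ℕ) : Matrix (Fin (n + 1)) (Fin (n + 1)) ℤ := fun i j =>
  if i = j then 2
  else if DoubleEntry t n i j then -2
  else if Edge t n i j ∨ Edge t n j i then -1
  else 0

/-- Twice the symmetrizing number `d_i` : `d_i = 1` except `d_n = 1/2` in type `B` and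
`d_0 = d_n = 2` in type `C`. -/
def twiceD : (t : ClassicalType) → (n : ℕ) → Fin (n + 1) → ℕ
  | A, _, _ => 2
  | B, n, i => if (i : ℕ) = n then 1 else 2
  | C, n, i => if (i : ℕ) = 0 ∨ (i : ℕ) = n then 4 else 2
  | D, _, _ => 2

end ClassicalType

/-! ### Root lattice, Weyl group and generalized Satake diagrams -/

section Combinatorics

variable {I : Type*} [Fintype I] [DecidableEq I]

/-- The simple root `α_i` in the root lattice `Q = ⨁ ℤ α_i`, realised as `I → ℤ`. -/
def simpleRoot (i : I) : I → ℤ := Pi.single i 1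

/-- The simple reflection `r_i` on `Q`, with `r_i(α_j) = α_j - a_{ij} α_i`. -/
def simpleReflection (A : Matrix I I ℤ) (i : I) : (I → ℤ) →ₗ[ℤ] (I → ℤ) where
  toFun μ := μ - (∑ j, A i j * μ j) • simpleRoot i
  map_add' μ ν := by
    simp only [Pi.add_apply, mul_add, Finset.sum_add_distrib, add_smul]; abel
  map_smul' m μ := by
    have h : (∑ j, A i j * (m • μ) j) = m * ∑ j, A i j * μ j := by
      rw [Finset.mul_sum]
      exact Finset.sum_congr rfl fun j _ => by simp only [Pi.smul_apply, smul_eq_mul]; ring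
    rw [h, RingHom.id_apply, smul_sub, mul_smul]

/-- The Weyl group element `r_{i_1} ⋯ r_{i_ℓ}` (acting on `Q`) of a word `[i_1, …, i_ℓ]`. -/
def wordProd (A : Matrix I I ℤ) (ws : List I) : Module.End ℤ (I → ℤ) :=
  (ws.map (simpleReflection A)).prod

/-- `ws` is a reduced decomposition, in the generators `r_i` (`i ∈ X`), of an element of `W_X`. -/
def IsReducedWord (A : Matrix I I ℤ) (X : Finset I) (ws : List I) : Prop :=
  (∀ i ∈ ws, i ∈ X) ∧
    ∀ ws' : List I, (∀ i ∈ ws', i ∈ X) → wordProd A ws' = wordProd A ws →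
      ws.length ≤ ws'.length

/-- `ws` is a reduced decomposition of the longest element of `W_X`. -/
def IsLongestWord (A : Matrix I I ℤ) (X : Finset I) (ws : List I) : Prop :=
  IsReducedWord A X ws ∧ ∀ ws' : List I, IsReducedWord A X ws' → ws'.length ≤ ws.length

open Classical in
/-- A fixed reduced decomposition of the longest element of `W_X`; it exists whenever `W_X` is
finite, in particular when `A_X` is of finite type. -/
def longestWord (A : Matrix I I ℤ) (X : Finset I) : List I :=
  if h : ∃ ws, IsLongestWord A X ws then h.choose else []

/-- The longest element `w_X` of `W_X`, acting on `Q`. -/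
def longestElt (A : Matrix I I ℤ) (X : Finset I) : Module.End ℤ (I → ℤ) :=
  wordProd A (longestWord A X)

/-- The action of a permutation of the nodes on `Q`, with `τ(α_i) = α_{τ(i)}`. -/
def permRoot (τ : Equiv.Perm I) : Module.End ℤ (I → ℤ) := LinearMap.funLeft ℤ ℤ τ.symm

/-- The involution `θ = -w_X τ` on `Q`. -/
def theta (A : Matrix I I ℤ) (X : Finset I) (τ : Equiv.Perm I) : Module.End ℤ (I → ℤ) :=
  -(longestElt A X * permRoot τ)

/-- The submatrix `A_X` is of finite type: all its principal minors are positive. -/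
def IsFiniteType (A : Matrix I I ℤ) (X : Finset I) : Prop :=
  ∀ Y ⊆ X, 0 < (A.submatrix (fun i : Y => (i : I)) (fun i : Y => (i : I))).det

/-- `(X, τ)` is a generalized Satake diagram associated to `A`. -/
structure IsGSat (A : Matrix I I ℤ) (X : Finset I) (τ : Equiv.Perm I) : Prop where
  finiteType : IsFiniteType A X
  diagramAut : ∀ i j, A (τ i) (τ j) = A i j
  involutive : ∀ i, τ (τ i) = i
  neg_longest : ∀ i ∈ X, -(longestElt A X (simpleRoot i)) = simpleRoot (τ i)
  gsat : ∀ i ∈ X, ∀ j ∉ X,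
    theta A X τ (simpleRoot j) = -(simpleRoot i + simpleRoot j) → A j i ≠ -1

/-- `Istar` is a subset of `I \ X` containing exactly one element of each `τ`-orbit in `I \ X`. -/
structure IsTransversal (X : Finset I) (τ : Equiv.Perm I) (Istar : Finset I) : Prop where
  notMem : ∀ j ∈ Istar, j ∉ X
  mem_or : ∀ j ∉ X, j ∈ Istar ∨ τ j ∈ Istar
  eq_of_mem : ∀ j ∈ Istar, τ j ∈ Istar → τ j = j

/-- The symmetric bilinear form on `Q` with `(α_i, α_j) = d_i a_{ij}`. -/
def rootForm (A : Matrix I I ℤ) (d : I → ℚ) (μ ν : I → ℤ) : ℚ :=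
  ∑ i, ∑ j, d i * A i j * μ i * ν j

/-- `I_diff = {j ∈ I^* | j ≠ τ(j), (α_j, θ(α_j)) ≠ 0}`. -/
def Idiff (A : Matrix I I ℤ) (d : I → ℚ) (X : Finset I) (τ : Equiv.Perm I)
    (Istar : Finset I) : Finset I :=
  {j ∈ Istar | j ≠ τ j ∧ rootForm A d (simpleRoot j) (theta A X τ (simpleRoot j)) ≠ 0}

/-- `I_ns = {j ∈ I^* | j = τ(j), a_{ij} = 0 for all i ∈ X}`. -/
def Ins (A : Matrix I I ℤ) (X : Finset I) (τ : Equiv.Perm I) (Istar : Finset I) : Finset I :=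
  {j ∈ Istar | j = τ j ∧ ∀ i ∈ X, A i j = 0}

/-- `I_nsf = {j ∈ I_ns | a_{ij} ∈ 2ℤ for all i ∈ I_ns}`. -/
def Insf (A : Matrix I I ℤ) (X : Finset I) (τ : Equiv.Perm I) (Istar : Finset I) : Finset I :=
  {j ∈ Ins A X τ Istar | ∀ i ∈ Ins A X τ Istar, Even (A i j)}

end Combinatorics

/-! ### The Drinfeld-Jimbo quantum group -/

section QuantumGroup

variable {I : Type*} [DecidableEq I] {K : Type*} [Field K]

/-- Generators `x_i`, `y_i`, `k_i`, `k_i⁻¹`. -/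
inductive Gen (I : Type*)
  | x (i : I)
  | y (i : I)
  | k (i : I)
  | kinv (i : I)

/-- The `q`-number `[r]_q`. -/
def qNum (q : K) (r : ℕ) : K := (q ^ r - q⁻¹ ^ r) / (q - q⁻¹)

/-- The `q`-factorial `[r]_q!`. -/
def qFactorial (q : K) (r : ℕ) : K := ∏ s ∈ Finset.range r, qNum q (s + 1)

/-- The divided power `a^{(r)} = a^r / [r]_q!`. -/
def divPow {U : Type*} [Ring U] [Algebra K U] (q : K) (a : U) (r : ℕ) : U :=
  (qFactorial q r)⁻¹ • a ^ r

/-- The `q`-Serre expression `∑_{r=0}^m (-1)^r a^{(m-r)} b a^{(r)}`. -/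
def serre {U : Type*} [Ring U] [Algebra K U] (q : K) (m : ℕ) (a b : U) : U :=
  ∑ r ∈ Finset.range (m + 1), (-1) ^ r * divPow q a (m - r) * b * divPow q a r

/-- The free algebra on the generators. -/
abbrev FreeU (I K : Type*) [Field K] := FreeAlgebra K (Gen I)

/-- A generator, as an element of the free algebra. -/
abbrev gen (K : Type*) [Field K] {I : Type*} (g : Gen I) : FreeU I K := FreeAlgebra.ι K g

/-- The defining relations of the quantum group of the Cartan matrix `A` with parameters
`q i = q_i = q^{d_i}`. -/
inductive Rel (A : Matrix I I ℤ) (q : I → K) : FreeU I K → FreeU I K → Prop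
  | k_kinv (i : I) : Rel A q (gen K (.k i) * gen K (.kinv i)) 1
  | kinv_k (i : I) : Rel A q (gen K (.kinv i) * gen K (.k i)) 1
  | k_comm (i j : I) : Rel A q (gen K (.k i) * gen K (.k j)) (gen K (.k j) * gen K (.k i))
  | k_x (i j : I) :
      Rel A q (gen K (.k i) * gen K (.x j)) (q i ^ A i j • (gen K (.x j) * gen K (.k i)))
  | k_y (i j : I) :
      Rel A q (gen K (.k i) * gen K (.y j)) (q i ^ (-A i j) • (gen K (.y j) * gen K (.k i)))
  | x_y_self (i : I) :
      Rel A q (gen K (.x i) * gen K (.y i) - gen K (.y i) * gen K (.x i))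
        ((q i - (q i)⁻¹)⁻¹ • (gen K (.k i) - gen K (.kinv i)))
  | x_y_ne (i j : I) (h : i ≠ j) :
      Rel A q (gen K (.x i) * gen K (.y j) - gen K (.y j) * gen K (.x i)) 0
  | serre_x (i j : I) (h : i ≠ j) :
      Rel A q (serre (q i) (1 - A i j).toNat (gen K (.x i)) (gen K (.x j))) 0
  | serre_y (i j : I) (h : i ≠ j) :
      Rel A q (serre (q i) (1 - A i j).toNat (gen K (.y i)) (gen K (.y j))) 0

/-- The quantum group `U_q(𝔤)` (as an associative unital algebra). -/
abbrev Uq (A : Matrix I I ℤ) (q : I → K) := RingQuot (Rel A q)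

section Generators

variable (A : Matrix I I ℤ) (q : I → K)

/-- The projection from the free algebra. -/
def proj : FreeU I K →ₐ[K] Uq A q := RingQuot.mkAlgHom K (Rel A q)

/-- The generator `x_i`. -/
def xGen (i : I) : Uq A q := proj A q (gen K (.x i))

/-- The generator `y_i`. -/
def yGen (i : I) : Uq A q := proj A q (gen K (.y i))

/-- The invertible generator `k_i`. -/
def kGen (i : I) : (Uq A q)ˣ where
  val := proj A q (gen K (.k i))
  inv := proj A q (gen K (.kinv i))
  val_inv := by
    rw [← map_mul, ← map_one (proj A q)]; exact RingQuot.mkAlgHom_rel K (Rel.k_kinv i)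
  inv_val := by
    rw [← map_mul, ← map_one (proj A q)]; exact RingQuot.mkAlgHom_rel K (Rel.kinv_k i)

end Generators

variable {A : Matrix I I ℤ} {q : I → K}

/-- Algebra homomorphisms out of `U_q(𝔤)` are determined by the images of `x_i`, `y_i`, `k_i`. -/
theorem hom_ext {U : Type*} [Ring U] [Algebra K U] {f g : Uq A q →ₐ[K] U}
    (hx : ∀ i, f (xGen A q i) = g (xGen A q i)) (hy : ∀ i, f (yGen A q i) = g (yGen A q i))
    (hk : ∀ i, f (kGen A q i : Uq A q) = g (kGen A q i : Uq A q)) : f = g := by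
  apply RingQuot.ringQuot_ext'
  apply FreeAlgebra.hom_ext
  funext a
  cases a with
  | x i => exact hx i
  | y i => exact hy i
  | k i => exact hk i
  | kinv i =>
    have h : Units.map (f : Uq A q →* U) (kGen A q i) =
        Units.map (g : Uq A q →* U) (kGen A q i) := Units.ext (hk i)
    have h2 := congrArg (fun u : Uˣ => ((u⁻¹ : Uˣ) : U)) h
    exact (by simpa using h2 : f ((kGen A q i)⁻¹ : (Uq A q)ˣ).val = g ((kGen A q i)⁻¹ : (Uq A q)ˣ).val)

/-! ### The automorphisms `Ad(χ)` -/

/-- Characters `χ ∈ Hom(Q, K^×)` of the root lattice. -/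
abbrev Character (I K : Type*) [Field K] := Multiplicative (I → ℤ) →* Kˣ

/-- The value `χ(α_i)`. -/
def Character.val (χ : Character I K) (i : I) : Kˣ := χ (Multiplicative.ofAdd (Pi.single i 1))

theorem divPow_smul {U : Type*} [Ring U] [Algebra K U] (p : K) (z : K) (a : U) (r : ℕ) :
    divPow p (z • a) r = z ^ r • divPow p a r := by
  simp only [divPow, smul_pow, smul_comm (z ^ r)]

theorem serre_smul {U : Type*} [Ring U] [Algebra K U] (p : K) (m : ℕ) (z w : K) (a b : U) :
    serre p m (z • a) (w • b) = (z ^ m * w) • serre p m a b := by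
  simp only [serre, Finset.smul_sum]
  refine Finset.sum_congr rfl fun r hr => ?_
  have hr' : m - r + r = m := Nat.sub_add_cancel (Nat.lt_succ_iff.mp (Finset.mem_range.mp hr))
  simp only [divPow_smul, mul_smul_comm, smul_mul_assoc, smul_smul]
  congr 1
  have hz : z ^ m = z ^ (m - r) * z ^ r := by rw [← pow_add, hr']
  rw [hz]; ring

theorem map_serre {U V : Type*} [Ring U] [Algebra K U] [Ring V] [Algebra K V] (f : U →ₐ[K] V)
    (p : K) (m : ℕ) (a b : U) : f (serre p m a b) = serre p m (f a) (f b) := by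
  simp [serre, divPow]

/-- `Ad(χ)` on generators. -/
def adGen (χ : Character I K) : Gen I → Uq A q
  | .x i => (χ.val i : K) • xGen A q i
  | .y i => ((χ.val i)⁻¹ : Kˣ).val • yGen A q i
  | .k i => (kGen A q i : Uq A q)
  | .kinv i => ((kGen A q i)⁻¹ : (Uq A q)ˣ).val

theorem proj_rel {a b : FreeU I K} (h : Rel A q a b) : proj A q a = proj A q b :=
  RingQuot.mkAlgHom_rel K h

theorem adGen_rel (χ : Character I K) {a b : FreeU I K} (h : Rel A q a b) :
    FreeAlgebra.lift K (adGen (A := A) (q := q) χ) a =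
      FreeAlgebra.lift K (adGen (A := A) (q := q) χ) b := by
  induction h with
  | k_kinv i => simp [adGen]
  | kinv_k i => simp [adGen]
  | k_comm i j =>
    have := proj_rel (Rel.k_comm (A := A) (q := q) i j)
    simpa [adGen, kGen] using this
  | k_x i j =>
    have := proj_rel (Rel.k_x (A := A) (q := q) i j)
    simp only [map_mul, map_smul] at this
    simp only [map_mul, map_smul, FreeAlgebra.lift_ι_apply, adGen, mul_smul_comm, smul_mul_assoc,
      kGen, xGen, this]
    rw [smul_comm]
  | k_y i j =>
    have := proj_rel (Rel.k_y (A := A) (q := q) i j)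
    simp only [map_mul, map_smul] at this
    simp only [map_mul, map_smul, FreeAlgebra.lift_ι_apply, adGen, mul_smul_comm, smul_mul_assoc,
      kGen, yGen, this]
    rw [smul_comm]
  | x_y_self i =>
    have := proj_rel (Rel.x_y_self (A := A) (q := q) i)
    simp only [map_mul, map_smul, map_sub] at this
    simp only [map_mul, map_smul, map_sub, FreeAlgebra.lift_ι_apply, adGen, mul_smul_comm,
      smul_mul_assoc, smul_smul, Units.mul_inv, Units.inv_mul, one_smul]
    exact this
  | x_y_ne i j h =>
    have := proj_rel (Rel.x_y_ne (A := A) (q := q) i j h)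
    simp only [map_mul, map_sub, map_zero] at this
    simp only [map_mul, map_sub, map_zero, FreeAlgebra.lift_ι_apply, adGen, mul_smul_comm,
      smul_mul_assoc, smul_smul]
    have h0 : xGen A q i * yGen A q j = yGen A q j * xGen A q i := sub_eq_zero.mp this
    rw [h0, mul_comm (χ.val i : K), sub_self]
  | serre_x i j h =>
    have := proj_rel (Rel.serre_x (A := A) (q := q) i j h)
    rw [map_serre, map_zero] at this
    rw [map_serre, map_zero, FreeAlgebra.lift_ι_apply, FreeAlgebra.lift_ι_apply]
    simp only [adGen]
    rw [serre_smul]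
    exact (congrArg _ this).trans (smul_zero _)
  | serre_y i j h =>
    have := proj_rel (Rel.serre_y (A := A) (q := q) i j h)
    rw [map_serre, map_zero] at this
    rw [map_serre, map_zero, FreeAlgebra.lift_ι_apply, FreeAlgebra.lift_ι_apply]
    simp only [adGen]
    rw [serre_smul]
    exact (congrArg _ this).trans (smul_zero _)

/-- `Ad(χ)` as an algebra homomorphism: `x_i ↦ χ(α_i) x_i`, `y_i ↦ χ(α_i)⁻¹ y_i`, `k_i ↦ k_i`. -/
def adHom (A : Matrix I I ℤ) (q : I → K) (χ : Character I K) : Uq A q →ₐ[K] Uq A q :=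
  RingQuot.liftAlgHom K ⟨FreeAlgebra.lift K (adGen χ), fun _ _ h => adGen_rel χ h⟩

theorem adHom_x (χ : Character I K) (i : I) :
    adHom A q χ (xGen A q i) = (χ.val i : K) • xGen A q i := by
  simp [adHom, xGen, proj, adGen]

theorem adHom_y (χ : Character I K) (i : I) :
    adHom A q χ (yGen A q i) = ((χ.val i)⁻¹ : Kˣ).val • yGen A q i := by
  simp [adHom, yGen, proj, adGen]

theorem adHom_k (χ : Character I K) (i : I) :
    adHom A q χ (kGen A q i : Uq A q) = (kGen A q i : Uq A q) := by
  simp [adHom, kGen, proj, adGen]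

theorem adHom_comp_inv (χ ξ : Character I K) (h : ∀ i, χ.val i * ξ.val i = 1) :
    (adHom A q χ).comp (adHom A q ξ) = AlgHom.id K (Uq A q) := by
  have hK : ∀ i, (ξ.val i : K) * (χ.val i : K) = 1 := fun i => by
    rw [mul_comm, ← Units.val_mul, h i, Units.val_one]
  have hK' : ∀ i, ((ξ.val i)⁻¹ : Kˣ).val * ((χ.val i)⁻¹ : Kˣ).val = 1 := fun i => by
    rw [← Units.val_mul, ← mul_inv, mul_comm, h i, inv_one, Units.val_one]
  apply hom_ext
  · intro i; simp only [AlgHom.comp_apply, adHom_x, map_smul, smul_smul, hK, one_smul, AlgHom.id_apply]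
  · intro i; simp only [AlgHom.comp_apply, adHom_y, map_smul, smul_smul, hK', one_smul, AlgHom.id_apply]
  · intro i; simp only [AlgHom.comp_apply, adHom_k, AlgHom.id_apply]

/-- The automorphism `Ad(χ)` of `U_q(𝔤)`. -/
def Ad (A : Matrix I I ℤ) (q : I → K) (χ : Character I K) : Uq A q ≃ₐ[K] Uq A q :=
  AlgEquiv.ofAlgHom (adHom A q χ) (adHom A q χ⁻¹)
    (adHom_comp_inv χ χ⁻¹ fun i => by simp [Character.val])
    (adHom_comp_inv χ⁻¹ χ fun i => by simp [Character.val])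

/-- Subalgebras `B`, `B'` are `Ad(H̃_q)`-equivalent if `Ad(χ)(B) = B'` for some character `χ`. -/
def AdEquivalent (B B' : Subalgebra K (Uq A q)) : Prop :=
  ∃ χ : Character I K, B.map (Ad A q χ : Uq A q →ₐ[K] Uq A q) = B'

/-! ### The automorphisms `ω_q`, `σ`, `T_i`, `θ_q` -/

open Classical in
/-- The algebra endomorphism of `U_q(𝔤)` with the prescribed values on the generators
`x_i`, `y_i`, `k_i`. It is unique by `hom_ext`; below this is used only for assignments that
are well known to extend to algebra automorphisms (the value when there is no such
endomorphism is irrelevant). -/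
def homWithValues (A : Matrix I I ℤ) (q : I → K) (fx fy fk : I → Uq A q) :
    Uq A q →ₐ[K] Uq A q :=
  if h : ∃ φ : Uq A q →ₐ[K] Uq A q, ∀ i, φ (xGen A q i) = fx i ∧ φ (yGen A q i) = fy i ∧
      φ (kGen A q i : Uq A q) = fk i
  then h.choose else AlgHom.id K (Uq A q)

/-- `ω_q`: `x_i ↦ -k_i⁻¹ y_i`, `y_i ↦ -x_i k_i`, `k_i ↦ k_i⁻¹`. -/
def omegaQ (A : Matrix I I ℤ) (q : I → K) : Uq A q →ₐ[K] Uq A q :=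
  homWithValues A q (fun i => -(((kGen A q i)⁻¹ : (Uq A q)ˣ).val * yGen A q i))
    (fun i => -(xGen A q i * (kGen A q i).val)) (fun i => ((kGen A q i)⁻¹ : (Uq A q)ˣ).val)

/-- A diagram automorphism `σ`: `x_i ↦ x_{σ(i)}`, `y_i ↦ y_{σ(i)}`, `k_i ↦ k_{σ(i)}`. -/
def sigmaQ (A : Matrix I I ℤ) (q : I → K) (σ : Equiv.Perm I) : Uq A q →ₐ[K] Uq A q :=
  homWithValues A q (fun i => xGen A q (σ i)) (fun i => yGen A q (σ i))
    (fun i => (kGen A q (σ i)).val)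

/-- Lusztig's automorphism `T_i = T''_{i,1}`. -/
def lusztigT (A : Matrix I I ℤ) (q : I → K) (i : I) : Uq A q →ₐ[K] Uq A q :=
  homWithValues A q
    (fun j => if j = i then -(yGen A q i * (kGen A q i).val)
      else ∑ r ∈ Finset.range ((-A i j).toNat + 1), ((-q i)⁻¹) ^ r •
        (divPow (q i) (xGen A q i) ((-A i j).toNat - r) * xGen A q j *
          divPow (q i) (xGen A q i) r))
    (fun j => if j = i then -(((kGen A q i)⁻¹ : (Uq A q)ˣ).val * xGen A q i)
      else ∑ r ∈ Finset.range ((-A i j).toNat + 1), (-q i) ^ r •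
        (divPow (q i) (yGen A q i) r * yGen A q j *
          divPow (q i) (yGen A q i) ((-A i j).toNat - r)))
    (fun j => (kGen A q j * kGen A q i ^ (-A i j) : (Uq A q)ˣ).val)

/-- `T_{i_1} ∘ ⋯ ∘ T_{i_ℓ}` for a word `[i_1, …, i_ℓ]`. -/
def lusztigWord (A : Matrix I I ℤ) (q : I → K) (ws : List I) : Uq A q →ₐ[K] Uq A q :=
  ws.foldr (fun i φ => (lusztigT A q i).comp φ) (AlgHom.id K (Uq A q))

section Coideal

variable [Fintype I]

/-- `θ_q = T_{w_X} τ ω_q`. -/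
def thetaQ (A : Matrix I I ℤ) (q : I → K) (X : Finset I) (τ : Equiv.Perm I) :
    Uq A q →ₐ[K] Uq A q :=
  (lusztigWord A q (longestWord A X)).comp ((sigmaQ A q τ).comp (omegaQ A q))

/-! ### Quantum pair algebras -/

/-- `U_q(𝔥) = ⟨k_i^{±1}⟩`. -/
def Uh (A : Matrix I I ℤ) (q : I → K) : Subalgebra K (Uq A q) :=
  Algebra.adjoin K
    (Set.range (fun i => (kGen A q i).val) ∪
      Set.range (fun i => ((kGen A q i)⁻¹ : (Uq A q)ˣ).val))

/-- The fixed-point subalgebra `U_q(𝔥)^{θ_q}`. -/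
def UhTheta (A : Matrix I I ℤ) (q : I → K) (X : Finset I) (τ : Equiv.Perm I) :
    Subalgebra K (Uq A q) :=
  Uh A q ⊓ AlgHom.equalizer (thetaQ A q X τ) (AlgHom.id K (Uq A q))

/-- The generator `b_i`: `y_i` if `i ∈ X`, and `y_i + c_i θ_q(y_i k_i) k_i⁻¹ - s_i k_i⁻¹`
otherwise. Tuples indexed by `I \ X` are given as functions on `I`; their values on `X` are
never used. -/
def bGen (A : Matrix I I ℤ) (q : I → K) (X : Finset I) (τ : Equiv.Perm I) (c s : I → K) (i : I) :
    Uq A q :=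
  if i ∈ X then yGen A q i
  else yGen A q i
    + c i • (thetaQ A q X τ (yGen A q i * (kGen A q i).val) * ((kGen A q i)⁻¹ : (Uq A q)ˣ).val)
    - s i • ((kGen A q i)⁻¹ : (Uq A q)ˣ).val

/-- The subalgebra `B_{c,s} = ⟨U_q(𝔫_X^+), U_q(𝔥)^{θ_q}, {b_i}⟩`. -/
def Bcs (A : Matrix I I ℤ) (q : I → K) (X : Finset I) (τ : Equiv.Perm I) (c s : I → K) :
    Subalgebra K (Uq A q) :=
  Algebra.adjoin K
    (xGen A q '' (X : Set I) ∪ (UhTheta A q X τ : Set (Uq A q)) ∪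
      Set.range (bGen A q X τ c s))

/-- The parameter set `𝒞 ⊆ (K^×)^{I \ X}`. -/
def CSet (K : Type*) [Field K] (A : Matrix I I ℤ) (d : I → ℚ) (X : Finset I)
    (τ : Equiv.Perm I) (Istar : Finset I) : Set (I → K) :=
  {c | (∀ j ∉ X, c j ≠ 0) ∧ ∀ j ∈ Istar, c j ≠ c (τ j) → j ∈ Idiff A d X τ Istar}

/-- The parameter set `𝒮 ⊆ K^{I \ X}`: `s_j = 0` for all `j ∈ I \ X` not in `I_nsf`. -/
def SSet (K : Type*) [Field K] (A : Matrix I I ℤ) (X : Finset I)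
    (τ : Equiv.Perm I) (Istar : Finset I) : Set (I → K) :=
  {s | ∀ j ∉ X, s j ≠ 0 → j ∈ Insf A X τ Istar}

/-! ### The normalised family with free parameters indexed by `I_diff ∪ I_nsf` -/

/-- Values of the free parameters: one scalar for every `j ∈ I_diff ∪ I_nsf`, nonzero if
`j ∈ I_diff` (where it is the value of `c_{τ(j)}`), arbitrary if `j ∈ I_nsf` (where it is the value
of `s_j`). -/
def FreeParams (K : Type*) [Field K] (A : Matrix I I ℤ) (d : I → ℚ) (X : Finset I)
    (τ : Equiv.Perm I) (Istar : Finset I) : Type _ :=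
  {p : ↥(Idiff A d X τ Istar ∪ Insf A X τ Istar) → K //
    ∀ j : ↥(Idiff A d X τ Istar ∪ Insf A X τ Istar), j.1 ∈ Idiff A d X τ Istar → p j ≠ 0}

namespace FreeParams

variable {A : Matrix I I ℤ} {d : I → ℚ} {X : Finset I} {τ : Equiv.Perm I} {Istar : Finset I}

/-- The tuple `c` with `c_{τ(j)} = p_j` for `j ∈ I_diff` and all other entries equal to `1`. -/
def cTuple (p : FreeParams K A d X τ Istar) : I → K := fun i =>
  if h : τ i ∈ Idiff A d X τ Istar then p.1 ⟨τ i, Finset.mem_union_left _ h⟩ else 1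

/-- The tuple `s` with `s_j = p_j` for `j ∈ I_nsf` and all other entries equal to `0`. -/
def sTuple (p : FreeParams K A d X τ Istar) : I → K := fun i =>
  if h : i ∈ Insf A X τ Istar then p.1 ⟨i, Finset.mem_union_right _ h⟩ else 0

end FreeParams

end Coideal

end QuantumGroup

/-! ### The classical untwisted affine case -/

namespace ClassicalType

/-- The symmetrizing numbers `d_i`. -/
def dNum (t : ClassicalType) (n : ℕ) (i : Fin (n + 1)) : ℚ := (twiceD t n i : ℚ) / 2

/-- `q_i = q^{d_i}`, in terms of a square root `v = q^{1/2}`. -/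
def qParam {K : Type*} [Field K] (t : ClassicalType) (n : ℕ) (v : K) (i : Fin (n + 1)) : K :=
  v ^ twiceD t n i

end ClassicalType

end QuantumPair

end

/-! The statement has two independent halves.

Normalisation of the parameters. Let χ be trivial on α_i for i in X. Then Ad(χ) fixes every k_i,
fixes x_i for i in X, and commutes with the Lusztig operators T_i for i in X. Since θ_q(y_i k_i) =
-T_{w_X}(x_{τ(i)}), it sends b_i to χ(α_i)⁻¹ times the generator with c_i replaced by c_i χ(α_i)
χ(α_{τ(i)}) and s_i by s_i χ(α_i) (`adHom_bGen`, `map_Ad_Bcs`). Take χ(α_j) to be a square root of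
c_j⁻¹ at τ-fixed j in I^*, c_j⁻¹ at the other j in I^*, and 1 elsewhere. All c_j with j in I^*
become 1, and c_{τ(j)} becomes c_{τ(j)}/c_j, which can differ from 1 only for j in I_diff
(`exists_adEquivalent`).

The bound |I_diff ∪ I_nsf| ≤ 2. It is proved for a weaker, purely combinatorial notion
(`IsFreeNode`): no three free nodes lie in distinct τ-orbits. Two obstructions carry the argument.
(1) A part of X not joined to the rest of X is τ-stable, because w_X preserves its span
(`IsGSat.map_mem_of_separated`). Hence τ cannot exchange two separated parts of X. (2) Let i be a
τ-fixed node outside X, joined to X only at the end of a simply laced run of m τ-fixed nodes of X.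
Then w_X negates the simple roots of the run, and the coefficients of w_X(α_i) along it solve a
discrete Laplace equation whose integrality forces m = 1. That case is the one forbidden by the last
axiom of a generalized Satake diagram (`IsGSat.exists_other_neighbour`, `IsGSat.no_path`). A τ-fixed
neighbour i of an I_nsf node j with a_ij odd is outside X but joined to X, so it starts a
configuration as in (2). Where τ acts as a reflection or a half turn, (1) applies. The bound follows
by running through the involutive automorphisms of each affine diagram. -/

namespace QuantumPair

set_option linter.unusedSectionVars false

/-! ### The action of w_X on the root lattice -/

section WeylGroup

variable {I : Type*} [Fintype I] [DecidableEq I]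

/-- The pairing of the simple coroot `α_i^∨` with `μ`. -/
def corootPair (A : Matrix I I ℤ) (i : I) (μ : I → ℤ) : ℤ := ∑ j, A i j * μ j

theorem simpleReflection_apply (A : Matrix I I ℤ) (i : I) (μ : I → ℤ) (l : I) :
    simpleReflection A i μ l = μ l - if l = i then corootPair A i μ else 0 := by
  simp [simpleReflection, simpleRoot, corootPair, Pi.single_apply]

theorem simpleReflection_eq (A : Matrix I I ℤ) (i : I) (μ : I → ℤ) :
    simpleReflection A i μ = μ - corootPair A i μ • simpleRoot i := rfl

theorem corootPair_simpleRoot (A : Matrix I I ℤ) (i j : I) :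
    corootPair A i (simpleRoot j) = A i j := by
  simp [corootPair, simpleRoot, Pi.single_apply]

theorem rootForm_add_left (A : Matrix I I ℤ) (d : I → ℚ) (μ ν ξ : I → ℤ) :
    rootForm A d (μ + ν) ξ = rootForm A d μ ξ + rootForm A d ν ξ := by
  simp only [rootForm, ← Finset.sum_add_distrib]
  refine Finset.sum_congr rfl fun i _ => Finset.sum_congr rfl fun j _ => ?_
  simp only [Pi.add_apply]; push_cast; ring

theorem rootForm_smul_left (A : Matrix I I ℤ) (d : I → ℚ) (m : ℤ) (μ ν : I → ℤ) :
    rootForm A d (m • μ) ν = m * rootForm A d μ ν := by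
  simp only [rootForm, Finset.mul_sum]
  refine Finset.sum_congr rfl fun i _ => Finset.sum_congr rfl fun j _ => ?_
  simp only [Pi.smul_apply, smul_eq_mul]; push_cast; ring

theorem rootForm_symm {A : Matrix I I ℤ} {d : I → ℚ} (hd : ∀ i j, d i * A i j = d j * A j i)
    (μ ν : I → ℤ) : rootForm A d μ ν = rootForm A d ν μ := by
  rw [rootForm, rootForm, Finset.sum_comm]
  refine Finset.sum_congr rfl fun i _ => Finset.sum_congr rfl fun j _ => ?_
  rw [hd]; ring

theorem rootForm_simpleRoot_left (A : Matrix I I ℤ) (d : I → ℚ) (i : I) (ν : I → ℤ) :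
    rootForm A d (simpleRoot i) ν = d i * corootPair A i ν := by
  simp only [rootForm, simpleRoot, corootPair]
  rw [Finset.sum_eq_single i]
  · push_cast
    rw [Finset.mul_sum]
    refine Finset.sum_congr rfl fun j _ => ?_
    simp [mul_assoc]
  · intro b _ hb; simp [hb]
  · simp

theorem rootForm_neg_left (A : Matrix I I ℤ) (d : I → ℚ) (μ ν : I → ℤ) :
    rootForm A d (-μ) ν = -rootForm A d μ ν := by
  have := rootForm_smul_left A d (-1) μ ν
  simpa using this

theorem rootForm_simpleReflection {A : Matrix I I ℤ} {d : I → ℚ}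
    (hd : ∀ i j, d i * A i j = d j * A j i) (h2 : ∀ i, A i i = 2) (i : I) (μ ν : I → ℤ) :
    rootForm A d (simpleReflection A i μ) (simpleReflection A i ν) = rootForm A d μ ν := by
  have key : ∀ μ ν : I → ℤ, rootForm A d (simpleReflection A i μ) ν =
      rootForm A d μ ν - corootPair A i μ * (d i * corootPair A i ν) := fun μ ν => by
    rw [simpleReflection_eq, sub_eq_add_neg, rootForm_add_left, rootForm_neg_left,
      rootForm_smul_left, rootForm_simpleRoot_left]; ring
  have hc : corootPair A i (simpleReflection A i ν) = -corootPair A i ν := by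
    have : corootPair A i (simpleReflection A i ν) =
        corootPair A i ν - A i i * corootPair A i ν := by
      conv_lhs => rw [corootPair]
      simp only [simpleReflection_apply, mul_sub, Finset.sum_sub_distrib]
      simp [corootPair]
    rw [this, h2]; ring
  rw [key, hc, rootForm_symm hd μ, key, rootForm_symm hd ν]; push_cast; ring

theorem longestWord_mem {A : Matrix I I ℤ} {X : Finset I} : ∀ i ∈ longestWord A X, i ∈ X := by
  unfold longestWord
  split_ifs with h
  · exact h.choose_spec.1.1
  · simp

/-- A property of endomorphisms which is stable under left multiplication by the simple
reflections of `W_X` holds for the longest element. -/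
theorem longestElt_induction {A : Matrix I I ℤ} {X : Finset I}
    {P : Module.End ℤ (I → ℤ) → Prop} (h1 : P 1)
    (hs : ∀ i ∈ X, ∀ f, P f → P (simpleReflection A i * f)) : P (longestElt A X) := by
  have : ∀ ws : List I, (∀ i ∈ ws, i ∈ X) → P (wordProd A ws) := by
    intro ws
    induction ws with
    | nil => intro _; simpa [wordProd] using h1
    | cons a ws ih =>
      intro h
      have h' := hs a (h a (by simp)) _ (ih fun i hi => h i (by simp [hi]))
      simpa [wordProd] using h'
  exact this _ longestWord_mem

/-- Each simple reflection is an isometry of the symmetrised form. This transfers knowledge of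
w_X(α_k) to the coroot pairings of w_X(μ). -/
theorem rootForm_longestElt {A : Matrix I I ℤ} {d : I → ℚ} (X : Finset I)
    (hd : ∀ i j, d i * A i j = d j * A j i) (h2 : ∀ i, A i i = 2) (μ ν : I → ℤ) :
    rootForm A d (longestElt A X μ) (longestElt A X ν) = rootForm A d μ ν := by
  refine longestElt_induction (P := fun f => rootForm A d (f μ) (f ν) = rootForm A d μ ν) rfl ?_
  intro i _ f hf
  rw [Module.End.mul_apply, Module.End.mul_apply, rootForm_simpleReflection hd h2, hf]

theorem longestElt_apply_of_notMem (A : Matrix I I ℤ) (X : Finset I) (μ : I → ℤ) {l : I}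
    (hl : l ∉ X) : longestElt A X μ l = μ l := by
  refine longestElt_induction (P := fun f => f μ l = μ l) rfl ?_
  intro i hi f hf
  have : l ≠ i := fun h => hl (h ▸ hi)
  rw [Module.End.mul_apply, simpleReflection_apply, hf, if_neg this, sub_zero]

theorem longestElt_eq_self (A : Matrix I I ℤ) (X : Finset I) (μ : I → ℤ)
    (h : ∀ i ∈ X, corootPair A i μ = 0) : longestElt A X μ = μ := by
  refine longestElt_induction (P := fun f => f μ = μ) rfl ?_
  intro i hi f hf
  rw [Module.End.mul_apply, hf, simpleReflection_eq, h i hi, zero_smul, sub_zero]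

/-- If no node of `X \ S` is joined to `S`, then `w_X` preserves the span of `S`. -/
theorem longestElt_support {A : Matrix I I ℤ} {X : Finset I} (S : I → Prop)
    (hS : ∀ k ∈ X, ¬ S k → ∀ l, S l → A k l = 0) (μ : I → ℤ) (hμ : ∀ l, ¬ S l → μ l = 0) (l : I)
    (hl : ¬ S l) : longestElt A X μ l = 0 := by
  revert l
  refine longestElt_induction (P := fun f => ∀ l, ¬ S l → f μ l = 0) hμ ?_
  intro i hi f hf l hl
  rw [Module.End.mul_apply, simpleReflection_apply, hf l hl]
  split_ifs with h
  · subst h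
    have : corootPair A l (f μ) = 0 := by
      refine Finset.sum_eq_zero fun j _ => ?_
      by_cases hj : S j
      · rw [hS l hi hl j hj, zero_mul]
      · rw [hf j hj, mul_zero]
    rw [this, sub_zero]
  · simp

theorem permRoot_simpleRoot (τ : Equiv.Perm I) (i : I) :
    permRoot τ (simpleRoot i) = simpleRoot (τ i) := by
  funext l
  simp only [permRoot, simpleRoot, LinearMap.funLeft_apply, Pi.single_apply]
  simp only [Equiv.symm_apply_eq]

theorem theta_simpleRoot (A : Matrix I I ℤ) (X : Finset I) (τ : Equiv.Perm I) (i : I) :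
    theta A X τ (simpleRoot i) = -longestElt A X (simpleRoot (τ i)) := by
  simp [theta, Module.End.mul_apply, permRoot_simpleRoot]

end WeylGroup

/-! ### Two obstructions coming from generalized Satake diagrams -/

section GSat

variable {I : Type*} [Fintype I] [DecidableEq I] {A : Matrix I I ℤ} {X : Finset I}
  {τ : Equiv.Perm I}

theorem simpleRoot_self (i : I) : simpleRoot i i = 1 := by simp [simpleRoot]

theorem simpleRoot_ne {i j : I} (h : j ≠ i) : simpleRoot i j = 0 := by simp [simpleRoot, h]

/-- A subset `S` of `X` which is not joined to the rest of `X` is stable under `τ`. -/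
theorem IsGSat.map_mem_of_separated (hG : IsGSat A X τ) (S : I → Prop)
    (hS : ∀ k ∈ X, ¬ S k → ∀ l, S l → A k l = 0) {i : I} (hi : i ∈ X) (hiS : S i) : S (τ i) := by
  by_contra hn
  have h1 := longestElt_support S hS (simpleRoot i)
    (fun l hl => simpleRoot_ne fun h => hl (h ▸ hiS)) (τ i) hn
  have h2 := congrFun (hG.neg_longest i hi) (τ i)
  rw [Pi.neg_apply, h1, simpleRoot_self] at h2
  norm_num at h2

theorem IsGSat.map_mem (hG : IsGSat A X τ) {i : I} (hi : i ∈ X) : τ i ∈ X :=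
  hG.map_mem_of_separated (fun l => l ∈ X) (fun _ hk hn => absurd hk hn) hi hi

theorem IsGSat.map_notMem (hG : IsGSat A X τ) {i : I} (hi : i ∉ X) : τ i ∉ X := fun h =>
  hi (by simpa [hG.involutive] using hG.map_mem h)

theorem IsGSat.entry_map_right (hG : IsGSat A X τ) (i j : I) : A i (τ j) = A (τ i) j := by
  rw [← hG.diagramAut i (τ j), hG.involutive]

/-- A `τ`-fixed node outside `X` is not joined to `X` only by a single simple edge to an
isolated node of `X`. -/
theorem IsGSat.exists_other_neighbour (hG : IsGSat A X τ) (h2 : ∀ i, A i i = 2) {i k : I}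
    (hi : i ∉ X) (hτi : τ i = i) (hk : k ∈ X) (hiso : ∀ l ∈ X, l ≠ k → A l k = 0)
    (hki : A k i = -1) (hik : A i k = -1) : ∃ l ∈ X, l ≠ k ∧ A l i ≠ 0 := by
  by_contra! hcon
  have hne : i ≠ k := fun h => hi (h ▸ hk)
  -- Among the reflections of W_X only r_k acts nontrivially on the span of α_i and α_k. So w_X
  -- restricts there to 1 or to r_k.
  have key : (longestElt A X (simpleRoot i) = simpleRoot i ∧
        longestElt A X (simpleRoot k) = simpleRoot k) ∨
      (longestElt A X (simpleRoot i) = simpleRoot k + simpleRoot i ∧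
        longestElt A X (simpleRoot k) = -simpleRoot k) := by
    refine longestElt_induction (P := fun f => (f (simpleRoot i) = simpleRoot i ∧
        f (simpleRoot k) = simpleRoot k) ∨
      (f (simpleRoot i) = simpleRoot k + simpleRoot i ∧
        f (simpleRoot k) = -simpleRoot k)) (Or.inl ⟨rfl, rfl⟩) ?_
    intro l hl f hf
    simp only [Module.End.mul_apply]
    by_cases hlk : l = k
    · subst hlk
      have e1 : simpleReflection A l (simpleRoot i) = simpleRoot l + simpleRoot i := by
        rw [simpleReflection_eq, corootPair_simpleRoot, hki]; module
      have e2 : simpleReflection A l (simpleRoot l) = -simpleRoot l := by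
        rw [simpleReflection_eq, corootPair_simpleRoot, h2]; module
      rcases hf with ⟨f1, f2⟩ | ⟨f1, f2⟩
      · right; rw [f1, f2, e1, e2]; exact ⟨rfl, rfl⟩
      · left; rw [f1, f2, map_add, map_neg, e1, e2]; constructor <;> abel
    · have e1 : simpleReflection A l (simpleRoot i) = simpleRoot i := by
        rw [simpleReflection_eq, corootPair_simpleRoot, hcon l hl hlk]; module
      have e2 : simpleReflection A l (simpleRoot k) = simpleRoot k := by
        rw [simpleReflection_eq, corootPair_simpleRoot, hiso l hl hlk]; module
      rcases hf with ⟨f1, f2⟩ | ⟨f1, f2⟩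
      · left; rw [f1, f2, e1, e2]; exact ⟨rfl, rfl⟩
      · right; rw [f1, f2, map_add, map_neg, e1, e2]; exact ⟨rfl, rfl⟩
  rcases key with ⟨_, h⟩ | ⟨h, _⟩
  -- If w_X fixed α_k, then -α_k would be the simple root α_{τ(k)}. In the other case θ(α_i) = -(α_k
  -- + α_i), which the axiom forbids when a_ik = -1.
  · have h3 := congrFun (hG.neg_longest k hk) k
    rw [h, Pi.neg_apply, simpleRoot_self, simpleRoot, Pi.single_apply] at h3
    split_ifs at h3
  · refine hG.gsat k hk i hi ?_ hik
    rw [theta_simpleRoot, hτi, h]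

/-- For a `τ`-fixed node `k` of `X`, the coroot `α_k^∨` is negated by `w_X`. -/
theorem IsGSat.corootPair_longestElt (hG : IsGSat A X τ) {d : I → ℚ}
    (hd : ∀ i j, d i * A i j = d j * A j i) (hpos : ∀ i, d i ≠ 0) (h2 : ∀ i, A i i = 2) {k : I}
    (hk : k ∈ X) (hτk : τ k = k) (μ : I → ℤ) :
    corootPair A k (longestElt A X μ) = -corootPair A k μ := by
  have h := rootForm_longestElt X hd h2 (simpleRoot k) μ
  have h' : longestElt A X (simpleRoot k) = -simpleRoot k := by
    rw [← neg_eq_iff_eq_neg, hG.neg_longest k hk, hτk]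
  rw [h', rootForm_neg_left, rootForm_simpleRoot_left, rootForm_simpleRoot_left] at h
  have h3 : d k * (-(corootPair A k (longestElt A X μ) : ℚ)) = d k * corootPair A k μ := by
    rw [← h]; ring
  have h4 := mul_left_cancel₀ (hpos k) h3
  have h5 : -corootPair A k (longestElt A X μ) = corootPair A k μ := by exact_mod_cast h4
  omega

/-- From the right end u is linear, u (m + 1 - t) = t · u m. Inserting this into the equation at 1
gives (m + 1) · u m = 2, so m + 1 divides 2. -/
theorem second_difference_solution {m : ℕ} (u : ℕ → ℤ) (hm : 1 ≤ m) (h0 : u 0 = 1)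
    (hend : u (m + 1) = 0) (h1 : 2 * u 1 - u 0 - u 2 = 1)
    (hk : ∀ k, 2 ≤ k → k ≤ m → 2 * u k - u (k - 1) - u (k + 1) = 0) : m = 1 := by
  have hrec : ∀ t, t + 1 ≤ m → u (m + 1 - t) = t * u m ∧ u (m - t) = (t + 1) * u m := by
    intro t
    induction t with
    | zero => intro _; simp [hend]
    | succ t ih =>
      intro ht
      obtain ⟨ha, hb⟩ := ih (by omega)
      have h := hk (m - t) (by omega) (by omega)
      have e1 : m - t - 1 = m - (t + 1) := by omega
      have e2 : m - t + 1 = m + 1 - t := by omega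
      have e3 : m + 1 - (t + 1) = m - t := by omega
      rw [e1, e2, ha, hb] at h
      rw [e3, hb]
      push_cast
      exact ⟨rfl, by linarith⟩
  obtain ⟨ha, hb⟩ := hrec (m - 1) (by omega)
  have e1 : m + 1 - (m - 1) = 2 := by omega
  have e2 : m - (m - 1) = 1 := by omega
  rw [e1] at ha; rw [e2] at hb
  have e3 : ((m - 1 : ℕ) : ℤ) = m - 1 := by push_cast [hm]; ring
  rw [e3] at ha hb
  rw [ha, hb, h0] at h1
  have h3 : ((m : ℤ) + 1) * u m = 2 := by linarith
  have h4 : ((m : ℤ) + 1) ∣ 2 := ⟨_, h3.symm⟩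
  have := Int.le_of_dvd (by norm_num) h4
  omega

/-- A `τ`-fixed node outside `X` whose only neighbour in `X` is the end of a simply laced path of
`τ`-fixed nodes, which leaves `X` again and has no further neighbours in `X`, cannot exist. -/
theorem IsGSat.no_path (hG : IsGSat A X τ) {d : I → ℚ}
    (hd : ∀ i j, d i * A i j = d j * A j i) (hpos : ∀ i, d i ≠ 0) (h2 : ∀ i, A i i = 2)
    (N : ℕ) (hN2 : 2 ≤ N) (p : ℕ → I) (hinj : ∀ a b, a ≤ N → b ≤ N → p a = p b → a = b)
    (h0 : p 0 ∉ X) (h1 : p 1 ∈ X) (hN : p N ∉ X) (hfix : ∀ k, k < N → τ (p k) = p k)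
    (hedge : ∀ k, k + 1 < N → A (p k) (p (k + 1)) = -1 ∧ A (p (k + 1)) (p k) = -1)
    (hnbr0 : ∀ l ∈ X, A l (p 0) ≠ 0 → l = p 1)
    (hnbr : ∀ k, 0 < k → k < N → ∀ l ∈ X, A (p k) l ≠ 0 → l = p (k - 1) ∨ l = p k ∨ l = p (k + 1)) :
    False := by
  classical
  have hz : ∀ i j, A i j = 0 → A j i = 0 := fun i j h => by
    have := hd i j
    rw [h] at this
    simpa [hpos j] using this.symm
  -- The minimal such `m` is the length of the run `p 1`, …, `p m` of nodes of X following `p 0`.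
  have hex : ∃ m, 1 ≤ m ∧ p (m + 1) ∉ X := ⟨N - 1, by omega, by
    rwa [Nat.sub_add_cancel (by omega)]⟩
  obtain ⟨m, ⟨hm1, hmX⟩, hmin⟩ : ∃ m, (1 ≤ m ∧ p (m + 1) ∉ X) ∧
      ∀ m' < m, ¬ (1 ≤ m' ∧ p (m' + 1) ∉ X) := ⟨Nat.find hex, Nat.find_spec hex,
        fun m' h => Nat.find_min hex h⟩
  have hmN : m + 1 ≤ N := by
    by_contra h
    exact hmin (N - 1) (by omega) ⟨by omega, by rwa [Nat.sub_add_cancel (by omega)]⟩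
  have hin : ∀ k, 1 ≤ k → k ≤ m → p k ∈ X := fun k hk1 hk2 => by
    rcases Nat.lt_or_ge 1 k with h | h
    · by_contra hc
      exact hmin (k - 1) (by omega) ⟨by omega, by rwa [Nat.sub_add_cancel (by omega)]⟩
    · have : k = 1 := by omega
      rwa [this]
  set ν := longestElt A X (simpleRoot (p 0)) with hν
  have hνout : ∀ l, l ∉ X → l ≠ p 0 → ν l = 0 := fun l hl hl0 => by
    rw [hν, longestElt_apply_of_notMem A X _ hl, simpleRoot_ne hl0]
  have hν0 : ν (p 0) = 1 := by
    rw [hν, longestElt_apply_of_notMem A X _ h0, simpleRoot_self]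
  have hsum : ∀ k, 1 ≤ k → k ≤ m →
      corootPair A (p k) ν = 2 * ν (p k) - ν (p (k - 1)) - ν (p (k + 1)) := by
    intro k hk1 hkm
    have d1 : p (k - 1) ≠ p k := fun h => by have := hinj _ _ (by omega) (by omega) h; omega
    have d2 : p (k - 1) ≠ p (k + 1) := fun h => by
      have := hinj _ _ (by omega) (by omega) h; omega
    have d3 : p k ≠ p (k + 1) := fun h => by have := hinj _ _ (by omega) (by omega) h; omega
    rw [corootPair, ← Finset.sum_subset (Finset.subset_univ {p (k - 1), p k, p (k + 1)})]
    · rw [Finset.sum_insert (by simp [d1, d2]), Finset.sum_insert (by simp [d3]),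
        Finset.sum_singleton, h2]
      have e1 : A (p k) (p (k - 1)) = -1 := by
        have := (hedge (k - 1) (by omega)).2
        rwa [Nat.sub_add_cancel hk1] at this
      -- Where the run leaves X the coefficient of ν vanishes. The last edge of the path may
      -- therefore be multiple, or absent.
      have e2 : A (p k) (p (k + 1)) * ν (p (k + 1)) = -ν (p (k + 1)) := by
        by_cases hX : p (k + 1) ∈ X
        · have hne : k + 1 ≠ N := fun h => hN (h ▸ hX)
          rw [(hedge k (by omega)).1]; ring
        · rw [hνout _ hX]
          · simp
          · intro h; have := hinj _ _ (by omega) (by omega) h; omega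
      rw [e1, e2]; ring
    · intro l _ hl
      by_cases hlX : l ∈ X
      · by_cases hA : A (p k) l = 0
        · rw [hA, zero_mul]
        · have := hnbr k (by omega) (by omega) l hlX hA
          simp only [Finset.mem_insert, Finset.mem_singleton] at hl
          exact absurd this hl
      · by_cases hl0 : l = p 0
        · subst hl0
          have hk : k ≠ 1 := by rintro rfl; simp at hl
          have : A (p k) (p 0) = 0 := by
            by_contra hA
            have := hnbr0 _ (hin k hk1 hkm) hA
            exact hk (hinj _ _ (by omega) (by omega) this)
          rw [this, zero_mul]
        · rw [hνout l hlX hl0, mul_zero]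
  -- Pairing ν with the coroot of `p k`, which w_X negates, gives the discrete Laplace equation. Its
  -- right side is 1 at k = 1 and 0 afterwards.
  have heq : ∀ k, 1 ≤ k → k ≤ m →
      2 * ν (p k) - ν (p (k - 1)) - ν (p (k + 1)) = -A (p k) (p 0) := fun k hk1 hkm => by
    rw [← hsum k hk1 hkm, hν, hG.corootPair_longestElt hd hpos h2 (hin k hk1 hkm)
      (hfix k (by omega)), corootPair_simpleRoot]
  have hm : m = 1 := by
    refine second_difference_solution (fun k => ν (p k)) hm1 hν0 ?_ ?_ ?_
    · refine hνout _ hmX fun h => ?_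
      have := hinj _ _ (by omega) (by omega) h; omega
    · have := heq 1 le_rfl hm1
      simpa [(hedge 0 (by omega)).2] using this
    · intro k hk2 hkm
      rw [heq k (by omega) hkm, neg_eq_zero]
      by_contra hA
      have := hnbr0 _ (hin k (by omega) hkm) hA
      have := hinj _ _ (by omega) (by omega) this
      omega
  subst hm
  -- With m = 1 the node `p 1` is isolated in X and is the only neighbour of `p 0` in X.
  obtain ⟨l, hlX, hl1, hl2⟩ := hG.exists_other_neighbour h2 h0 (hfix 0 (by omega)) h1
    (fun l hl hne => by
      by_contra hA
      rcases hnbr 1 (by omega) (by omega) l hl (fun h => hA (hz _ _ h)) with h | h | h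
      · exact h0 (by simpa [h] using hl)
      · exact hne h
      · exact hmX (by simpa [h] using hl))
    (hedge 0 (by omega)).2 (hedge 0 (by omega)).1
  exact hl1 (hnbr0 l hlX hl2)

end GSat

/-! ### Combinatorial consequences of membership in I_diff and I_nsf -/

section Parameters

variable {I : Type*} [Fintype I] [DecidableEq I] {A : Matrix I I ℤ} {X : Finset I}
  {τ : Equiv.Perm I} {Istar : Finset I} {d : I → ℚ}

/-- If j is not joined to X, then neither is τ(j), so w_X fixes α_{τ(j)} and (α_j, θ(α_j)) = -d_j
a_{jτ(j)}. This vanishes unless j and τ(j) are joined. -/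
theorem mem_Idiff {j : I} (hG : IsGSat A X τ) (hj : j ∈ Idiff A d X τ Istar) :
    j ∈ Istar ∧ τ j ≠ j ∧ (A j (τ j) ≠ 0 ∨ ∃ x ∈ X, A x j ≠ 0) := by
  simp only [Idiff, Finset.mem_filter] at hj
  obtain ⟨h1, h2, h3⟩ := hj
  refine ⟨h1, fun h => h2 h.symm, ?_⟩
  by_contra! hcon
  apply h3
  rw [theta_simpleRoot, longestElt_eq_self]
  · rw [rootForm_simpleRoot_left]
    have : corootPair A j (-simpleRoot (τ j)) = -A j (τ j) := by
      rw [← corootPair_simpleRoot A j (τ j)]; simp [corootPair]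
    rw [this, hcon.1]; simp
  · intro x hx
    rw [corootPair_simpleRoot, hG.entry_map_right]
    exact hcon.2 _ (hG.map_mem hx)

/-- A τ-fixed i with a_ij odd is not in I_ns. Being fixed and outside X, it lies in I^*, so what
fails is the condition of not being joined to X. -/
theorem mem_Insf {j : I} (hI : IsTransversal X τ Istar)
    (hj : j ∈ Insf A X τ Istar) :
    j ∈ Istar ∧ τ j = j ∧ (∀ x ∈ X, A x j = 0) ∧
      ∀ i, τ i = i → ¬ Even (A i j) → i ∉ X ∧ ∃ x ∈ X, A x i ≠ 0 := by
  simp only [Insf, Ins, Finset.mem_filter] at hj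
  obtain ⟨⟨h1, h2, h3⟩, h4⟩ := hj
  refine ⟨h1, h2.symm, h3, fun i hi hodd => ?_⟩
  have hiX : i ∉ X := fun h => hodd (by rw [h3 i h]; simp)
  refine ⟨hiX, ?_⟩
  by_contra! hcon
  refine hodd (h4 i ⟨?_, hi.symm, hcon⟩)
  rcases hI.mem_or i hiX with h | h
  · exact h
  · rwa [hi] at h

end Parameters

/-! ### Free nodes, and the case where τ is a reflection -/

section FreeNodes

variable {I : Type*} [Fintype I] [DecidableEq I] {A : Matrix I I ℤ} {X : Finset I}
  {τ : Equiv.Perm I} {Istar : Finset I} {d : I → ℚ}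

/-- Combinatorial consequences of `j ∈ I_diff`. -/
def IsDiffNode (A : Matrix I I ℤ) (X : Finset I) (τ : Equiv.Perm I) (j : I) : Prop :=
  τ j ≠ j ∧ (A j (τ j) ≠ 0 ∨ ∃ x ∈ X, A x j ≠ 0)

/-- Combinatorial consequences of `j ∈ I_nsf`. -/
def IsNsfNode (A : Matrix I I ℤ) (X : Finset I) (τ : Equiv.Perm I) (j : I) : Prop :=
  τ j = j ∧ (∀ x ∈ X, A x j = 0) ∧
    ∀ i, τ i = i → ¬ Even (A i j) → i ∉ X ∧ ∃ x ∈ X, A x i ≠ 0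

/-- Combinatorial consequences of `j ∈ I_diff ∪ I_nsf`. -/
def IsFreeNode (A : Matrix I I ℤ) (X : Finset I) (τ : Equiv.Perm I) (j : I) : Prop :=
  j ∉ X ∧ (IsDiffNode A X τ j ∨ IsNsfNode A X τ j)

/-- Distinct elements of I^* lie in distinct τ-orbits. This removes both I^* and the numbers d_i
from the counting problem. -/
theorem card_le_two_of_isFreeNode (hG : IsGSat A X τ) (hI : IsTransversal X τ Istar)
    (h : ∀ a b c, a ≠ b → a ≠ c → b ≠ c → τ a ≠ b → τ a ≠ c → τ b ≠ c →
      IsFreeNode A X τ a → IsFreeNode A X τ b → IsFreeNode A X τ c → False) :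
    (Idiff A d X τ Istar ∪ Insf A X τ Istar).card ≤ 2 := by
  by_contra! hlt
  obtain ⟨a, ha, b, hb, c, hc, hab, hac, hbc⟩ := Finset.two_lt_card.1 hlt
  have hmem : ∀ j ∈ Idiff A d X τ Istar ∪ Insf A X τ Istar,
      j ∈ Istar ∧ IsFreeNode A X τ j := by
    intro j hj
    rcases Finset.mem_union.1 hj with hj | hj
    · have := mem_Idiff hG hj
      exact ⟨this.1, hI.notMem _ this.1, Or.inl this.2⟩
    · have := mem_Insf hI hj
      exact ⟨this.1, hI.notMem _ this.1, Or.inr this.2⟩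
  have hτ : ∀ i j, i ∈ Istar → j ∈ Istar → i ≠ j → τ i ≠ j := fun i j hi hj hne e =>
    hne (by rw [← e, hI.eq_of_mem i hi (e ▸ hj)])
  obtain ⟨ha1, ha2⟩ := hmem a ha
  obtain ⟨hb1, hb2⟩ := hmem b hb
  obtain ⟨hc1, hc2⟩ := hmem c hc
  exact h a b c hab hac hbc (hτ _ _ ha1 hb1 hab) (hτ _ _ ha1 hc1 hac) (hτ _ _ hb1 hc1 hbc)
    ha2 hb2 hc2

/-- The defining property of b would make a joined to X, which the defining property of a excludes.
-/
theorem IsNsfNode.not_adj {a b : I} (ha : IsNsfNode A X τ a) (hb : IsNsfNode A X τ b)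
    (h : ¬ Even (A a b)) : False := by
  obtain ⟨-, x, hx, hne⟩ := hb.2.2 a ha.1 h
  exact hne (ha.2.1 x hx)

/-- `IsGSat.no_path` for a path described by the values of a coordinate function `r`. -/
theorem IsGSat.no_path_coord (hG : IsGSat A X τ)
    (hd : ∀ i j, d i * A i j = d j * A j i) (hpos : ∀ i, d i ≠ 0) (h2 : ∀ i, A i i = 2)
    (r : I → ℕ) (hr : ∀ i j, r i = r j → i = j)
    (N : ℕ) (hN2 : 2 ≤ N) (p : ℕ → ℕ) (hex : ∀ k ≤ N, ∃ i, r i = p k)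
    (hinj : ∀ a b, a < b → b ≤ N → p a ≠ p b)
    (h0 : ∀ i, r i = p 0 → i ∉ X) (h1 : ∀ i, r i = p 1 → i ∈ X) (hN : ∀ i, r i = p N → i ∉ X)
    (hfix : ∀ k < N, ∀ i, r i = p k → τ i = i)
    (hedge : ∀ k, k + 1 < N → ∀ i j, r i = p k → r j = p (k + 1) → A i j = -1 ∧ A j i = -1)
    (hnbr0 : ∀ i, r i = p 0 → ∀ l ∈ X, A l i ≠ 0 → r l = p 1)
    (hnbr : ∀ k, 0 < k → k < N → ∀ i, r i = p k → ∀ l ∈ X, A i l ≠ 0 →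
      r l = p (k - 1) ∨ r l = p k ∨ r l = p (k + 1)) : False := by
  choose f hf using hex
  -- The values beyond `N` play no role.
  let g : ℕ → I := fun k => if h : k ≤ N then f k h else f 0 (Nat.zero_le _)
  have hg : ∀ k, k ≤ N → r (g k) = p k := fun k hk => by simp only [g, dif_pos hk, hf]
  refine hG.no_path hd hpos h2 N hN2 g ?_ (h0 _ (hg 0 (by omega))) (h1 _ (hg 1 (by omega)))
    (hN _ (hg N le_rfl)) (fun k hk => hfix k hk _ (hg k hk.le))
    (fun k hk => hedge k hk _ _ (hg k (by omega)) (hg (k + 1) (by omega))) ?_ ?_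
  · intro a b ha hb hab
    have : p a = p b := by rw [← hg a ha, ← hg b hb, hab]
    rcases lt_trichotomy a b with h | h | h
    · exact absurd this (hinj a b h hb)
    · exact h
    · exact absurd this.symm (hinj b a h ha)
  · intro l hl hA
    exact hr _ _ ((hnbr0 _ (hg 0 (by omega)) l hl hA).trans (hg 1 (by omega)).symm)
  · intro k hk0 hk l hl hA
    rcases hnbr k hk0 hk _ (hg k hk.le) l hl hA with h | h | h
    · exact Or.inl (hr _ _ (h.trans (hg _ (by omega)).symm))
    · exact Or.inr (Or.inl (hr _ _ (h.trans (hg _ (by omega)).symm)))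
    · exact Or.inr (Or.inr (hr _ _ (h.trans (hg _ (by omega)).symm)))

/-- For a reflection of a path or of a cycle, no node of `X` lies between two `τ`-orbits outside
`X`. Here `y` is a signed coordinate on which `τ` acts as `-1`. -/
theorem IsGSat.no_mem_between (hG : IsGSat A X τ) (y : I → ℤ) (N : ℤ)
    (hy : ∀ a b, y a = y b → a = b) (hpar : ∀ a b, (y a - y b) % 2 = 0)
    (hbd : ∀ a, -N < y a ∧ y a ≤ N) (hτ : ∀ a, y a < N → y (τ a) = -y a)
    (hadj : ∀ a b, A a b ≠ 0 → a = b ∨ y a - y b = 2 ∨ y b - y a = 2 ∨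
      y a - y b = 2 * N - 2 ∨ y b - y a = 2 * N - 2)
    {a b x : I} (ha : a ∉ X) (hb : b ∉ X) (hx : x ∈ X) (hax : |y a| < |y x|)
    (hxb : |y x| < |y b|) : False := by
  have hout : ∀ m, m ∉ X → ∀ k ∈ X, y k ≠ y m ∧ y k ≠ -y m := by
    intro m hm k hk
    refine ⟨fun h => hm (hy _ _ h ▸ hk), fun h => ?_⟩
    -- If y m = N, then -y m = -N is not a value of y at all, so τ need not be known there.
    by_cases hN : y m < N
    · exact hG.map_notMem hm (hy _ _ (h.trans (hτ m hN).symm) ▸ hk)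
    · have := hbd m; have := hbd k; omega
  -- The nodes with e · y strictly between |y a| and |y b| are cut off from the rest of X by the
  -- orbits of a and b. So this set would contain τ(x) along with x, although τ changes the sign of
  -- y.
  have hsep : ∀ e : ℤ, e = 1 ∨ e = -1 → |y a| < e * y x → e * y x < |y b| → False := by
    intro e he h1 h2
    have key := hG.map_mem_of_separated (fun l => |y a| < e * y l ∧ e * y l < |y b|) ?_ hx
      ⟨h1, h2⟩
    · have hxN : y x < N := by
        have := hbd x; have := hbd b
        rcases he with rfl | rfl <;> rcases abs_cases (y b) with ⟨e1, _⟩ | ⟨e1, _⟩ <;>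
          rcases abs_cases (y a) with ⟨e2, _⟩ | ⟨e2, _⟩ <;> rw [e1] at h2 <;> rw [e2] at h1 <;> omega
      rw [hτ x hxN] at key
      have := abs_nonneg (y a)
      have : e * -y x = -(e * y x) := by ring
      omega
    · intro k hk hkn l ⟨hl1, hl2⟩
      by_contra hA
      apply hkn
      have o1 := hout a ha k hk
      have o2 := hout b hb k hk
      have p1 := hpar k a
      have p2 := hpar k b
      have p3 := hpar l k
      have b1 := hbd k
      have b2 := hbd l
      have b3 := hbd b
      have b4 := hbd a
      rcases hadj k l hA with rfl | h
      · exact ⟨hl1, hl2⟩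
      · clear hadj hout hτ hpar hbd hy
        rcases he with rfl | rfl <;> rcases abs_cases (y b) with ⟨e1, _⟩ | ⟨e1, _⟩ <;>
          rcases abs_cases (y a) with ⟨e2, _⟩ | ⟨e2, _⟩ <;> rw [e1] at hl2 ⊢ <;>
          rw [e2] at hl1 ⊢ <;> omega
  rcases abs_cases (y x) with ⟨e, _⟩ | ⟨e, _⟩
  · exact hsep 1 (Or.inl rfl) (by rw [one_mul, ← e]; exact hax) (by rw [one_mul, ← e]; exact hxb)
  · exact hsep (-1) (Or.inr rfl) (by rw [neg_one_mul, ← e]; exact hax)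
      (by rw [neg_one_mul, ← e]; exact hxb)

/-- Distinct orbits have distinct |y|, so one of the three nodes, say b, is strictly in the middle.
It is not τ-fixed, since y b is neither 0 nor N. It is not joined to τ(b), since that would put b at
an extreme value of |y|. A neighbour of b in X would have |y| strictly between two of the three
values, against `IsGSat.no_mem_between`. The value N is the fixed antipodal node of a cycle, and a
difference 2N - 2 is the edge across the cut. -/
theorem IsGSat.reflection_free_nodes (hG : IsGSat A X τ) (y : I → ℤ) (N : ℤ)
    (hy : ∀ a b, y a = y b → a = b) (hpar : ∀ a b, (y a - y b) % 2 = 0)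
    (hbd : ∀ a, -N < y a ∧ y a ≤ N) (hτ : ∀ a, y a < N → y (τ a) = -y a)
    (hadj : ∀ a b, A a b ≠ 0 → a = b ∨ y a - y b = 2 ∨ y b - y a = 2 ∨
      y a - y b = 2 * N - 2 ∨ y b - y a = 2 * N - 2)
    (a b c : I) (hab : a ≠ b) (hac : a ≠ c) (hbc : b ≠ c) (tab : τ a ≠ b) (tac : τ a ≠ c)
    (tbc : τ b ≠ c) (ha : IsFreeNode A X τ a) (hb : IsFreeNode A X τ b)
    (hc : IsFreeNode A X τ c) : False := by
  have hout : ∀ m, m ∉ X → ∀ k ∈ X, y k ≠ y m ∧ y k ≠ -y m := by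
    intro m hm k hk
    refine ⟨fun h => hm (hy _ _ h ▸ hk), fun h => ?_⟩
    by_cases hN : y m < N
    · exact hG.map_notMem hm (hy _ _ (h.trans (hτ m hN).symm) ▸ hk)
    · have := hbd m; have := hbd k; omega
  have habs_out : ∀ m, m ∉ X → ∀ k ∈ X, |y k| ≠ |y m| := fun m hm k hk h =>
    (abs_eq_abs.1 h).elim (hout m hm k hk).1 (hout m hm k hk).2
  have habs_par : ∀ a b, (|y a| - |y b|) % 2 = 0 := by
    intro a b
    have := hpar a b
    rcases abs_cases (y a) with ⟨e1, _⟩ | ⟨e1, _⟩ <;>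
      rcases abs_cases (y b) with ⟨e2, _⟩ | ⟨e2, _⟩ <;> rw [e1, e2] <;> omega
  have mid : ∀ a b c, IsFreeNode A X τ a → IsFreeNode A X τ b → IsFreeNode A X τ c →
      |y a| < |y b| → |y b| < |y c| → False := by
    intro a b c ha hb hc h1 h2
    have ba := hbd a
    have bb := hbd b
    have bc := hbd c
    have pab := hpar a b
    have pbc := hpar b c
    have hbN : y b < N := by
      rcases abs_cases (y b) with ⟨e1, _⟩ | ⟨e1, _⟩ <;>
        rcases abs_cases (y c) with ⟨e2, _⟩ | ⟨e2, _⟩ <;> rw [e1, e2] at h2 <;> omega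
    have hτb := hτ b hbN
    rcases hb.2 with ⟨hne, h | ⟨x, hx, h⟩⟩ | ⟨he, -⟩
    · have := hadj _ _ h
      rw [hτb] at this
      rcases this with h | h
      · exact hne h.symm
      · clear hadj hout hτ hpar hbd hy
        rcases abs_cases (y b) with ⟨e1, _⟩ | ⟨e1, _⟩ <;>
        rcases abs_cases (y c) with ⟨e2, _⟩ | ⟨e2, _⟩ <;>
        rcases abs_cases (y a) with ⟨e3, _⟩ | ⟨e3, _⟩ <;> rw [e1, e2] at h2 <;>
        rw [e3, e1] at h1 <;> omega
    · have s1 : ¬ (|y a| < |y x| ∧ |y x| < |y b|) := fun h =>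
        hG.no_mem_between y N hy hpar hbd hτ hadj ha.1 hb.1 hx h.1 h.2
      have s2 : ¬ (|y b| < |y x| ∧ |y x| < |y c|) := fun h =>
        hG.no_mem_between y N hy hpar hbd hτ hadj hb.1 hc.1 hx h.1 h.2
      have oa := habs_out a ha.1 x hx
      have ob := habs_out b hb.1 x hx
      have oc := habs_out c hc.1 x hx
      have qab := habs_par a b
      have qbc := habs_par b c
      have hcN : |y c| ≤ N := abs_le.2 ⟨by omega, bc.2⟩
      have bx := hbd x
      have hx' : |y x| - |y b| = 2 ∨ |y b| - |y x| = 2 ∨ (|y x| = N ∧ |y b| = N - 2) := by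
        rcases hadj _ _ h with rfl | h
        · exact absurd hx hb.1
        · clear hadj hout hτ hpar hbd hy habs_out habs_par s1 s2 oa oc
          rcases abs_cases (y b) with ⟨e1, _⟩ | ⟨e1, _⟩ <;>
          rcases abs_cases (y x) with ⟨e4, _⟩ | ⟨e4, _⟩ <;> rw [e1, e4] at ob <;>
          rw [e1] at qbc h2 <;> rw [e1, e4] <;> omega
      have := abs_nonneg (y a)
      clear hadj hout hτ hpar hbd hy habs_out habs_par
      generalize |y a| = s at *
      generalize |y b| = t at *
      generalize |y c| = u at *
      generalize |y x| = w at *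
      omega
    · rw [he] at hτb
      have : y b = 0 := by omega
      rw [this] at h1
      exact absurd h1 (by simp)
  have hne : ∀ a b, a ≠ b → τ a ≠ b → |y a| ≠ |y b| := by
    intro a b h1 h2 h
    rcases abs_eq_abs.1 h with h | h
    · exact h1 (hy _ _ h)
    · have ba := hbd a
      have bb := hbd b
      exact h2 (hy _ _ (by rw [hτ a (by omega)]; omega))
  have n1 := hne a b hab tab
  have n2 := hne a c hac tac
  have n3 := hne b c hbc tbc
  rcases lt_or_gt_of_ne n1 with h1 | h1 <;> rcases lt_or_gt_of_ne n2 with h2 | h2 <;>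
    rcases lt_or_gt_of_ne n3 with h3 | h3
  · exact mid a b c ha hb hc h1 h3
  · exact mid a c b ha hc hb h2 h3
  · exact absurd (h1.trans h3) h2.not_gt
  · exact mid c a b hc ha hb h2 h1
  · exact mid b a c hb ha hc h1 h2
  · exact absurd (h3.trans h1) h2.not_gt
  · exact mid b c a hb hc ha h3 h2
  · exact mid c b a hc hb ha h3 h1

end FreeNodes

/-! ### Entries of the classical affine Cartan matrices -/

namespace ClassicalType

theorem cartan_self (t : ClassicalType) (n : ℕ) (i : Fin (n + 1)) : t.cartan n i i = 2 := by
  simp [cartan]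

theorem cartan_cases (t : ClassicalType) (n : ℕ) (i j : Fin (n + 1)) :
    ((i : ℕ) = j ∧ t.cartan n i j = 2) ∨
      ((i : ℕ) ≠ j ∧ DoubleEntry t n i j ∧ t.cartan n i j = -2) ∨
      ((i : ℕ) ≠ j ∧ ¬ DoubleEntry t n i j ∧ (Edge t n i j ∨ Edge t n j i) ∧
        t.cartan n i j = -1) ∨
      ((i : ℕ) ≠ j ∧ ¬ DoubleEntry t n i j ∧ ¬ (Edge t n i j ∨ Edge t n j i) ∧
        t.cartan n i j = 0) := by
  unfold cartan
  split_ifs with h1 h2 h3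
  · exact Or.inl ⟨congrArg _ h1, rfl⟩
  · exact Or.inr (Or.inl ⟨fun h => h1 (Fin.ext h), h2, rfl⟩)
  · exact Or.inr (Or.inr (Or.inl ⟨fun h => h1 (Fin.ext h), h2, h3, rfl⟩))
  · exact Or.inr (Or.inr (Or.inr ⟨fun h => h1 (Fin.ext h), h2, h3, rfl⟩))

theorem twiceD_mul_cartan (t : ClassicalType) (n : ℕ) (hn : t.minRank ≤ n) (i j : Fin (n + 1)) :
    (twiceD t n i : ℤ) * t.cartan n i j = twiceD t n j * t.cartan n j i := by
  rcases cartan_cases t n i j with ⟨h1, e⟩ | ⟨h1, h2, e⟩ | ⟨h1, h2, h3, e⟩ | ⟨h1, h2, h3, e⟩ <;>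
  rcases cartan_cases t n j i with
    ⟨h1', e'⟩ | ⟨h1', h2', e'⟩ | ⟨h1', h2', h3', e'⟩ | ⟨h1', h2', h3', e'⟩ <;>
  rw [e, e'] <;> clear e e' <;> cases t <;>
    simp only [twiceD, minRank, DoubleEntry, Edge] at * <;>
    (try split_ifs) <;> omega

theorem dNum_mul_cartan (t : ClassicalType) (n : ℕ) (hn : t.minRank ≤ n) (i j : Fin (n + 1)) :
    dNum t n i * t.cartan n i j = dNum t n j * t.cartan n j i := by
  have h : ((twiceD t n i : ℤ) * t.cartan n i j : ℚ) = (twiceD t n j : ℤ) * t.cartan n j i := by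
    exact_mod_cast twiceD_mul_cartan t n hn i j
  push_cast at h
  simp only [dNum]
  linarith

theorem dNum_ne_zero (t : ClassicalType) (n : ℕ) (i : Fin (n + 1)) : dNum t n i ≠ 0 := by
  cases t <;> simp only [dNum, twiceD] <;> (try split_ifs) <;> norm_num

theorem cartan_A_ne_zero {n : ℕ} (hn : 2 ≤ n) (i j : Fin (n + 1)) :
    cartan A n i j ≠ 0 ↔ (i : ℕ) = j ∨ (j : ℕ) = i + 1 ∨ (i : ℕ) = j + 1 ∨
      ((i : ℕ) = 0 ∧ (j : ℕ) = n) ∨ ((j : ℕ) = 0 ∧ (i : ℕ) = n) := by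
  rcases cartan_cases A n i j with ⟨h1, e⟩ | ⟨h1, h2, e⟩ | ⟨h1, h2, h3, e⟩ | ⟨h1, h2, h3, e⟩ <;>
    simp only [e, DoubleEntry, Edge] at * <;> omega

theorem cartan_A_eq_neg_one {n : ℕ} (hn : 2 ≤ n) {i j : Fin (n + 1)} (hij : (i : ℕ) ≠ j)
    (h : cartan A n i j ≠ 0) : cartan A n i j = -1 := by
  rcases cartan_cases A n i j with ⟨h1, e⟩ | ⟨h1, h2, e⟩ | ⟨h1, h2, h3, e⟩ | ⟨h1, h2, h3, e⟩ <;>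
    simp only [e, DoubleEntry, Edge] at * <;> omega

theorem cartan_B_ne_zero {n : ℕ} (hn : 3 ≤ n) (i j : Fin (n + 1)) :
    cartan B n i j ≠ 0 ↔ (i : ℕ) = j ∨ (1 ≤ (i : ℕ) ∧ (j : ℕ) = i + 1) ∨
      (1 ≤ (j : ℕ) ∧ (i : ℕ) = j + 1) ∨ ((i : ℕ) = 0 ∧ (j : ℕ) = 2) ∨
      ((j : ℕ) = 0 ∧ (i : ℕ) = 2) := by
  rcases cartan_cases B n i j with ⟨h1, e⟩ | ⟨h1, h2, e⟩ | ⟨h1, h2, h3, e⟩ | ⟨h1, h2, h3, e⟩ <;>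
    simp only [e, DoubleEntry, Edge] at * <;> omega

theorem cartan_B_eq_neg_one {n : ℕ} {i j : Fin (n + 1)} (hij : (i : ℕ) ≠ j)
    (hi : (i : ℕ) ≠ n) (h : cartan B n i j ≠ 0) : cartan B n i j = -1 := by
  rcases cartan_cases B n i j with ⟨h1, e⟩ | ⟨h1, h2, e⟩ | ⟨h1, h2, h3, e⟩ | ⟨h1, h2, h3, e⟩ <;>
    simp only [e, DoubleEntry, Edge] at * <;> omega

theorem cartan_B_eq_neg_two {n : ℕ} (i j : Fin (n + 1)) :
    cartan B n i j = -2 ↔ (i : ℕ) = n ∧ (j : ℕ) + 1 = n := by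
  rcases cartan_cases B n i j with ⟨h1, e⟩ | ⟨h1, h2, e⟩ | ⟨h1, h2, h3, e⟩ | ⟨h1, h2, h3, e⟩
  · exact iff_of_false (by rw [e]; decide) (by omega)
  · exact iff_of_true e h2
  · exact iff_of_false (by rw [e]; decide) h2
  · exact iff_of_false (by rw [e]; decide) h2

theorem cartan_C_ne_zero {n : ℕ} (hn : 2 ≤ n) (i j : Fin (n + 1)) :
    cartan C n i j ≠ 0 ↔ (i : ℕ) = j ∨ (j : ℕ) = i + 1 ∨ (i : ℕ) = j + 1 := by
  rcases cartan_cases C n i j with ⟨h1, e⟩ | ⟨h1, h2, e⟩ | ⟨h1, h2, h3, e⟩ | ⟨h1, h2, h3, e⟩ <;>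
    simp only [e, DoubleEntry, Edge] at * <;> omega

theorem cartan_C_eq_neg_one {n : ℕ} {i j : Fin (n + 1)} (hij : (i : ℕ) ≠ j)
    (hj : (j : ℕ) ≠ 0 ∧ (j : ℕ) ≠ n) (h : cartan C n i j ≠ 0) : cartan C n i j = -1 := by
  rcases cartan_cases C n i j with ⟨h1, e⟩ | ⟨h1, h2, e⟩ | ⟨h1, h2, h3, e⟩ | ⟨h1, h2, h3, e⟩ <;>
    simp only [e, DoubleEntry, Edge] at * <;> omega

theorem cartan_C_eq_neg_two {n : ℕ} (i j : Fin (n + 1)) :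
    cartan C n i j = -2 ↔ ((i : ℕ) = 1 ∧ (j : ℕ) = 0) ∨ ((i : ℕ) + 1 = n ∧ (j : ℕ) = n) := by
  rcases cartan_cases C n i j with ⟨h1, e⟩ | ⟨h1, h2, e⟩ | ⟨h1, h2, h3, e⟩ | ⟨h1, h2, h3, e⟩
  · exact iff_of_false (by rw [e]; decide) (by omega)
  · exact iff_of_true e h2
  · exact iff_of_false (by rw [e]; decide) h2
  · exact iff_of_false (by rw [e]; decide) h2

theorem cartan_D_ne_zero {n : ℕ} (i j : Fin (n + 1)) :
    cartan D n i j ≠ 0 ↔ (i : ℕ) = j ∨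
      (1 ≤ (i : ℕ) ∧ (i : ℕ) + 2 ≤ n ∧ (j : ℕ) = i + 1) ∨
      (1 ≤ (j : ℕ) ∧ (j : ℕ) + 2 ≤ n ∧ (i : ℕ) = j + 1) ∨
      ((i : ℕ) = 0 ∧ (j : ℕ) = 2) ∨ ((j : ℕ) = 0 ∧ (i : ℕ) = 2) ∨
      ((i : ℕ) + 2 = n ∧ (j : ℕ) = n) ∨ ((j : ℕ) + 2 = n ∧ (i : ℕ) = n) := by
  rcases cartan_cases D n i j with ⟨h1, e⟩ | ⟨h1, h2, e⟩ | ⟨h1, h2, h3, e⟩ | ⟨h1, h2, h3, e⟩ <;>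
    simp only [e, DoubleEntry, Edge] at * <;> omega

theorem cartan_D_eq_neg_one {n : ℕ} {i j : Fin (n + 1)} (hij : (i : ℕ) ≠ j)
    (h : cartan D n i j ≠ 0) : cartan D n i j = -1 := by
  rcases cartan_cases D n i j with ⟨h1, e⟩ | ⟨h1, h2, e⟩ | ⟨h1, h2, h3, e⟩ | ⟨h1, h2, h3, e⟩ <;>
    simp only [e, DoubleEntry, Edge] at * <;> omega

/-- The numbers `d_i` are invariant under diagram automorphisms. -/
theorem twiceD_map (t : ClassicalType) (n : ℕ) (hn : t.minRank ≤ n)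
    (τ : Equiv.Perm (Fin (n + 1))) (hτ : ∀ i j, t.cartan n (τ i) (τ j) = t.cartan n i j)
    (i : Fin (n + 1)) : twiceD t n (τ i) = twiceD t n i := by
  cases t with
  | A => rfl
  | D => rfl
  | B =>
    have hn : 3 ≤ n := hn
    -- The exceptional node is recognised by an entry -2 in its row, which every diagram
    -- automorphism preserves. In type C the column plays this role.
    have key : ∀ i : Fin (n + 1), (i : ℕ) = n ↔ ∃ j, cartan B n i j = -2 := fun i => by
      simp only [cartan_B_eq_neg_two]
      exact ⟨fun h => ⟨⟨n - 1, by omega⟩, h, show n - 1 + 1 = n by omega⟩, fun ⟨_, h, _⟩ => h⟩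
    have : ((τ i : Fin (n + 1)) : ℕ) = n ↔ (i : ℕ) = n := by
      rw [key, key, τ.surjective.exists]
      simp only [hτ]
    simp only [twiceD, this]
  | C =>
    have hn : 2 ≤ n := hn
    have key : ∀ j : Fin (n + 1), ((j : ℕ) = 0 ∨ (j : ℕ) = n) ↔ ∃ i, cartan C n i j = -2 :=
      fun j => by
        simp only [cartan_C_eq_neg_two]
        constructor
        · rintro (h | h)
          · exact ⟨⟨1, by omega⟩, Or.inl ⟨rfl, h⟩⟩
          · exact ⟨⟨n - 1, by omega⟩, Or.inr ⟨show n - 1 + 1 = n by omega, h⟩⟩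
        · rintro ⟨_, ⟨_, h⟩ | ⟨_, h⟩⟩
          · exact Or.inl h
          · exact Or.inr h
    have : (((τ i : Fin (n + 1)) : ℕ) = 0 ∨ ((τ i : Fin (n + 1)) : ℕ) = n) ↔
        ((i : ℕ) = 0 ∨ (i : ℕ) = n) := by
      rw [key, key, τ.surjective.exists]
      simp only [hτ]
    simp only [twiceD, this]

end ClassicalType

/-! ### The bound in type C -/

section TypeC

open ClassicalType

variable {n : ℕ} {X : Finset (Fin (n + 1))} {τ : Equiv.Perm (Fin (n + 1))}

theorem perm_val_ne (τ : Equiv.Perm (Fin (n + 1))) {a b : Fin (n + 1)} (h : (a : ℕ) ≠ b) :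
    (τ a : ℕ) ≠ τ b := fun e => h (by rw [τ.injective (Fin.ext e)])

/-- The entries -2 occur only in the columns of the two end nodes, so τ(0) is an end. Adjacency and
injectivity then determine τ along the path. -/
theorem diagramAut_C (hn : 2 ≤ n) (hG : IsGSat (cartan C n) X τ) :
    (∀ i, τ i = i) ∨ ∀ i, (τ i : ℕ) + i = n := by
  have hadj : ∀ i j : Fin (n + 1), (j : ℕ) = i + 1 →
      (τ j : ℕ) = τ i + 1 ∨ (τ i : ℕ) = τ j + 1 := by
    intro i j hij
    have h : cartan C n (τ i) (τ j) ≠ 0 := by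
      rw [hG.diagramAut, cartan_C_ne_zero hn]; omega
    rw [cartan_C_ne_zero hn] at h
    have := perm_val_ne τ (a := i) (b := j) (by omega)
    omega
  have h0 : (τ 0 : ℕ) = 0 ∨ (τ 0 : ℕ) = n := by
    have h : cartan C n (τ ⟨1, by omega⟩) (τ 0) = -2 := by
      rw [hG.diagramAut, cartan_C_eq_neg_two]; exact Or.inl ⟨rfl, rfl⟩
    rw [cartan_C_eq_neg_two] at h
    omega
  rcases h0 with h0 | h0
  · left
    have : ∀ k : ℕ, ∀ i j : Fin (n + 1), (i : ℕ) = k → (j : ℕ) = k + 1 →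
        (τ i : ℕ) = i ∧ (τ j : ℕ) = j := by
      intro k
      induction k with
      | zero =>
        intro i j hi hj
        have : i = 0 := Fin.ext hi
        subst this
        have := hadj 0 j (by simpa using hj)
        omega
      | succ k ih =>
        intro i j hi hj
        obtain ⟨e, he⟩ : ∃ e : Fin (n + 1), (e : ℕ) = k := ⟨⟨k, by omega⟩, rfl⟩
        have := ih e i he hi
        have := hadj i j (by omega)
        have := perm_val_ne τ (a := e) (b := j) (by omega)
        omega
    intro i
    apply Fin.ext
    by_cases hi : (i : ℕ) = n
    · exact (this (n - 1) ⟨n - 1, by omega⟩ i rfl (by omega)).2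
    · exact (this i i ⟨i + 1, by omega⟩ rfl rfl).1
  · right
    have : ∀ k : ℕ, ∀ i j : Fin (n + 1), (i : ℕ) = k → (j : ℕ) = k + 1 →
        (τ i : ℕ) + i = n ∧ (τ j : ℕ) + j = n := by
      intro k
      induction k with
      | zero =>
        intro i j hi hj
        have : i = 0 := Fin.ext hi
        subst this
        have := hadj 0 j (by simpa using hj)
        have := (τ j).isLt
        have : ((0 : Fin (n + 1)) : ℕ) = 0 := rfl
        omega
      | succ k ih =>
        intro i j hi hj
        obtain ⟨e, he⟩ : ∃ e : Fin (n + 1), (e : ℕ) = k := ⟨⟨k, by omega⟩, rfl⟩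
        have := ih e i he hi
        have := hadj i j (by omega)
        have := perm_val_ne τ (a := e) (b := j) (by omega)
        omega
    intro i
    by_cases hi : (i : ℕ) = n
    · exact (this (n - 1) ⟨n - 1, by omega⟩ i rfl (by omega)).2
    · exact (this i i ⟨i + 1, by omega⟩ rfl rfl).1

/-- Two nodes of `I_nsf` in type `C` with trivial `τ`: the smaller one is the left end. -/
theorem nsf_C (hn : 2 ≤ n) (hG : IsGSat (cartan C n) X τ) (hτ : ∀ i, τ i = i)
    {a b : Fin (n + 1)} (ha : IsFreeNode (cartan C n) X τ a) (hb : IsFreeNode (cartan C n) X τ b)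
    (hab : (a : ℕ) < b) : (a : ℕ) = 0 := by
  have toNsf : ∀ {j}, IsFreeNode (cartan C n) X τ j → IsNsfNode (cartan C n) X τ j :=
    fun h => h.2.resolve_left fun h => h.1 (hτ _)
  have ha' := toNsf ha
  have hb' := toNsf hb
  by_contra ha0
  have odd : ∀ i j : Fin (n + 1), (i : ℕ) = j + 1 ∨ (j : ℕ) = i + 1 → (j : ℕ) ≠ 0 →
      (j : ℕ) ≠ n → ¬ Even (cartan C n i j) := fun i j h h0 h1 => by
    rw [cartan_C_eq_neg_one (by omega) ⟨h0, h1⟩ ((cartan_C_ne_zero hn _ _).2 (by omega))]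
    decide
  have hbn := b.isLt
  obtain ⟨i, hi⟩ : ∃ i : Fin (n + 1), (i : ℕ) = a + 1 := ⟨⟨a + 1, by omega⟩, rfl⟩
  obtain ⟨hiX, x, hx, hxi⟩ := ha'.2.2 i (hτ i) (odd i a (Or.inl hi) (by omega) (by omega))
  have hxa : x ≠ a := fun h => ha.1 (h ▸ hx)
  rw [Ne, Fin.ext_iff] at hxa
  have hxi' : (x : ℕ) ≠ i := fun h => hiX (Fin.ext h ▸ hx)
  rw [cartan_C_ne_zero hn] at hxi
  have hxv : (x : ℕ) = a + 2 := by omega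
  have hbx : (b : ℕ) ≠ x := fun h => hb.1 (Fin.ext h ▸ hx)
  have hbi : (b : ℕ) ≠ i := fun h => by
    have e : b = i := Fin.ext h
    subst e
    exact hb'.not_adj ha' (odd b a (Or.inl hi) (by omega) (by omega))
  -- The path runs from a + 1 to b. Only its last edge can be the double one, and no condition is
  -- imposed on that edge.
  refine hG.no_path_coord (dNum_mul_cartan C n hn) (dNum_ne_zero C n) (cartan_self C n)
    (fun i => (i : ℕ)) (fun _ _ h => Fin.ext h) (b - a - 1) (by omega) (fun k => a + 1 + k)
    (fun k hk => ⟨⟨a + 1 + k, by omega⟩, rfl⟩) (fun k l _ _ => by omega) ?_ ?_ ?_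
    (fun _ _ i _ => hτ i) ?_ ?_ ?_
  · intro i' h
    have : i' = i := Fin.ext (by omega)
    rwa [this]
  · intro i' h
    have : i' = x := Fin.ext (by omega)
    rwa [this]
  · intro i' h
    have : i' = b := Fin.ext (by omega)
    rw [this]; exact hb.1
  · intro k hk i' j' h1 h2
    constructor <;> refine cartan_C_eq_neg_one (by omega) (by omega)
      ((cartan_C_ne_zero hn _ _).2 (by omega))
  · intro i' h l hl hA
    rw [cartan_C_ne_zero hn] at hA
    have h1 : (l : ℕ) ≠ i := fun h => hiX (Fin.ext h ▸ hl)
    have h2 : (l : ℕ) ≠ a := fun h => ha.1 (Fin.ext h ▸ hl)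
    omega
  · intro k hk0 hk i' h l hl hA
    rw [cartan_C_ne_zero hn] at hA
    omega

theorem card_le_two_C (hn : 2 ≤ n) (hG : IsGSat (cartan C n) X τ) {Istar : Finset (Fin (n + 1))}
    (hI : IsTransversal X τ Istar) (d : Fin (n + 1) → ℚ) :
    (Idiff (cartan C n) d X τ Istar ∪ Insf (cartan C n) X τ Istar).card ≤ 2 := by
  refine card_le_two_of_isFreeNode hG hI ?_
  rcases diagramAut_C hn hG with hτ | hτ
  · intro a b c hab hac hbc _ _ _ ha hb hc
    rw [Ne, Fin.ext_iff] at hab hac hbc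
    have h1 := nsf_C hn hG hτ ha hb
    have h2 := nsf_C hn hG hτ hb ha
    have h3 := nsf_C hn hG hτ ha hc
    have h4 := nsf_C hn hG hτ hc ha
    have h5 := nsf_C hn hG hτ hb hc
    have h6 := nsf_C hn hG hτ hc hb
    omega
  -- Here |y| ≤ n. With N = n + 2 neither the value N nor the wrap-around difference 2N - 2 occurs,
  -- so the cycle degenerates to a path.
  · refine hG.reflection_free_nodes (fun i => 2 * (i : ℤ) - n) (n + 2) ?_ ?_ ?_ ?_ ?_
    · intro a b h; apply Fin.ext; omega
    · intro a b; omega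
    · intro a; have := a.isLt; omega
    · intro a _; have := hτ a; omega
    · intro a b h
      rw [cartan_C_ne_zero hn] at h
      simp only [Fin.ext_iff]
      omega

end TypeC

/-! ### The bound in type A -/

section TypeA

open ClassicalType

variable {n : ℕ} {X : Finset (Fin (n + 1))} {τ : Equiv.Perm (Fin (n + 1))}

/-- An automorphism of a cycle is a rotation or a reflection. Which of the two is decided by whether
τ(1) follows τ(0) in the cyclic order. -/
theorem diagramAut_A (hn : 2 ≤ n) (hG : IsGSat (cartan A n) X τ) :
    (∀ i : Fin (n + 1), (τ i : ℕ) = τ 0 + i ∨ (τ i : ℕ) + (n + 1) = τ 0 + i) ∨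
      ∀ i : Fin (n + 1), (τ i : ℕ) + i = τ 0 ∨ (τ i : ℕ) + i = τ 0 + (n + 1) := by
  have hadj : ∀ i j : Fin (n + 1), (j : ℕ) = i + 1 →
      (τ j : ℕ) = τ i + 1 ∨ (τ i : ℕ) = τ j + 1 ∨ ((τ i : ℕ) = 0 ∧ (τ j : ℕ) = n) ∨
        ((τ j : ℕ) = 0 ∧ (τ i : ℕ) = n) := by
    intro i j hij
    have h : cartan A n (τ i) (τ j) ≠ 0 := by
      rw [hG.diagramAut, cartan_A_ne_zero hn]; omega
    rw [cartan_A_ne_zero hn] at h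
    have := perm_val_ne τ (a := i) (b := j) (by omega)
    omega
  obtain ⟨u, hu⟩ : ∃ u : Fin (n + 1), (u : ℕ) = 1 := ⟨⟨1, by omega⟩, rfl⟩
  have h0 : ((0 : Fin (n + 1)) : ℕ) = 0 := rfl
  have h01 := hadj 0 u (by omega)
  have hlt := (τ 0).isLt
  have hltu := (τ u).isLt
  by_cases hc : (τ u : ℕ) = τ 0 + 1 ∨ (τ u : ℕ) + (n + 1) = τ 0 + 1
  · left
    have : ∀ k : ℕ, ∀ i j : Fin (n + 1), (i : ℕ) = k → (j : ℕ) = k + 1 →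
        ((τ i : ℕ) = τ 0 + i ∨ (τ i : ℕ) + (n + 1) = τ 0 + i) ∧
        ((τ j : ℕ) = τ 0 + j ∨ (τ j : ℕ) + (n + 1) = τ 0 + j) := by
      intro k
      induction k with
      | zero =>
        intro i j hi hj
        have e1 : i = 0 := Fin.ext hi
        have e2 : j = u := Fin.ext (by omega)
        subst e1 e2
        omega
      | succ k ih =>
        intro i j hi hj
        obtain ⟨e, he⟩ : ∃ e : Fin (n + 1), (e : ℕ) = k := ⟨⟨k, by omega⟩, rfl⟩
        have := ih e i he hi
        have := hadj i j (by omega)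
        have := perm_val_ne τ (a := e) (b := j) (by omega)
        have := (τ e).isLt
        have := (τ i).isLt
        have := (τ j).isLt
        omega
    intro i
    by_cases hi : (i : ℕ) = n
    · exact (this (n - 1) ⟨n - 1, by omega⟩ i rfl (by omega)).2
    · exact (this i i ⟨i + 1, by omega⟩ rfl rfl).1
  · right
    have : ∀ k : ℕ, ∀ i j : Fin (n + 1), (i : ℕ) = k → (j : ℕ) = k + 1 →
        ((τ i : ℕ) + i = τ 0 ∨ (τ i : ℕ) + i = τ 0 + (n + 1)) ∧
        ((τ j : ℕ) + j = τ 0 ∨ (τ j : ℕ) + j = τ 0 + (n + 1)) := by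
      intro k
      induction k with
      | zero =>
        intro i j hi hj
        have e1 : i = 0 := Fin.ext hi
        have e2 : j = u := Fin.ext (by omega)
        subst e1 e2
        omega
      | succ k ih =>
        intro i j hi hj
        obtain ⟨e, he⟩ : ∃ e : Fin (n + 1), (e : ℕ) = k := ⟨⟨k, by omega⟩, rfl⟩
        have := ih e i he hi
        have := hadj i j (by omega)
        have := perm_val_ne τ (a := e) (b := j) (by omega)
        have := (τ e).isLt
        have := (τ i).isLt
        have := (τ j).isLt
        omega
    intro i
    by_cases hi : (i : ℕ) = n
    · exact (this (n - 1) ⟨n - 1, by omega⟩ i rfl (by omega)).2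
    · exact (this i i ⟨i + 1, by omega⟩ rfl rfl).1

/-- In type `A` with trivial `τ` there are no free nodes. -/
theorem not_isFreeNode_A_id (hn : 2 ≤ n) (hG : IsGSat (cartan A n) X τ) (hτ : ∀ i, τ i = i)
    {j : Fin (n + 1)} (hj : IsFreeNode (cartan A n) X τ j) : False := by
  have hj' : IsNsfNode (cartan A n) X τ j := hj.2.resolve_left fun h => h.1 (hτ _)
  -- `p k` is j + 1 + k modulo n + 1: once round the cycle, from j + 1 to `p n` = j.
  let p : ℕ → ℕ := fun k => if (j : ℕ) + 1 + k ≤ n then j + 1 + k else j + k - n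
  have hp : ∀ k, p k = j + 1 + k ∧ (j : ℕ) + 1 + k ≤ n ∨ p k = j + k - n ∧ n < (j : ℕ) + 1 + k :=
    fun k => by simp only [p]; split_ifs <;> omega
  have hjlt := j.isLt
  have hp0 := hp 0
  have hp1 := hp 1
  obtain ⟨i, hi⟩ : ∃ i : Fin (n + 1), (i : ℕ) = p 0 := ⟨⟨p 0, by omega⟩, rfl⟩
  have odd : ¬ Even (cartan A n i j) := by
    rw [cartan_A_eq_neg_one hn (by omega) ((cartan_A_ne_zero hn _ _).2 (by omega))]
    decide
  obtain ⟨hiX, x, hx, hxi⟩ := hj'.2.2 i (hτ i) odd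
  have hXj : ∀ l ∈ X, (l : ℕ) ≠ j := fun l hl h => hj.1 (Fin.ext h ▸ hl)
  have hXi : ∀ l ∈ X, (l : ℕ) ≠ i := fun l hl h => hiX (Fin.ext h ▸ hl)
  have hnbr0 : ∀ l ∈ X, cartan A n l i ≠ 0 → (l : ℕ) = p 1 := by
    intro l hl hA
    rw [cartan_A_ne_zero hn] at hA
    have := hXj l hl
    have := hXi l hl
    have := l.isLt
    omega
  have hx1 := hnbr0 x hx hxi
  have hpn : p n = j := by have := hp n; omega
  refine hG.no_path_coord (dNum_mul_cartan A n (by change 1 ≤ n; omega)) (dNum_ne_zero A n)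
    (cartan_self A n) (fun i => (i : ℕ)) (fun _ _ h => Fin.ext h) n hn p
    (fun k hk => ⟨⟨p k, by have := hp k; omega⟩, rfl⟩)
    (fun k l _ _ => by have := hp k; have := hp l; omega) ?_ ?_ ?_
    (fun _ _ i _ => hτ i) ?_ ?_ ?_
  · intro i' h
    have : i' = i := Fin.ext (by omega)
    rwa [this]
  · intro i' h
    have : i' = x := Fin.ext (by omega)
    rwa [this]
  · intro i' h
    have : i' = j := Fin.ext (by omega)
    rw [this]; exact hj.1
  · intro k hk i' j' h1 h2
    have := hp k
    have := hp (k + 1)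
    constructor <;> exact cartan_A_eq_neg_one hn (by omega)
      ((cartan_A_ne_zero hn _ _).2 (by omega))
  · intro i' h
    have : i' = i := Fin.ext (by omega)
    rw [this]
    exact hnbr0
  · intro k hk0 hk i' h l hl hA
    rw [cartan_A_ne_zero hn] at hA
    have := hp k
    have := hp (k + 1)
    have := hp (k - 1)
    omega

/-- In type `A`, if `τ` is a rotation by half a turn, there are no free nodes. -/
theorem not_isFreeNode_A_rotation (hn : 2 ≤ n) (hG : IsGSat (cartan A n) X τ) {a : ℕ}
    (ha : 2 * a = n + 1)
    (hτ : ∀ i : Fin (n + 1), (τ i : ℕ) = a + i ∨ (τ i : ℕ) + (n + 1) = a + i)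
    {j : Fin (n + 1)} (hj : IsFreeNode (cartan A n) X τ j) : False := by
  have tj := hτ j
  have tjlt := (τ j).isLt
  have hjlt := j.isLt
  rcases hj.2 with ⟨hne, h | ⟨x, hx, h⟩⟩ | ⟨he, -⟩
  · rw [cartan_A_ne_zero hn] at h
    omega
  · have hXj : ∀ l ∈ X, (l : ℕ) ≠ j := fun l hl h => hj.1 (Fin.ext h ▸ hl)
    have hXτj : ∀ l ∈ X, (l : ℕ) ≠ τ j := fun l hl h => hG.map_notMem hj.1 (Fin.ext h ▸ hl)
    have tx := hτ x
    have txlt := (τ x).isLt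
    have x1 := hXj x hx
    have x2 := hXτj x hx
    -- The nodes j and τ(j), both outside X, cut the cycle into two open arcs which the half turn
    -- exchanges. The part of X in either arc is separated, hence would have to be τ-stable.
    obtain ⟨lo, hi, hlo, hhi⟩ : ∃ lo hi : ℕ, hi = lo + a ∧
        ((lo = (j : ℕ) ∧ hi = τ j) ∨ (lo = τ j ∧ hi = j)) := by
      rcases tj with h | h
      · exact ⟨j, τ j, by omega, Or.inl ⟨rfl, rfl⟩⟩
      · exact ⟨τ j, j, by omega, Or.inr ⟨rfl, rfl⟩⟩
    by_cases hxin : lo < (x : ℕ) ∧ (x : ℕ) < hi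
    · have := hG.map_mem_of_separated (fun l => lo < (l : ℕ) ∧ (l : ℕ) < hi) ?_ hx hxin
      · omega
      · intro k hk hkn l hl
        by_contra hA
        rw [← ne_eq, cartan_A_ne_zero hn] at hA
        have := hXj k hk
        have := hXτj k hk
        have := k.isLt
        omega
    · have := hG.map_mem_of_separated (fun l => (l : ℕ) < lo ∨ hi < (l : ℕ)) ?_ hx (by omega)
      · omega
      · intro k hk hkn l hl
        by_contra hA
        rw [← ne_eq, cartan_A_ne_zero hn] at hA
        have := hXj k hk
        have := hXτj k hk
        have := k.isLt
        have := l.isLt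
        omega
  · rw [he] at tj
    omega

theorem card_le_two_A (hn : 1 ≤ n) (hG : IsGSat (cartan A n) X τ) {Istar : Finset (Fin (n + 1))}
    (hI : IsTransversal X τ Istar) (d : Fin (n + 1) → ℚ) :
    (Idiff (cartan A n) d X τ Istar ∪ Insf (cartan A n) X τ Istar).card ≤ 2 := by
  by_cases hn1 : n = 1
  · subst hn1
    exact (Finset.card_le_univ _).trans (by simp)
  have hn2 : 2 ≤ n := by omega
  refine card_le_two_of_isFreeNode hG hI ?_
  have hlt := (τ 0).isLt
  rcases diagramAut_A hn2 hG with hτ | hτ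
  · intro j _ _ _ _ _ _ _ _ hj _ _
    by_cases h0 : (τ 0 : ℕ) = 0
    · refine not_isFreeNode_A_id hn2 hG (fun i => Fin.ext ?_) hj
      have := hτ i
      omega
    · have h1 := hτ (τ 0)
      rw [hG.involutive] at h1
      have : ((0 : Fin (n + 1)) : ℕ) = 0 := rfl
      exact not_isFreeNode_A_rotation hn2 hG (by omega) hτ hj
  -- Since τ(i) ≡ τ(0) - i modulo n + 1, the number 2i - τ(0) is negated modulo 2(n + 1). Its
  -- representative is taken between -(n + 1), excluded, and n + 1, included.
  · let y : Fin (n + 1) → ℤ := fun i =>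
      if 2 * (i : ℤ) - (τ 0 : ℕ) ≤ n + 1 then 2 * (i : ℤ) - (τ 0 : ℕ)
      else 2 * (i : ℤ) - (τ 0 : ℕ) - 2 * (n + 1)
    have hy : ∀ i, (y i = 2 * (i : ℤ) - (τ 0 : ℕ) ∧ 2 * (i : ℤ) - (τ 0 : ℕ) ≤ n + 1) ∨
        (y i = 2 * (i : ℤ) - (τ 0 : ℕ) - 2 * (n + 1) ∧
          (n : ℤ) + 1 < 2 * (i : ℤ) - (τ 0 : ℕ)) := fun i => by
      simp only [y]; split_ifs <;> omega
    refine hG.reflection_free_nodes y (n + 1) ?_ ?_ ?_ ?_ ?_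
    · intro a b h
      apply Fin.ext
      have := hy a; have := hy b; have := a.isLt; have := b.isLt
      omega
    · intro a b
      have := hy a; have := hy b
      omega
    · intro a
      have := hy a; have := a.isLt
      omega
    · intro a ha
      have := hy a; have := hy (τ a); have := a.isLt; have := (τ a).isLt
      have := hτ a
      omega
    · intro a b h
      have := hy a; have := hy b; have := a.isLt; have := b.isLt
      rw [cartan_A_ne_zero hn2] at h
      rw [Fin.ext_iff]
      omega

end TypeA

/-! ### The bound in type B -/

section TypeB

open ClassicalType

variable {n : ℕ} {X : Finset (Fin (n + 1))} {τ : Equiv.Perm (Fin (n + 1))}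

/-- The only entry -2 is at (n, n - 1), so τ fixes both of these nodes. Adjacency propagates this
down to the branch node 2. -/
theorem diagramAut_B (hn : 3 ≤ n) (hG : IsGSat (cartan B n) X τ) {i : Fin (n + 1)}
    (hi : 2 ≤ (i : ℕ)) : τ i = i := by
  have hadj : ∀ i j : Fin (n + 1), 1 ≤ (i : ℕ) → (j : ℕ) = i + 1 →
      (1 ≤ (τ i : ℕ) ∧ (τ j : ℕ) = τ i + 1) ∨ (1 ≤ (τ j : ℕ) ∧ (τ i : ℕ) = τ j + 1) ∨
        ((τ i : ℕ) = 0 ∧ (τ j : ℕ) = 2) ∨ ((τ j : ℕ) = 0 ∧ (τ i : ℕ) = 2) := by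
    intro i j h1 hij
    have h : cartan B n (τ i) (τ j) ≠ 0 := by
      rw [hG.diagramAut, cartan_B_ne_zero hn]; omega
    rw [cartan_B_ne_zero hn] at h
    have := perm_val_ne τ (a := i) (b := j) (by omega)
    omega
  have : ∀ k : ℕ, k + 3 ≤ n → ∀ i j : Fin (n + 1), (i : ℕ) + k + 1 = n → (j : ℕ) = i + 1 →
      (τ i : ℕ) = i ∧ (τ j : ℕ) = j := by
    intro k
    induction k with
    | zero =>
      intro _ i j hi hj
      have h : cartan B n (τ j) (τ i) = -2 := by
        rw [hG.diagramAut, cartan_B_eq_neg_two]; omega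
      rw [cartan_B_eq_neg_two] at h
      omega
    | succ k ih =>
      intro hk i j hi hj
      obtain ⟨e, he⟩ : ∃ e : Fin (n + 1), (e : ℕ) = j + 1 := ⟨⟨j + 1, by omega⟩, rfl⟩
      have := ih (by omega) j e (by omega) he
      have := hadj i j (by omega) hj
      have := perm_val_ne τ (a := e) (b := i) (by omega)
      omega
  apply Fin.ext
  have hlt := i.isLt
  by_cases hi' : (i : ℕ) = n
  · exact (this 0 (by omega) ⟨n - 1, by omega⟩ i (by simp only; omega) (by simp only; omega)).2
  · exact (this (n - 1 - i) (by omega) i ⟨i + 1, by omega⟩ (by omega) rfl).1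

/-- Two free nodes of type `B` are not both outside the fork `{0, 1}`. -/
theorem not_two_free_B (hn : 3 ≤ n) (hG : IsGSat (cartan B n) X τ) {a b : Fin (n + 1)}
    (ha : IsFreeNode (cartan B n) X τ a) (hb : IsFreeNode (cartan B n) X τ b)
    (ha2 : 2 ≤ (a : ℕ)) (hab : (a : ℕ) < b) : False := by
  have hfix : ∀ i : Fin (n + 1), 2 ≤ (i : ℕ) → τ i = i := fun i hi => diagramAut_B hn hG hi
  have ha' := ha.2.resolve_left fun h => h.1 (hfix _ ha2)
  have hb' := hb.2.resolve_left fun h => h.1 (hfix _ (by omega))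
  have odd : ∀ i j : Fin (n + 1), 1 ≤ (i : ℕ) → 1 ≤ (j : ℕ) → (i : ℕ) = j + 1 ∨ (j : ℕ) = i + 1 →
      (i : ℕ) ≠ n → ¬ Even (cartan B n i j) := fun i j h0 h0' h h1 => by
    rw [cartan_B_eq_neg_one (by omega) h1 ((cartan_B_ne_zero hn _ _).2 (by omega))]
    decide
  have hbn := b.isLt
  by_cases hab1 : (b : ℕ) = a + 1
  · exact ha'.not_adj hb' (odd a b (by omega) (by omega) (Or.inr hab1) (by omega))
  obtain ⟨i, hi⟩ : ∃ i : Fin (n + 1), (i : ℕ) = a + 1 := ⟨⟨a + 1, by omega⟩, rfl⟩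
  obtain ⟨hiX, x, hx, hxi⟩ := ha'.2.2 i (hfix i (by omega))
    (odd i a (by omega) (by omega) (Or.inl hi) (by omega))
  have hXa : ∀ l ∈ X, (l : ℕ) ≠ a := fun l hl h => ha.1 (Fin.ext h ▸ hl)
  have hXi : ∀ l ∈ X, (l : ℕ) ≠ i := fun l hl h => hiX (Fin.ext h ▸ hl)
  have hnbr0 : ∀ l ∈ X, cartan B n l i ≠ 0 → (l : ℕ) = a + 2 := by
    intro l hl hA
    rw [cartan_B_ne_zero hn] at hA
    have := hXa l hl
    have := hXi l hl
    omega
  have hx1 := hnbr0 x hx hxi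
  have hbx : (x : ℕ) ≠ b := fun h => hb.1 (Fin.ext h ▸ hx)
  -- The path ascends from a + 1 to b, and the double edge can only be its last one.
  refine hG.no_path_coord (dNum_mul_cartan B n hn) (dNum_ne_zero B n) (cartan_self B n)
    (fun i => (i : ℕ)) (fun _ _ h => Fin.ext h) (b - a - 1) (by omega) (fun k => a + 1 + k)
    (fun k hk => ⟨⟨a + 1 + k, by omega⟩, rfl⟩) (fun k l _ _ => by omega) ?_ ?_ ?_
    (fun _ _ i h => hfix i (by omega)) ?_ ?_ ?_
  · intro i' h
    have : i' = i := Fin.ext (by omega)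
    rwa [this]
  · intro i' h
    have : i' = x := Fin.ext (by omega)
    rwa [this]
  · intro i' h
    have : i' = b := Fin.ext (by omega)
    rw [this]; exact hb.1
  · intro k hk i' j' h1 h2
    constructor <;> refine cartan_B_eq_neg_one (by omega) (by omega)
      ((cartan_B_ne_zero hn _ _).2 (by omega))
  · intro i' h
    have : i' = i := Fin.ext (by omega)
    rw [this]
    exact fun l hl hA => by have := hnbr0 l hl hA; omega
  · intro k hk0 hk i' h l hl hA
    rw [cartan_B_ne_zero hn] at hA
    omega

/-- A `τ`-fixed free node in the fork `{0, 1}` of type `B` excludes free nodes outside the fork. -/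
theorem not_fork_free_B (hn : 3 ≤ n) (hG : IsGSat (cartan B n) X τ) {a b : Fin (n + 1)}
    (ha : IsFreeNode (cartan B n) X τ a) (hb : IsFreeNode (cartan B n) X τ b)
    (ha2 : (a : ℕ) < 2) (hτa : τ a = a) (hb2 : 2 ≤ (b : ℕ)) : False := by
  have hfix : ∀ i : Fin (n + 1), 2 ≤ (i : ℕ) → τ i = i := fun i hi => diagramAut_B hn hG hi
  have ha' := ha.2.resolve_left fun h => h.1 hτa
  have hb' := hb.2.resolve_left fun h => h.1 (hfix _ (by omega))
  have hbn := b.isLt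
  have neg : ∀ i j : Fin (n + 1), (i : ℕ) ≠ j → (i : ℕ) ≠ n → cartan B n i j ≠ 0 →
      cartan B n i j = -1 := fun i j => cartan_B_eq_neg_one
  obtain ⟨two, htwo⟩ : ∃ i : Fin (n + 1), (i : ℕ) = 2 := ⟨⟨2, by omega⟩, rfl⟩
  have hXa : ∀ l ∈ X, (l : ℕ) ≠ a := fun l hl h => ha.1 (Fin.ext h ▸ hl)
  have hXb : ∀ l ∈ X, (l : ℕ) ≠ b := fun l hl h => hb.1 (Fin.ext h ▸ hl)
  -- Node 2 is a neighbour of a, and an I_nsf node is not joined to X.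
  have h2X : ∀ l ∈ X, (l : ℕ) ≠ 2 := by
    intro l hl h
    have := ha'.2.1 l hl
    revert this
    rw [imp_false, ← ne_eq, cartan_B_ne_zero hn]
    omega
  by_cases hb3 : (b : ℕ) = 2
  · refine ha'.not_adj hb' ?_
    rw [neg a b (by omega) (by omega) ((cartan_B_ne_zero hn _ _).2 (by omega))]
    decide
  obtain ⟨i, hi⟩ : ∃ i : Fin (n + 1), (i : ℕ) + 1 = b := ⟨⟨b - 1, by omega⟩, by simp only; omega⟩
  obtain ⟨hiX, x, hx, hxi⟩ := hb'.2.2 i (hfix i (by omega)) (by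
    rw [neg i b (by omega) (by omega) ((cartan_B_ne_zero hn _ _).2 (by omega))]
    decide)
  have hXi : ∀ l ∈ X, (l : ℕ) ≠ i := fun l hl h => hiX (Fin.ext h ▸ hl)
  by_cases hb4 : (b : ℕ) = 3
  -- Now i = 2, whose only possible neighbour in X is the other leaf 1 - a. That leaf is isolated in
  -- X, so this is the forbidden case m = 1.
  · have hnbr : ∀ l ∈ X, cartan B n l i ≠ 0 → (l : ℕ) + a = 1 := by
      intro l hl hA
      rw [cartan_B_ne_zero hn] at hA
      have := hXa l hl
      have := hXb l hl
      have := hXi l hl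
      omega
    have hxa := hnbr x hx hxi
    obtain ⟨l, hl, hlx, hli⟩ := hG.exists_other_neighbour (cartan_self B n) hiX
      (hfix i (by omega)) hx (fun l hl hlx => by
        by_contra hA
        rw [← ne_eq, cartan_B_ne_zero hn] at hA
        have := h2X l hl
        rw [Ne, Fin.ext_iff] at hlx
        omega)
      (neg x i (by omega) (by omega) hxi)
      (neg i x (by omega) (by omega) ((cartan_B_ne_zero hn _ _).2 (by omega)))
    exact hlx (Fin.ext (by have := hnbr l hl hli; omega))
  have hnbr0 : ∀ l ∈ X, cartan B n l i ≠ 0 → (l : ℕ) + 2 = b := by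
    intro l hl hA
    rw [cartan_B_ne_zero hn] at hA
    have := hXb l hl
    have := hXi l hl
    omega
  have hx1 := hnbr0 x hx hxi
  have hx2 := h2X x hx
  -- The path descends from b - 1 to the branch node 2, which is outside X.
  refine hG.no_path_coord (dNum_mul_cartan B n hn) (dNum_ne_zero B n) (cartan_self B n)
    (fun i => (i : ℕ)) (fun _ _ h => Fin.ext h) (b - 3) (by omega) (fun k => b - 1 - k)
    (fun k hk => ⟨⟨b - 1 - k, by omega⟩, rfl⟩) (fun k l _ _ => by omega) ?_ ?_ ?_
    (fun _ _ i h => hfix i (by omega)) ?_ ?_ ?_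
  · intro i' h
    have : i' = i := Fin.ext (by omega)
    rwa [this]
  · intro i' h
    have : i' = x := Fin.ext (by omega)
    rwa [this]
  · intro i' h hm
    have := h2X i' hm
    omega
  · intro k hk i' j' h1 h2
    constructor <;> refine neg _ _ (by omega) (by omega)
      ((cartan_B_ne_zero hn _ _).2 (by omega))
  · intro i' h
    have : i' = i := Fin.ext (by omega)
    rw [this]
    exact fun l hl hA => by have := hnbr0 l hl hA; omega
  · intro k hk0 hk i' h l hl hA
    rw [cartan_B_ne_zero hn] at hA
    omega

theorem card_le_two_B (hn : 3 ≤ n) (hG : IsGSat (cartan B n) X τ) {Istar : Finset (Fin (n + 1))}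
    (hI : IsTransversal X τ Istar) (d : Fin (n + 1) → ℚ) :
    (Idiff (cartan B n) d X τ Istar ∪ Insf (cartan B n) X τ Istar).card ≤ 2 := by
  refine card_le_two_of_isFreeNode hG hI ?_
  intro a b c hab hac hbc tab tac tbc ha hb hc
  rw [Ne, Fin.ext_iff] at hab hac hbc tab tac tbc
  have pair : ∀ a b : Fin (n + 1), IsFreeNode (cartan B n) X τ a → IsFreeNode (cartan B n) X τ b →
      2 ≤ (a : ℕ) → 2 ≤ (b : ℕ) → (a : ℕ) = b := by
    intro a b ha hb h1 h2
    rcases lt_trichotomy (a : ℕ) b with h | h | h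
    · exact (not_two_free_B hn hG ha hb h1 h).elim
    · exact h
    · exact (not_two_free_B hn hG hb ha h2 h).elim
  -- When a and b exhaust the fork and lie in different orbits, τ fixes a.
  have fork : ∀ a b c : Fin (n + 1), IsFreeNode (cartan B n) X τ a → IsFreeNode (cartan B n) X τ c →
      (a : ℕ) ≠ b → (τ a : ℕ) ≠ b → (a : ℕ) < 2 → (b : ℕ) < 2 → 2 ≤ (c : ℕ) → False := by
    intro a b c ha hc hab tab h1 h2 h3
    refine not_fork_free_B hn hG ha hc h1 (Fin.ext ?_) h3
    have : ¬ 2 ≤ (τ a : ℕ) := fun h => by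
      have := diagramAut_B hn hG h
      rw [hG.involutive] at this
      rw [← this] at h
      omega
    omega
  have p1 := pair a b ha hb
  have p2 := pair a c ha hc
  have p3 := pair b c hb hc
  have f1 := fork a b c ha hc hab tab
  have f2 := fork a c b ha hb hac tac
  have f3 := fork b c a hb ha hbc tbc
  by_cases h1 : (a : ℕ) < 2 <;> by_cases h2 : (b : ℕ) < 2 <;> by_cases h3 : (c : ℕ) < 2
  · omega
  · exact f1 h1 h2 (by omega)
  · exact f2 h1 h3 (by omega)
  · exact hbc (p3 (by omega) (by omega))
  · exact f3 h2 h3 (by omega)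
  · exact hac (p2 (by omega) (by omega))
  · exact hab (p1 (by omega) (by omega))
  · exact hab (p1 (by omega) (by omega))

end TypeB

/-! ### The bound in type D: coordinates and automorphisms -/

section TypeD

open ClassicalType

variable {n : ℕ} {X : Finset (Fin (n + 1))} {τ : Equiv.Perm (Fin (n + 1))}
  {r : Fin (n + 1) → ℕ}

/-- `cartan_D_ne_zero` in terms of the coordinate `i ↦ i` or `i ↦ n - i`. -/
theorem cartan_D_coord (hr : (∀ i, r i = (i : ℕ)) ∨ ∀ i, r i + i = n) (hn : 4 ≤ n)
    (i j : Fin (n + 1)) :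
    cartan D n i j ≠ 0 ↔ r i = r j ∨ (1 ≤ r i ∧ r i + 2 ≤ n ∧ r j = r i + 1) ∨
      (1 ≤ r j ∧ r j + 2 ≤ n ∧ r i = r j + 1) ∨ (r i = 0 ∧ r j = 2) ∨ (r j = 0 ∧ r i = 2) ∨
      (r i + 2 = n ∧ r j = n) ∨ (r j + 2 = n ∧ r i = n) := by
  rw [cartan_D_ne_zero]
  rcases hr with hr | hr
  · rw [hr i, hr j]
  · have h1 := hr i
    have h2 := hr j
    constructor
    · rintro (h | h | h | h | h | h | h) <;> omega
    · rintro (h | h | h | h | h | h | h) <;> omega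

theorem coord_le (hr : (∀ i, r i = (i : ℕ)) ∨ ∀ i, r i + i = n) (i : Fin (n + 1)) : r i ≤ n := by
  have := i.isLt
  rcases hr with hr | hr <;> have := hr i <;> omega

theorem coord_inj (hr : (∀ i, r i = (i : ℕ)) ∨ ∀ i, r i + i = n) {i j : Fin (n + 1)}
    (h : r i = r j) : i = j := by
  apply Fin.ext
  rcases hr with hr | hr <;> have := hr i <;> have := hr j <;> omega

theorem coord_surj (hr : (∀ i, r i = (i : ℕ)) ∨ ∀ i, r i + i = n) {m : ℕ} (hm : m ≤ n) :
    ∃ i, r i = m := by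
  rcases hr with hr | hr
  · exact ⟨⟨m, by omega⟩, hr _⟩
  · refine ⟨⟨n - m, by omega⟩, ?_⟩
    have := hr ⟨n - m, by omega⟩
    simp only at this
    omega

theorem cartan_D_coord_eq {i j : Fin (n + 1)} (hij : r i ≠ r j) (h : cartan D n i j ≠ 0) :
    cartan D n i j = -1 :=
  cartan_D_eq_neg_one (fun e => hij (by rw [Fin.ext e])) h

/-- Diagram automorphisms in type `D_n`, `n ≥ 5`, preserve or reverse the diagram. -/
theorem diagramAut_D (hn : 5 ≤ n) (hG : IsGSat (cartan D n) X τ) :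
    ∃ r : Fin (n + 1) → ℕ, ((∀ i, r i = (i : ℕ)) ∨ ∀ i, r i + i = n) ∧
      (∀ i : Fin (n + 1), 2 ≤ (i : ℕ) → (i : ℕ) + 2 ≤ n → r (τ i) = i) ∧
      (∀ i : Fin (n + 1), (i : ℕ) ≤ 1 → r (τ i) ≤ 1) ∧
      ∀ i : Fin (n + 1), n ≤ (i : ℕ) + 1 → n ≤ r (τ i) + 1 := by
  have mk : ∀ k : ℕ, k ≤ n → ∃ i : Fin (n + 1), (i : ℕ) = k := fun k hk => ⟨⟨k, by omega⟩, rfl⟩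
  obtain ⟨i0, h0⟩ := mk 0 (by omega)
  obtain ⟨i1, h1⟩ := mk 1 (by omega)
  obtain ⟨i2, h2⟩ := mk 2 (by omega)
  obtain ⟨i3, h3⟩ := mk 3 (by omega)
  obtain ⟨i4, h4⟩ := mk 4 (by omega)
  have adj : ∀ i j : Fin (n + 1), cartan D n i j ≠ 0 → cartan D n (τ i) (τ j) ≠ 0 :=
    fun i j h => by rwa [hG.diagramAut]
  -- For n ≥ 5 only the branch nodes 2 and n - 2 have three neighbours.
  have t2 : (τ i2 : ℕ) = 2 ∨ (τ i2 : ℕ) + 2 = n := by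
    have e0 := adj i2 i0 ((cartan_D_ne_zero _ _).2 (by omega))
    have e1 := adj i2 i1 ((cartan_D_ne_zero _ _).2 (by omega))
    have e3 := adj i2 i3 ((cartan_D_ne_zero _ _).2 (by omega))
    rw [cartan_D_ne_zero] at e0 e1 e3
    have := perm_val_ne τ (a := i0) (b := i1) (by omega)
    have := perm_val_ne τ (a := i0) (b := i2) (by omega)
    have := perm_val_ne τ (a := i0) (b := i3) (by omega)
    have := perm_val_ne τ (a := i1) (b := i2) (by omega)
    have := perm_val_ne τ (a := i1) (b := i3) (by omega)
    have := perm_val_ne τ (a := i2) (b := i3) (by omega)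
    omega
  -- After composing τ with the flip if necessary, the branch node 2 is fixed. The coordinate `r`
  -- records whether the flip was needed.
  obtain ⟨r, hr, r2⟩ : ∃ r : Fin (n + 1) → ℕ,
      ((∀ i, r i = (i : ℕ)) ∨ ∀ i, r i + i = n) ∧ r (τ i2) = 2 := by
    rcases t2 with h | h
    · exact ⟨fun i => i, Or.inl fun _ => rfl, h⟩
    · exact ⟨fun i => n - i, Or.inr fun i => by have := i.isLt; simp only; omega, by simp only; omega⟩
  have hne : ∀ i j : Fin (n + 1), (i : ℕ) ≠ j → r (τ i) ≠ r (τ j) := fun i j h e =>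
    h (by rw [τ.injective (coord_inj hr e)])
  have hadj : ∀ i j : Fin (n + 1), cartan D n i j ≠ 0 → _ := fun i j h =>
    (cartan_D_coord hr (by omega) _ _).1 (adj i j h)
  have r3 : r (τ i3) = 3 := by
    have e3 := hadj i2 i3 ((cartan_D_ne_zero _ _).2 (by omega))
    have e4 := hadj i3 i4 ((cartan_D_ne_zero _ _).2 (by omega))
    have := hne i2 i3 (by omega)
    have := hne i2 i4 (by omega)
    have := hne i3 i4 (by omega)
    omega
  have hmid : ∀ k : ℕ, ∀ i j : Fin (n + 1), (i : ℕ) = k + 2 → (j : ℕ) = k + 3 → k + 5 ≤ n →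
      r (τ i) = i ∧ r (τ j) = j := by
    intro k
    induction k with
    | zero =>
      intro i j hi hj _
      have e1 : i = i2 := Fin.ext (by omega)
      have e2 : j = i3 := Fin.ext (by omega)
      subst e1 e2
      omega
    | succ k ih =>
      intro i j hi hj hk
      obtain ⟨e, he⟩ := mk (k + 2) (by omega)
      have := ih e i he hi (by omega)
      have := hadj i j ((cartan_D_ne_zero _ _).2 (by omega))
      have := hne e j (by omega)
      have := hne i j (by omega)
      omega
  have hmid' : ∀ i : Fin (n + 1), 2 ≤ (i : ℕ) → (i : ℕ) + 2 ≤ n → r (τ i) = i := by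
    intro i hi1 hi2
    by_cases h : (i : ℕ) = 2
    · rw [show i = i2 from Fin.ext (by omega), r2, h2]
    · obtain ⟨e, he⟩ := mk (i - 1) (by omega)
      exact (hmid (i - 3) e i (by omega) (by omega) (by omega)).2
  refine ⟨r, hr, hmid', fun i hi => ?_, fun i hi => ?_⟩
  · have := hadj i2 i ((cartan_D_ne_zero _ _).2 (by omega))
    have := hne i i2 (by omega)
    have := hne i i3 (by omega)
    omega
  · have := i.isLt
    obtain ⟨e, he⟩ := mk (n - 2) (by omega)
    obtain ⟨f, hf⟩ := mk (n - 3) (by omega)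
    have := hmid' e (by omega) (by omega)
    have := hmid' f (by omega) (by omega)
    have := hadj e i ((cartan_D_ne_zero _ _).2 (by omega))
    have := hne i e (by omega)
    have := hne i f (by omega)
    omega

/-! ### Type D: automorphisms fixing the middle of the diagram -/

section Preserving

/-- The end `e` of the path is either a middle node or the leaf n - 1. In the latter case the twin
leaf n must also avoid X, since it would be a neighbour of n - 2 lying off the path. -/
theorem IsGSat.no_path_D (hG : IsGSat (cartan D n) X τ) (hn : 5 ≤ n)
    (hr : (∀ i, r i = (i : ℕ)) ∨ ∀ i, r i + i = n)
    (hfix : ∀ i, 2 ≤ r i → r i + 2 ≤ n → τ i = i) {m e : ℕ} (hm : 2 ≤ m) (hme : m + 2 ≤ e)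
    (hen : e + 1 ≤ n) {i x : Fin (n + 1)} (hi : r i = m) (hiX : i ∉ X) (hx : r x = m + 1)
    (hxX : x ∈ X) (he : ∀ l ∈ X, r l ≠ e) (he' : e + 1 = n → ∀ l ∈ X, r l ≠ n)
    (hnbr : ∀ l ∈ X, cartan D n l i ≠ 0 → r l = m + 1) : False := by
  have hn4 : 4 ≤ n := by omega
  refine hG.no_path_coord (dNum_mul_cartan D n hn4) (dNum_ne_zero D n) (cartan_self D n)
    r (fun _ _ => coord_inj hr) (e - m) (by omega) (fun k => m + k)
    (fun k hk => coord_surj hr (by omega)) (fun k l _ _ => by omega) ?_ ?_ ?_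
    (fun _ _ i h => hfix i (by omega) (by omega)) ?_ ?_ ?_
  · intro i' h
    rwa [coord_inj hr (show r i' = r i by omega)]
  · intro i' h
    rwa [coord_inj hr (show r i' = r x by omega)]
  · intro i' h hm
    have := he i' hm
    omega
  · intro k hk i' j' h1 h2
    constructor <;> refine cartan_D_coord_eq (r := r) (by omega)
      ((cartan_D_coord hr hn4 _ _).2 (by omega))
  · intro i' h
    rw [coord_inj hr (show r i' = r i by omega)]
    exact hnbr
  · intro k hk0 hk i' h l hl hA
    rw [cartan_D_coord hr hn4] at hA
    have := he l hl
    by_cases h1 : e + 1 = n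
    · have := he' h1 l hl
      omega
    · omega

theorem IsFreeNode.coord_ne {a : Fin (n + 1)} (ha : IsFreeNode (cartan D n) X τ a)
    (hr : (∀ i, r i = (i : ℕ)) ∨ ∀ i, r i + i = n) : ∀ l ∈ X, r l ≠ r a :=
  fun _ hl h => ha.1 (coord_inj hr h ▸ hl)

theorem odd_cartan_D {i j : Fin (n + 1)}
    (hij : r i ≠ r j) (h : cartan D n i j ≠ 0) : ¬ Even (cartan D n i j) := by
  rw [cartan_D_coord_eq (r := r) hij h]; decide

theorem not_mid_mid_D (hG : IsGSat (cartan D n) X τ) (hn : 5 ≤ n)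
    (hr : (∀ i, r i = (i : ℕ)) ∨ ∀ i, r i + i = n)
    (hfix : ∀ i, 2 ≤ r i → r i + 2 ≤ n → τ i = i) {a b : Fin (n + 1)}
    (ha : IsFreeNode (cartan D n) X τ a) (hb : IsFreeNode (cartan D n) X τ b)
    (ha2 : 2 ≤ r a) (hab : r a < r b) (hbn : r b + 2 ≤ n) : False := by
  have hn4 : 4 ≤ n := by omega
  have ha' := ha.2.resolve_left fun h => h.1 (hfix _ ha2 (by omega))
  have hb' := hb.2.resolve_left fun h => h.1 (hfix _ (by omega) hbn)
  by_cases hab1 : r b = r a + 1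
  · exact ha'.not_adj hb' (odd_cartan_D (r := r) (by omega) ((cartan_D_coord hr hn4 _ _).2 (by omega)))
  obtain ⟨i, hi⟩ := coord_surj hr (show r a + 1 ≤ n by omega)
  obtain ⟨hiX, x, hx, hxi⟩ := ha'.2.2 i (hfix i (by omega) (by omega))
    (odd_cartan_D (r := r) (by omega) ((cartan_D_coord hr hn4 _ _).2 (by omega)))
  have hnbr : ∀ l ∈ X, cartan D n l i ≠ 0 → r l = r a + 1 + 1 := by
    intro l hl hA
    rw [cartan_D_coord hr hn4] at hA
    have := ha.coord_ne hr l hl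
    have : r l ≠ r i := fun h => hiX (coord_inj hr h ▸ hl)
    omega
  have hx' := hnbr x hx hxi
  have := hb.coord_ne hr x hx
  exact hG.no_path_D hn hr hfix (by omega) (by omega) (by omega) hi hiX hx' hx
    (hb.coord_ne hr) (by omega) hnbr

/-- Two leaves exchanged by τ are not joined to each other. So if they are free, they are joined to
X through the branch node n - 2, while both are outside X. -/
theorem diff_leaf_D (hG : IsGSat (cartan D n) X τ) (hn : 5 ≤ n)
    (hr : (∀ i, r i = (i : ℕ)) ∨ ∀ i, r i + i = n)
    (hright : ∀ i, n ≤ r i + 1 → n ≤ r (τ i) + 1) {c : Fin (n + 1)}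
    (hc : IsFreeNode (cartan D n) X τ c) (hcn : n ≤ r c + 1) (hτc : τ c ≠ c) :
    (∃ x ∈ X, r x + 2 = n) ∧ ∀ l ∈ X, r l + 2 ≤ n := by
  have hn4 : 4 ≤ n := by omega
  have hc' := hc.2.resolve_right fun h => hτc h.1
  have h1 := coord_le hr c
  have h2 := coord_le hr (τ c)
  have h3 : r (τ c) ≠ r c := fun h => hτc (coord_inj hr h)
  have h4 := hright c hcn
  constructor
  · rcases hc'.2 with h | ⟨x, hx, h⟩
    · rw [cartan_D_coord hr hn4] at h
      omega
    · rw [cartan_D_coord hr hn4] at h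
      have := hc.coord_ne hr x hx
      exact ⟨x, hx, by omega⟩
  · intro l hl
    have h5 := hc.coord_ne hr l hl
    have h6 : r l ≠ r (τ c) := fun h => hG.map_notMem hc.1 (coord_inj hr h ▸ hl)
    have := coord_le hr l
    omega

/-- Starting from b, X must be left before or at the far end. If τ fixes the leaf c, then n - 2 is
outside X because c is not joined to X. If τ moves c, then both leaves are outside X by
`diff_leaf_D`. When b is the node n - 3 and c is fixed, the run degenerates to the single other
leaf. -/
theorem not_mid_leaf_D (hG : IsGSat (cartan D n) X τ) (hn : 5 ≤ n)
    (hr : (∀ i, r i = (i : ℕ)) ∨ ∀ i, r i + i = n)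
    (hfix : ∀ i, 2 ≤ r i → r i + 2 ≤ n → τ i = i)
    (hright : ∀ i, n ≤ r i + 1 → n ≤ r (τ i) + 1) {b c : Fin (n + 1)}
    (hb : IsFreeNode (cartan D n) X τ b) (hc : IsFreeNode (cartan D n) X τ c)
    (hb2 : 2 ≤ r b) (hbn : r b + 2 ≤ n) (hcn : n ≤ r c + 1) : False := by
  have hn4 : 4 ≤ n := by omega
  have hb' := hb.2.resolve_left fun h => h.1 (hfix _ hb2 hbn)
  have hcle := coord_le hr c
  by_cases hτc : τ c = c
  · have hc' := hc.2.resolve_left fun h => h.1 hτc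
    have hX2 : ∀ l ∈ X, r l ≠ n - 2 := by
      intro l hl h
      have := hc'.2.1 l hl
      revert this
      rw [imp_false, ← ne_eq, cartan_D_coord hr hn4]
      omega
    by_cases hb1 : r b + 2 = n
    · exact hb'.not_adj hc' (odd_cartan_D (r := r) (by omega)
        ((cartan_D_coord hr hn4 _ _).2 (by omega)))
    obtain ⟨i, hi⟩ := coord_surj hr (show r b + 1 ≤ n by omega)
    obtain ⟨hiX, x, hx, hxi⟩ := hb'.2.2 i (hfix i (by omega) (by omega))
      (odd_cartan_D (r := r) (by omega) ((cartan_D_coord hr hn4 _ _).2 (by omega)))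
    have hXi : ∀ l ∈ X, r l ≠ r i := fun l hl h => hiX (coord_inj hr h ▸ hl)
    by_cases hb3 : r b + 3 = n
    · have hnbr : ∀ l ∈ X, cartan D n l i ≠ 0 → r l + r c + 1 = n + n := by
        intro l hl hA
        rw [cartan_D_coord hr hn4] at hA
        have := hb.coord_ne hr l hl
        have := hc.coord_ne hr l hl
        have := hXi l hl
        omega
      have hxc := hnbr x hx hxi
      obtain ⟨l, hl, hlx, hli⟩ := hG.exists_other_neighbour (cartan_self D n) hiX
        (hfix i (by omega) (by omega)) hx (fun l hl hlx => by
          by_contra hA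
          rw [← ne_eq, cartan_D_coord hr hn4] at hA
          have := hX2 l hl
          have : r l ≠ r x := fun h => hlx (coord_inj hr h)
          omega)
        (cartan_D_coord_eq (r := r) (hXi x hx) hxi)
        (cartan_D_coord_eq (r := r) (hXi x hx).symm ((cartan_D_coord hr hn4 _ _).2 (by omega)))
      exact hlx (coord_inj hr (by have := hnbr l hl hli; omega))
    have hnbr : ∀ l ∈ X, cartan D n l i ≠ 0 → r l = r b + 1 + 1 := by
      intro l hl hA
      rw [cartan_D_coord hr hn4] at hA
      have := hb.coord_ne hr l hl
      have := hXi l hl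
      omega
    have hx' := hnbr x hx hxi
    have := hX2 x hx
    exact hG.no_path_D hn hr hfix (by omega) (by omega) (by omega) hi hiX hx' hx
      hX2 (by omega) hnbr
  · obtain ⟨⟨z, hz, hzn⟩, hle⟩ := diff_leaf_D hG hn hr hright hc hcn hτc
    have h1 := hb.coord_ne hr z hz
    have h2 : r b + 3 ≠ n := fun h => by
      have := hb'.2.1 z hz
      revert this
      rw [imp_false, ← ne_eq, cartan_D_coord hr hn4]
      omega
    obtain ⟨i, hi⟩ := coord_surj hr (show r b + 1 ≤ n by omega)
    obtain ⟨hiX, x, hx, hxi⟩ := hb'.2.2 i (hfix i (by omega) (by omega))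
      (odd_cartan_D (r := r) (by omega) ((cartan_D_coord hr hn4 _ _).2 (by omega)))
    have hnbr : ∀ l ∈ X, cartan D n l i ≠ 0 → r l = r b + 1 + 1 := by
      intro l hl hA
      rw [cartan_D_coord hr hn4] at hA
      have := hb.coord_ne hr l hl
      have : r l ≠ r i := fun h => hiX (coord_inj hr h ▸ hl)
      have := hle l hl
      omega
    exact hG.no_path_D (e := n - 1) hn hr hfix (by omega) (by omega) (by omega) hi hiX
      (hnbr x hx hxi) hx (fun l hl => by have := hle l hl; omega)
      (fun _ l hl => by have := hle l hl; omega) hnbr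

/-- Both leaves of the left fork are free in different orbits, hence fixed. Then node 2 is outside X
but joined to X, necessarily at 3. The free leaf c at the far end again forces X to be left. -/
theorem not_fork_leaf_D (hG : IsGSat (cartan D n) X τ) (hn : 5 ≤ n)
    (hr : (∀ i, r i = (i : ℕ)) ∨ ∀ i, r i + i = n)
    (hfix : ∀ i, 2 ≤ r i → r i + 2 ≤ n → τ i = i)
    (hleft : ∀ i, r i ≤ 1 → r (τ i) ≤ 1)
    (hright : ∀ i, n ≤ r i + 1 → n ≤ r (τ i) + 1) {a b c : Fin (n + 1)}
    (ha : IsFreeNode (cartan D n) X τ a) (hb : IsFreeNode (cartan D n) X τ b)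
    (hc : IsFreeNode (cartan D n) X τ c) (hab : a ≠ b) (tab : τ a ≠ b)
    (ha1 : r a ≤ 1) (hb1 : r b ≤ 1) (hcn : n ≤ r c + 1) : False := by
  have hn4 : 4 ≤ n := by omega
  have hcle := coord_le hr c
  have hab' : r a ≠ r b := fun h => hab (coord_inj hr h)
  have hτa : τ a = a := by
    apply coord_inj hr
    have := hleft a ha1
    have : r (τ a) ≠ r b := fun h => tab (coord_inj hr h)
    omega
  have ha' := ha.2.resolve_left fun h => h.1 hτa
  obtain ⟨i, hi⟩ := coord_surj hr (show 2 ≤ n by omega)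
  obtain ⟨hiX, x, hx, hxi⟩ := ha'.2.2 i (hfix i (by omega) (by omega))
    (odd_cartan_D (r := r) (by omega) ((cartan_D_coord hr hn4 _ _).2 (by omega)))
  have hnbr : ∀ l ∈ X, cartan D n l i ≠ 0 → r l = 2 + 1 := by
    intro l hl hA
    rw [cartan_D_coord hr hn4] at hA
    have := ha.coord_ne hr l hl
    have := hb.coord_ne hr l hl
    have : r l ≠ r i := fun h => hiX (coord_inj hr h ▸ hl)
    omega
  have hx' := hnbr x hx hxi
  by_cases hτc : τ c = c
  · have hc' := hc.2.resolve_left fun h => h.1 hτc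
    have hX2 : ∀ l ∈ X, r l ≠ n - 2 := by
      intro l hl h
      have := hc'.2.1 l hl
      revert this
      rw [imp_false, ← ne_eq, cartan_D_coord hr hn4]
      omega
    have := hX2 x hx
    exact hG.no_path_D hn hr hfix (by omega) (by omega) (by omega) hi hiX hx' hx
      hX2 (by omega) hnbr
  · obtain ⟨-, hle⟩ := diff_leaf_D hG hn hr hright hc hcn hτc
    exact hG.no_path_D (e := n - 1) hn hr hfix (by omega) (by omega) (by omega) hi hiX
      hx' hx (fun l hl => by have := hle l hl; omega)
      (fun _ l hl => by have := hle l hl; omega) hnbr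

/-- A free middle node tolerates no second free node, so all three are leaves. Two of them share a
fork and the third is at the other end. The coordinate n - i reduces the mirror images to the same
lemmas. -/
theorem preserving_free_nodes_D (hG : IsGSat (cartan D n) X τ) (hn : 5 ≤ n)
    (hfix : ∀ i : Fin (n + 1), 2 ≤ (i : ℕ) → (i : ℕ) + 2 ≤ n → τ i = i)
    (hleft : ∀ i : Fin (n + 1), (i : ℕ) ≤ 1 → (τ i : ℕ) ≤ 1)
    (hright : ∀ i : Fin (n + 1), n ≤ (i : ℕ) + 1 → n ≤ (τ i : ℕ) + 1)
    (a b c : Fin (n + 1)) (hab : a ≠ b) (hac : a ≠ c) (hbc : b ≠ c) (tab : τ a ≠ b)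
    (tac : τ a ≠ c) (tbc : τ b ≠ c) (ha : IsFreeNode (cartan D n) X τ a)
    (hb : IsFreeNode (cartan D n) X τ b) (hc : IsFreeNode (cartan D n) X τ c) : False := by
  have mid : ∀ a b, IsFreeNode (cartan D n) X τ a → IsFreeNode (cartan D n) X τ b → a ≠ b →
      ¬ (2 ≤ (a : ℕ) ∧ (a : ℕ) + 2 ≤ n) := by
    rintro a b ha hb hab ⟨h1, h2⟩
    rw [Ne, Fin.ext_iff] at hab
    have hblt := b.isLt
    by_cases h3 : (b : ℕ) ≤ 1
    · refine not_mid_leaf_D (r := fun i => n - i) hG hn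
        (Or.inr fun i => by have := i.isLt; omega)
        (fun i hi1 hi2 => hfix i (by have := i.isLt; omega) (by have := i.isLt; omega))
        (fun i hi => ?_) ha hb (by omega) (by omega) (by omega)
      have := hleft i (by have := i.isLt; omega)
      omega
    by_cases h4 : n ≤ (b : ℕ) + 1
    · exact not_mid_leaf_D (r := fun i => (i : ℕ)) hG hn (Or.inl fun _ => rfl) hfix hright ha hb
        h1 h2 h4
    · rcases lt_or_gt_of_ne hab with h | h
      · exact not_mid_mid_D (r := fun i => (i : ℕ)) hG hn (Or.inl fun _ => rfl) hfix ha hb h1 h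
          (by omega)
      · exact not_mid_mid_D (r := fun i => (i : ℕ)) hG hn (Or.inl fun _ => rfl) hfix hb ha
          (by omega) h h2
  have fork : ∀ a b c, IsFreeNode (cartan D n) X τ a → IsFreeNode (cartan D n) X τ b →
      IsFreeNode (cartan D n) X τ c → a ≠ b → τ a ≠ b →
      ¬ ((a : ℕ) ≤ 1 ∧ (b : ℕ) ≤ 1 ∧ n ≤ (c : ℕ) + 1) ∧
      ¬ (n ≤ (a : ℕ) + 1 ∧ n ≤ (b : ℕ) + 1 ∧ (c : ℕ) ≤ 1) := by
    intro a b c ha hb hc hab tab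
    constructor
    · rintro ⟨h1, h2, h3⟩
      exact not_fork_leaf_D (r := fun i => (i : ℕ)) hG hn (Or.inl fun _ => rfl) hfix hleft hright
        ha hb hc hab tab h1 h2 h3
    · rintro ⟨h1, h2, h3⟩
      refine not_fork_leaf_D (r := fun i => n - i) hG hn
        (Or.inr fun i => by have := i.isLt; omega)
        (fun i hi1 hi2 => hfix i (by have := i.isLt; omega) (by have := i.isLt; omega))
        (fun i hi => ?_) (fun i hi => ?_) ha hb hc hab tab (by omega) (by omega) (by omega)
      · have := hright i (by have := i.isLt; omega)
        omega
      · have := hleft i (by have := i.isLt; omega)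
        omega
  have m1 := mid a b ha hb hab
  have m2 := mid b a hb ha hab.symm
  have m3 := mid c a hc ha hac.symm
  have f1 := fork a b c ha hb hc hab tab
  have f2 := fork a c b ha hc hb hac tac
  have f3 := fork b c a hb hc ha hbc tbc
  rw [Ne, Fin.ext_iff] at hab hac hbc
  have := a.isLt
  have := b.isLt
  have := c.isLt
  omega

end Preserving

/-! ### Type D: automorphisms reversing the diagram -/

section Reversing

/-- The parts of X outside the orbit of a are separated and exchanged by τ, so X lies strictly
between lo and n - lo. A node b further out is then not joined to X. It is neither fixed by τ nor
joined to its image, so it is not free. -/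
theorem reversing_outside_D (hG : IsGSat (cartan D n) X τ) (hn : 5 ≤ n)
    (hmid : ∀ i : Fin (n + 1), 2 ≤ (i : ℕ) → (i : ℕ) + 2 ≤ n → (τ i : ℕ) + i = n)
    (hleft : ∀ i : Fin (n + 1), (i : ℕ) ≤ 1 → n ≤ (τ i : ℕ) + 1)
    (hright : ∀ i : Fin (n + 1), n ≤ (i : ℕ) + 1 → (τ i : ℕ) ≤ 1)
    {a b : Fin (n + 1)} (ha : IsFreeNode (cartan D n) X τ a)
    (hb : IsFreeNode (cartan D n) X τ b) {lo : ℕ} (hlo2 : 2 ≤ lo) (hlon : 2 * lo ≤ n)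
    (halo : (a : ℕ) = lo ∨ (a : ℕ) + lo = n) (hblo : (b : ℕ) < lo ∨ n < (b : ℕ) + lo) :
    False := by
  have hta := hmid a (by omega) (by omega)
  have hXlo : ∀ l ∈ X, (l : ℕ) ≠ lo ∧ (l : ℕ) + lo ≠ n := by
    intro l hl
    have h1 : (l : ℕ) ≠ a := fun h => ha.1 (Fin.ext h ▸ hl)
    have h2 : (l : ℕ) ≠ τ a := fun h => hG.map_notMem ha.1 (Fin.ext h ▸ hl)
    omega
  have hX : ∀ x ∈ X, lo < (x : ℕ) ∧ (x : ℕ) + lo < n := by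
    intro x hx
    have hx1 := hXlo x hx
    have tl := hleft x
    have tr := hright x
    have tm := hmid x
    by_contra hcon
    by_cases h : (x : ℕ) < lo
    · have := hG.map_mem_of_separated (fun l => (l : ℕ) < lo) ?_ hx h
      · omega
      · intro k hk hkn l hl
        by_contra hA
        rw [← ne_eq, cartan_D_ne_zero] at hA
        have := hXlo k hk
        omega
    · have := hG.map_mem_of_separated (fun l => n < (l : ℕ) + lo) ?_ hx (by omega)
      · omega
      · intro k hk hkn l hl
        by_contra hA
        rw [← ne_eq, cartan_D_ne_zero] at hA
        have := hXlo k hk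
        omega
  have tl := hleft b
  have tr := hright b
  have tm := hmid b
  have := b.isLt
  rcases hb.2 with ⟨-, h | ⟨x, hx, h⟩⟩ | ⟨he, -⟩
  · rw [cartan_D_ne_zero] at h
    omega
  · rw [cartan_D_ne_zero] at h
    have := hX x hx
    omega
  · rw [he] at tl tr tm
    omega

/-- If one of two free nodes is in the middle, the outer of the two orbits contradicts
`reversing_outside_D`. Otherwise all three are leaves, but the four leaves form only two orbits. -/
theorem reversing_free_nodes_D (hG : IsGSat (cartan D n) X τ) (hn : 5 ≤ n)
    (hmid : ∀ i : Fin (n + 1), 2 ≤ (i : ℕ) → (i : ℕ) + 2 ≤ n → (τ i : ℕ) + i = n)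
    (hleft : ∀ i : Fin (n + 1), (i : ℕ) ≤ 1 → n ≤ (τ i : ℕ) + 1)
    (hright : ∀ i : Fin (n + 1), n ≤ (i : ℕ) + 1 → (τ i : ℕ) ≤ 1)
    (a b c : Fin (n + 1)) (hab : a ≠ b) (hac : a ≠ c) (hbc : b ≠ c) (tab : τ a ≠ b)
    (tac : τ a ≠ c) (tbc : τ b ≠ c) (ha : IsFreeNode (cartan D n) X τ a)
    (hb : IsFreeNode (cartan D n) X τ b) (hc : IsFreeNode (cartan D n) X τ c) : False := by
  have inv : ∀ a b : Fin (n + 1), τ a ≠ b → (τ b : ℕ) ≠ a := fun a b h e =>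
    h (by rw [← Fin.ext e, hG.involutive])
  have mid : ∀ a b, IsFreeNode (cartan D n) X τ a → IsFreeNode (cartan D n) X τ b → a ≠ b →
      τ a ≠ b → ¬ (2 ≤ (a : ℕ) ∧ (a : ℕ) + 2 ≤ n) := by
    rintro a b ha hb hab tab ⟨h1, h2⟩
    rw [Ne, Fin.ext_iff] at hab tab
    have hblt := b.isLt
    have hta := hmid a h1 h2
    obtain ⟨la, hla⟩ : ∃ lo : ℕ, 2 * lo ≤ n ∧ ((a : ℕ) = lo ∨ (a : ℕ) + lo = n) := by
      by_cases h : 2 * (a : ℕ) ≤ n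
      · exact ⟨a, h, Or.inl rfl⟩
      · exact ⟨n - a, by omega, Or.inr (by omega)⟩
    obtain ⟨lb, hlb⟩ : ∃ lo : ℕ, 2 * lo ≤ n ∧ ((b : ℕ) = lo ∨ (b : ℕ) + lo = n) := by
      by_cases h : 2 * (b : ℕ) ≤ n
      · exact ⟨b, h, Or.inl rfl⟩
      · exact ⟨n - b, by omega, Or.inr (by omega)⟩
    by_cases h : lb < la
    · exact reversing_outside_D hG hn hmid hleft hright ha hb (by omega) hla.1 hla.2 (by omega)
    · exact reversing_outside_D hG hn hmid hleft hright hb ha (by omega) hlb.1 hlb.2 (by omega)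
  have m1 := mid a b ha hb hab tab
  have m2 := mid b c hb hc hbc tbc
  have m3 := mid c a hc ha hac.symm fun h => tac (by rw [← h, hG.involutive])
  have i1 := inv a b tab
  have i2 := inv a c tac
  have i3 := inv b c tbc
  rw [Ne, Fin.ext_iff] at hab hac hbc tab tac tbc
  have := a.isLt
  have := b.isLt
  have := c.isLt
  have := (τ a).isLt
  have := (τ b).isLt
  have := (τ c).isLt
  have la := hleft a
  have lb := hleft b
  have lc := hleft c
  have ra := hright a
  have rb := hright b
  have rc := hright c
  clear hleft hright hmid mid inv
  by_cases h1 : (a : ℕ) ≤ 1 <;> by_cases h2 : (b : ℕ) ≤ 1 <;> by_cases h3 : (c : ℕ) ≤ 1 <;> omega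

end Reversing

/-! ### Type D with n = 4 -/

theorem not_six_distinct (a b c d e f : Fin (4 + 1)) (h : [a, b, c, d, e, f].Nodup) : False := by
  have := h.length_le_card
  simp at this

-- The diagram is a star with centre 2, fixed by τ, and all three free nodes are leaves. A leaf of
-- nsf kind would require two leaves in X, so all the free leaves are moved by τ. Either way there
-- would be six nodes.
set_option maxHeartbeats 1000000 in
theorem free_nodes_D_four {X : Finset (Fin (4 + 1))} {τ : Equiv.Perm (Fin (4 + 1))}
    (hG : IsGSat (cartan D 4) X τ)
    (a b c : Fin (4 + 1)) (hab : a ≠ b) (hac : a ≠ c) (hbc : b ≠ c) (tab : τ a ≠ b)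
    (tac : τ a ≠ c) (tbc : τ b ≠ c) (ha : IsFreeNode (cartan D 4) X τ a)
    (hb : IsFreeNode (cartan D 4) X τ b) (hc : IsFreeNode (cartan D 4) X τ c) : False := by
  have adj : ∀ i j : Fin (4 + 1), cartan D 4 i j ≠ 0 ↔
      (i : ℕ) = j ∨ (i : ℕ) = 2 ∨ (j : ℕ) = 2 := fun i j => by
    rw [cartan_D_ne_zero]
    have := i.isLt
    have := j.isLt
    omega
  have neg : ∀ i j : Fin (4 + 1), (i : ℕ) ≠ j → ((i : ℕ) = 2 ∨ (j : ℕ) = 2) →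
      cartan D 4 i j = -1 := fun i j h h' => cartan_D_eq_neg_one h ((adj i j).2 (Or.inr h'))
  have h22 : ((2 : Fin (4 + 1)) : ℕ) = 2 := rfl
  have t2 : τ 2 = 2 := by
    have e0 : cartan D 4 (τ 2) (τ 0) ≠ 0 := by
      rw [hG.diagramAut, adj]; exact Or.inr (Or.inl rfl)
    have e1 : cartan D 4 (τ 2) (τ 1) ≠ 0 := by
      rw [hG.diagramAut, adj]; exact Or.inr (Or.inl rfl)
    rw [adj] at e0 e1
    have := perm_val_ne τ (a := 2) (b := 0) (by decide)
    have := perm_val_ne τ (a := 2) (b := 1) (by decide)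
    have := perm_val_ne τ (a := 0) (b := 1) (by decide)
    apply Fin.ext
    omega
  have hne2 : ∀ i : Fin (4 + 1), (i : ℕ) ≠ 2 → (τ i : ℕ) ≠ 2 := fun i h e => by
    have := perm_val_ne τ (a := i) (b := 2) h
    rw [t2] at this
    exact this e
  have center : ∀ a b, IsFreeNode (cartan D 4) X τ a → IsFreeNode (cartan D 4) X τ b → a ≠ b →
      (a : ℕ) ≠ 2 := by
    intro a b ha hb hab h
    have e : a = 2 := Fin.ext h
    have ha' := ha.2.resolve_left fun h => h.1 (by rw [e, t2])
    rw [Ne, Fin.ext_iff] at hab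
    rcases hb.2 with ⟨hne, h | ⟨x, hx, h⟩⟩ | hb'
    · rw [adj] at h
      have := hne2 b (by omega)
      rw [Ne, Fin.ext_iff] at hne
      omega
    · rw [adj] at h
      have h1 : (x : ℕ) ≠ b := fun h => hb.1 (Fin.ext h ▸ hx)
      have h2 : (x : ℕ) ≠ a := fun h => ha.1 (Fin.ext h ▸ hx)
      omega
    · refine ha'.not_adj hb' ?_
      rw [neg a b hab (Or.inl h)]
      decide
  have c1 := center a b ha hb hab
  have c2 := center b a hb ha hab.symm
  have c3 := center c a hc ha hac.symm
  have hX : ∀ l ∈ X, (l : ℕ) ≠ a ∧ (l : ℕ) ≠ b ∧ (l : ℕ) ≠ c := fun l hl =>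
    ⟨fun h => ha.1 (Fin.ext h ▸ hl), fun h => hb.1 (Fin.ext h ▸ hl),
      fun h => hc.1 (Fin.ext h ▸ hl)⟩
  rw [Ne, Fin.ext_iff] at hab hac hbc
  have bda := a.isLt
  have bdb := b.isLt
  have bdc := c.isLt
  have nsf : ∀ j : Fin (4 + 1), (j : ℕ) ≠ 2 → ¬ IsNsfNode (cartan D 4) X τ j := by
    intro j hj hj'
    obtain ⟨h2X, x, hx, hx2⟩ := hj'.2.2 2 t2 (by rw [neg 2 j hj.symm (Or.inl rfl)]; decide)
    have hX2 : ∀ l ∈ X, (l : ℕ) ≠ 2 := fun l hl h => h2X ((Fin.ext h : l = 2) ▸ hl)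
    obtain ⟨l, hl, hlx, -⟩ := hG.exists_other_neighbour (cartan_self D 4) h2X t2 hx
      (fun l hl hlx => by
        by_contra hA
        rw [← ne_eq, adj] at hA
        have := hX2 l hl
        have := hX2 x hx
        rw [Ne, Fin.ext_iff] at hlx
        omega)
      (neg x 2 (hX2 x hx) (Or.inr rfl)) (neg 2 x (hX2 x hx).symm (Or.inl rfl))
    have x1 := hX x hx
    have l1 := hX l hl
    have x2 := hX2 x hx
    have l2 := hX2 l hl
    rw [Ne, Fin.ext_iff] at hlx
    refine not_six_distinct a b c x l 2 ?_
    simp only [List.nodup_cons, List.mem_cons, List.not_mem_nil, or_false, not_or, Fin.ext_iff,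
      not_false_eq_true, List.nodup_nil, and_true, h22]
    and_intros <;> omega
  have ma := (ha.2.resolve_right (nsf a c1)).1
  have mb := (hb.2.resolve_right (nsf b c2)).1
  have inv : ∀ a b : Fin (4 + 1), τ a ≠ b → (τ b : ℕ) ≠ a := fun a b h e =>
    h (by rw [← Fin.ext e, hG.involutive])
  have i1 := inv a b tab
  have n1 := perm_val_ne τ hab
  have d1 := hne2 a c1
  have d2 := hne2 b c2
  rw [Ne, Fin.ext_iff] at ma mb tab tac tbc
  refine not_six_distinct a b c (τ a) (τ b) 2 ?_
  simp only [List.nodup_cons, List.mem_cons, List.not_mem_nil, or_false, not_or, Fin.ext_iff,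
    not_false_eq_true, List.nodup_nil, and_true, h22]
  and_intros <;> omega

theorem card_le_two_D (hn : 4 ≤ n) (hG : IsGSat (cartan D n) X τ) {Istar : Finset (Fin (n + 1))}
    (hI : IsTransversal X τ Istar) (d : Fin (n + 1) → ℚ) :
    (Idiff (cartan D n) d X τ Istar ∪ Insf (cartan D n) X τ Istar).card ≤ 2 := by
  refine card_le_two_of_isFreeNode hG hI ?_
  by_cases hn4 : n = 4
  · subst hn4
    exact free_nodes_D_four hG
  have hn5 : 5 ≤ n := by omega
  obtain ⟨r, hr | hr, hmid, hleft, hright⟩ := diagramAut_D hn5 hG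
  · refine preserving_free_nodes_D hG hn5 (fun i h1 h2 => Fin.ext ?_) (fun i h => ?_)
      fun i h => ?_
    · rw [← hr]; exact hmid i h1 h2
    · rw [← hr]; exact hleft i h
    · rw [← hr]; exact hright i h
  · refine reversing_free_nodes_D hG hn5 (fun i h1 h2 => ?_) (fun i h => ?_) fun i h => ?_
    · have := hr (τ i); have := hmid i h1 h2; omega
    · have := hr (τ i); have := hleft i h; omega
    · have := hr (τ i); have := hright i h; omega

end TypeD

theorem card_freeNodes_le_two (t : ClassicalType) {n : ℕ} (hn : t.minRank ≤ n)
    {X : Finset (Fin (n + 1))} {τ : Equiv.Perm (Fin (n + 1))} (hG : IsGSat (t.cartan n) X τ)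
    {Istar : Finset (Fin (n + 1))} (hI : IsTransversal X τ Istar) (d : Fin (n + 1) → ℚ) :
    (Idiff (t.cartan n) d X τ Istar ∪ Insf (t.cartan n) X τ Istar).card ≤ 2 := by
  cases t with
  | A => exact card_le_two_A hn hG hI d
  | B => exact card_le_two_B hn hG hI d
  | C => exact card_le_two_C hn hG hI d
  | D => exact card_le_two_D hn hG hI d

/-! ### The q-Serre expression under quasi-commuting factors -/

section Serre

variable {K : Type*} [Field K] {U : Type*} [Ring U] [Algebra K U]

theorem pow_mul_of_mul_eq_smul {a u : U} {c : K} (h : a * u = c • (u * a)) (m : ℕ) :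
    a * u ^ m = c ^ m • (u ^ m * a) := by
  induction m with
  | zero => simp
  | succ m ih =>
    rw [pow_succ, ← mul_assoc, ih, smul_mul_assoc, mul_assoc, h, mul_smul_comm, smul_smul,
      ← mul_assoc, pow_succ]

theorem pow_mul_of_mul_eq_smul' {a u : U} {c : K} (h : a * u = c • (u * a)) (m : ℕ) :
    a ^ m * u = c ^ m • (u * a ^ m) := by
  induction m with
  | zero => simp
  | succ m ih =>
    rw [pow_succ, mul_assoc, h, mul_smul_comm, ← mul_assoc, ih, smul_mul_assoc, smul_smul,
      mul_assoc, pow_succ c, mul_comm c]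

/-- Moving all u and w to the left costs a scalar that depends only on p + r. So every monomial of a
q-Serre sum acquires the same factor. -/
theorem twisted_monomial {a b u w : U} {c e : K} (hau : a * u = c • (u * a))
    (hbu : b * u = e • (u * b)) (haw : a * w = e • (w * a)) (huw : u * w = w * u) (p r : ℕ) :
    (u * a) ^ p * (w * b) * (u * a) ^ r =
      (∏ s ∈ Finset.range (p + r), c ^ s * e) • (u ^ (p + r) * w * (a ^ p * b * a ^ r)) := by
  induction p with
  | zero =>
    simp only [pow_zero, one_mul, zero_add]
    induction r with
    | zero => simp
    | succ r ih =>
      rw [pow_succ, ← mul_assoc, ih, Finset.prod_range_succ, smul_mul_assoc, mul_smul]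
      congr 1
      have h1 : b * a ^ r * (u * a) = (c ^ r * e) • (u * (b * (a ^ r * a))) := by
        calc b * a ^ r * (u * a) = b * (a ^ r * u) * a := by simp only [mul_assoc]
          _ = c ^ r • (b * u * (a ^ r * a)) := by
            rw [pow_mul_of_mul_eq_smul' hau]; simp only [mul_smul_comm, smul_mul_assoc, mul_assoc]
          _ = (c ^ r * e) • (u * (b * (a ^ r * a))) := by
            rw [hbu, smul_mul_assoc, smul_smul, mul_assoc]
      calc u ^ r * w * (b * a ^ r) * (u * a) = u ^ r * w * (b * a ^ r * (u * a)) := by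
            rw [mul_assoc]
        _ = (c ^ r * e) • (u ^ r * (w * u) * (b * (a ^ r * a))) := by
            rw [h1, mul_smul_comm]; simp only [mul_assoc]
        _ = _ := by rw [← huw, pow_succ u, pow_succ a]; simp only [mul_assoc]
  | succ p ih =>
    have h0 : (u * a) ^ (p + 1) * (w * b) * (u * a) ^ r =
        u * a * ((u * a) ^ p * (w * b) * (u * a) ^ r) := by
      rw [pow_succ']; simp only [mul_assoc]
    rw [h0, ih, show p + 1 + r = p + r + 1 by omega, Finset.prod_range_succ, mul_smul_comm,
      mul_smul]
    congr 1
    have h1 : a * (u ^ (p + r) * w) = (c ^ (p + r) * e) • (u ^ (p + r) * w * a) := by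
      rw [← mul_assoc, pow_mul_of_mul_eq_smul hau, smul_mul_assoc, mul_assoc, haw, mul_smul_comm,
        smul_smul, ← mul_assoc]
    calc u * a * (u ^ (p + r) * w * (a ^ p * b * a ^ r))
        = u * (a * (u ^ (p + r) * w)) * (a ^ p * b * a ^ r) := by simp only [mul_assoc]
      _ = (c ^ (p + r) * e) • (u * (u ^ (p + r) * w * a) * (a ^ p * b * a ^ r)) := by
        rw [h1, mul_smul_comm, smul_mul_assoc]
      _ = _ := by rw [pow_succ' u, pow_succ' a]; simp only [mul_assoc]

/-- The `q`-Serre expression of `u a`, `w b`, where `u` and `w` quasi-commute with `a` and `b`. -/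
theorem serre_twisted (q : K) {a b u w : U} {c e : K} (hau : a * u = c • (u * a))
    (hbu : b * u = e • (u * b)) (haw : a * w = e • (w * a)) (huw : u * w = w * u) (m : ℕ) :
    serre q m (u * a) (w * b) =
      (∏ s ∈ Finset.range m, c ^ s * e) • (u ^ m * w * serre q m a b) := by
  simp only [serre, Finset.mul_sum, Finset.smul_sum]
  refine Finset.sum_congr rfl fun r hr => ?_
  have hr' : m - r + r = m := Nat.sub_add_cancel (Nat.lt_succ_iff.mp (Finset.mem_range.mp hr))
  have h := twisted_monomial hau hbu haw huw (m - r) r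
  rw [hr'] at h
  have hsign : ∀ z : U, (-1) ^ r * z = ((-1 : K) ^ r) • z := fun z => by
    rw [Algebra.smul_def]; simp
  simp only [divPow, smul_mul_assoc, mul_smul_comm, hsign, smul_smul]
  rw [h, smul_smul]
  congr 1
  ring

end Serre

/-! ### Homomorphisms out of the quantum group, and their commutation with Ad(χ) -/

section Homs

variable {I : Type*} [DecidableEq I] {K : Type*} [Field K] {A : Matrix I I ℤ} {q : I → K}

/-- Elements of an algebra satisfying the defining relations of `U_q(𝔤)`. -/
structure SatisfiesRel {U : Type*} [Ring U] [Algebra K U] (A : Matrix I I ℤ) (q : I → K)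
    (x y : I → U) (k : I → Uˣ) : Prop where
  k_k : ∀ i j, k i * k j = k j * k i
  k_x : ∀ i j, (k i).val * x j = q i ^ A i j • (x j * (k i).val)
  k_y : ∀ i j, (k i).val * y j = q i ^ (-A i j) • (y j * (k i).val)
  x_y_self : ∀ i, x i * y i - y i * x i =
    (q i - (q i)⁻¹)⁻¹ • ((k i).val - ((k i)⁻¹ : Uˣ).val)
  x_y_ne : ∀ i j, i ≠ j → x i * y j - y j * x i = 0
  serre_x : ∀ i j, i ≠ j → serre (q i) (1 - A i j).toNat (x i) (x j) = 0
  serre_y : ∀ i j, i ≠ j → serre (q i) (1 - A i j).toNat (y i) (y j) = 0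

theorem satisfiesRel_generators (A : Matrix I I ℤ) (q : I → K) :
    SatisfiesRel A q (xGen A q) (yGen A q) (kGen A q) where
  k_k i j := Units.ext (by
    have := proj_rel (Rel.k_comm (A := A) (q := q) i j)
    rw [map_mul, map_mul] at this
    exact this)
  k_x i j := by
    have := proj_rel (Rel.k_x (A := A) (q := q) i j)
    rw [map_mul, map_smul, map_mul] at this
    exact this
  k_y i j := by
    have := proj_rel (Rel.k_y (A := A) (q := q) i j)
    rw [map_mul, map_smul, map_mul] at this
    exact this
  x_y_self i := by
    have := proj_rel (Rel.x_y_self (A := A) (q := q) i)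
    rw [map_sub, map_smul, map_sub, map_mul, map_mul] at this
    exact this
  x_y_ne i j h := by
    have := proj_rel (Rel.x_y_ne (A := A) (q := q) i j h)
    rw [map_sub, map_mul, map_mul, map_zero] at this
    exact this
  serre_x i j h := by
    have := proj_rel (Rel.serre_x (A := A) (q := q) i j h)
    rwa [map_serre, map_zero] at this
  serre_y i j h := by
    have := proj_rel (Rel.serre_y (A := A) (q := q) i j h)
    rwa [map_serre, map_zero] at this

/-- The universal property of `U_q(𝔤)`. -/
theorem SatisfiesRel.exists_hom {U : Type*} [Ring U] [Algebra K U] {fx fy : I → U} {fk : I → Uˣ}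
    (hf : SatisfiesRel A q fx fy fk) :
    ∃ φ : Uq A q →ₐ[K] U, ∀ i, φ (xGen A q i) = fx i ∧ φ (yGen A q i) = fy i ∧
      φ (kGen A q i : Uq A q) = (fk i).val := by
  let g : Gen I → U := fun a => match a with
    | .x i => fx i
    | .y i => fy i
    | .k i => (fk i).val
    | .kinv i => ((fk i)⁻¹ : Uˣ).val
  have hg : ∀ {a b : FreeU I K}, Rel A q a b → FreeAlgebra.lift K g a = FreeAlgebra.lift K g b := by
    intro a b h
    induction h with
    | k_kinv i => simp [g]
    | kinv_k i => simp [g]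
    | k_comm i j => simpa [g] using congrArg Units.val (hf.k_k i j)
    | k_x i j => simpa only [map_mul, map_smul, FreeAlgebra.lift_ι_apply] using hf.k_x i j
    | k_y i j => simpa only [map_mul, map_smul, FreeAlgebra.lift_ι_apply] using hf.k_y i j
    | x_y_self i =>
      simpa only [map_mul, map_smul, map_sub, FreeAlgebra.lift_ι_apply] using hf.x_y_self i
    | x_y_ne i j h =>
      simpa only [map_mul, map_zero, map_sub, FreeAlgebra.lift_ι_apply] using hf.x_y_ne i j h
    | serre_x i j h =>
      simpa only [map_serre, map_zero, FreeAlgebra.lift_ι_apply] using hf.serre_x i j h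
    | serre_y i j h =>
      simpa only [map_serre, map_zero, FreeAlgebra.lift_ι_apply] using hf.serre_y i j h
  refine ⟨RingQuot.liftAlgHom K ⟨FreeAlgebra.lift K g, fun _ _ h => hg h⟩, fun i => ?_⟩
  refine ⟨?_, ?_, ?_⟩ <;> simp [xGen, yGen, kGen, proj, g]

section Omega

variable {U : Type*} [Ring U] [Algebra K U] {x y : I → U} {k : I → Uˣ}

theorem smul_zpow_cancel {M : Type*} [AddCommGroup M] [Module K M] {p : K} (hp : p ≠ 0) (z : ℤ)
    (m : M) : p ^ z • p ^ (-z) • m = m := by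
  rw [smul_smul, ← zpow_add₀ hp, add_neg_cancel, zpow_zero, one_smul]

theorem smul_zpow_cancel' {M : Type*} [AddCommGroup M] [Module K M] {p : K} (hp : p ≠ 0) (z : ℤ)
    (m : M) : p ^ (-z) • p ^ z • m = m := by
  rw [smul_smul, ← zpow_add₀ hp, neg_add_cancel, zpow_zero, one_smul]

theorem mul_inv_of_mul_eq_smul {u : Uˣ} {z : U} {c : K} (h : u.val * z = c • (z * u.val)) :
    z * (u⁻¹ : Uˣ).val = c • ((u⁻¹ : Uˣ).val * z) := by
  calc z * (u⁻¹ : Uˣ).val = (u⁻¹ : Uˣ).val * (u.val * z) * (u⁻¹ : Uˣ).val := by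
        rw [← mul_assoc, Units.inv_mul, one_mul]
    _ = c • ((u⁻¹ : Uˣ).val * z) := by
        rw [h, mul_smul_comm, smul_mul_assoc, mul_assoc, mul_assoc, Units.mul_inv, mul_one]

/-- The images of the generators under `ω_q` satisfy the defining relations. -/
theorem SatisfiesRel.omega (h : SatisfiesRel A q x y k) (hq : ∀ i, q i ≠ 0)
    (hs : ∀ i j, q i ^ A i j = q j ^ A j i) :
    SatisfiesRel A q (fun i => -(((k i)⁻¹ : Uˣ).val * y i)) (fun i => -(x i * (k i).val))
      (fun i => (k i)⁻¹) := by
  have hs' : ∀ i j, q i ^ (-A i j) = q j ^ (-A j i) := fun i j => by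
    rw [zpow_neg, zpow_neg, hs]
  have x_k : ∀ i j, x j * (k i).val = q i ^ (-A i j) • ((k i).val * x j) := fun i j => by
    rw [h.k_x, smul_zpow_cancel' (hq i)]
  have x_kinv : ∀ i j, x j * ((k i)⁻¹ : Uˣ).val = q i ^ A i j • (((k i)⁻¹ : Uˣ).val * x j) :=
    fun i j => mul_inv_of_mul_eq_smul (h.k_x i j)
  have y_kinv : ∀ i j, y j * ((k i)⁻¹ : Uˣ).val = q i ^ (-A i j) • (((k i)⁻¹ : Uˣ).val * y j) :=
    fun i j => mul_inv_of_mul_eq_smul (h.k_y i j)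
  have kinv_x : ∀ i j, ((k i)⁻¹ : Uˣ).val * x j = q i ^ (-A i j) • (x j * ((k i)⁻¹ : Uˣ).val) :=
    fun i j => by rw [x_kinv, smul_zpow_cancel' (hq i)]
  have kinv_y : ∀ i j, ((k i)⁻¹ : Uˣ).val * y j = q i ^ A i j • (y j * ((k i)⁻¹ : Uˣ).val) :=
    fun i j => by rw [y_kinv, smul_zpow_cancel (hq i)]
  have k_k : ∀ i j, (k i).val * (k j).val = (k j).val * (k i).val := fun i j =>
    congrArg Units.val (h.k_k i j)
  have kinv_kinv' : ∀ i j, (k i)⁻¹ * (k j)⁻¹ = (k j)⁻¹ * (k i)⁻¹ := fun i j => by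
    rw [← mul_inv_rev, ← mul_inv_rev, h.k_k]
  have kinv_kinv : ∀ i j, ((k i)⁻¹ : Uˣ).val * ((k j)⁻¹ : Uˣ).val =
      ((k j)⁻¹ : Uˣ).val * ((k i)⁻¹ : Uˣ).val := fun i j => congrArg Units.val (kinv_kinv' i j)
  have kinv_k : ∀ i j, ((k i)⁻¹ : Uˣ).val * (k j).val = (k j).val * ((k i)⁻¹ : Uˣ).val := by
    intro i j
    have : Commute (k i) (k j) := h.k_k i j
    exact congrArg Units.val this.inv_left.eq
  -- Moving k_j past y_i and k_i⁻¹ past x_j produces scalars which cancel, because q_i^{a_ij} =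
  -- q_j^{a_ji}.
  have hxy : ∀ i j, -(((k i)⁻¹ : Uˣ).val * y i) * -(x j * (k j).val) -
      -(x j * (k j).val) * -(((k i)⁻¹ : Uˣ).val * y i) =
      -(((k i)⁻¹ : Uˣ).val * (x j * y i - y i * x j) * (k j).val) := by
    intro i j
    have h1 : x j * (k j).val * (((k i)⁻¹ : Uˣ).val * y i) =
        ((k i)⁻¹ : Uˣ).val * (x j * y i) * (k j).val := by
      calc _ = x j * ((k j).val * ((k i)⁻¹ : Uˣ).val) * y i := by simp only [mul_assoc]
        _ = x j * ((k i)⁻¹ : Uˣ).val * ((k j).val * y i) := by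
            rw [← kinv_k]; simp only [mul_assoc]
        _ = q i ^ (-A i j) • q i ^ A i j • (((k i)⁻¹ : Uˣ).val * x j * (y i * (k j).val)) := by
            rw [x_kinv, h.k_y, hs' j i]; simp only [smul_mul_assoc, mul_smul_comm]
        _ = _ := by rw [smul_zpow_cancel' (hq i)]; simp only [mul_assoc]
    rw [neg_mul_neg, neg_mul_neg, h1]
    noncomm_ring
  refine ⟨kinv_kinv', ?_, ?_, ?_, ?_, ?_, ?_⟩
  · intro i j
    rw [mul_neg, neg_mul, smul_neg, ← mul_assoc, kinv_kinv, mul_assoc, kinv_y, mul_smul_comm,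
      mul_assoc]
  · intro i j
    rw [mul_neg, neg_mul, smul_neg, ← mul_assoc, kinv_x, smul_mul_assoc, mul_assoc, kinv_k,
      mul_assoc]
  · intro i
    rw [hxy, h.x_y_self, mul_smul_comm, smul_mul_assoc, inv_inv, ← smul_neg]
    congr 1
    rw [mul_sub, sub_mul, Units.inv_mul, one_mul, mul_assoc, Units.inv_mul, mul_one, neg_sub]
  · intro i j hij
    rw [hxy, h.x_y_ne j i hij.symm, mul_zero, zero_mul, neg_zero]
  · intro i j hij
    have hy : ∀ i, -(((k i)⁻¹ : Uˣ).val * y i) = (-1 : K) • (((k i)⁻¹ : Uˣ).val * y i) :=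
      fun i => by simp
    rw [hy, hy, serre_smul, serre_twisted (q i) (y_kinv i i) (y_kinv i j)
      (by rw [y_kinv, hs' j i]) (kinv_kinv i j), h.serre_y i j hij, mul_zero, smul_zero, smul_zero]
  · intro i j hij
    have hx : ∀ i, -(x i * (k i).val) = (-q i ^ (-A i i)) • ((k i).val * x i) := fun i => by
      rw [x_k, neg_smul]
    rw [hx, hx, serre_smul, serre_twisted (q i) (x_k i i) (x_k i j)
      (by rw [x_k, hs' j i]) (k_k i j), h.serre_x i j hij, mul_zero, smul_zero, smul_zero]

/-- The images of the generators under a diagram automorphism satisfy the defining relations. -/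
theorem SatisfiesRel.perm (h : SatisfiesRel A q x y k) (σ : Equiv.Perm I)
    (hA : ∀ i j, A (σ i) (σ j) = A i j) (hσ : ∀ i, q (σ i) = q i) :
    SatisfiesRel A q (fun i => x (σ i)) (fun i => y (σ i)) (fun i => k (σ i)) := by
  have hne : ∀ {i j}, i ≠ j → σ i ≠ σ j := fun h e => h (σ.injective e)
  refine ⟨fun i j => h.k_k _ _, fun i j => ?_, fun i j => ?_, fun i => ?_,
    fun i j hij => h.x_y_ne _ _ (hne hij), fun i j hij => ?_, fun i j hij => ?_⟩
  · rw [h.k_x, hA, hσ]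
  · rw [h.k_y, hA, hσ]
  · rw [h.x_y_self, hσ]
  · rw [← hA i j, ← hσ i]; exact h.serre_x _ _ (hne hij)
  · rw [← hA i j, ← hσ i]; exact h.serre_y _ _ (hne hij)

theorem neg_mul_mul_inv_cancel (z : U) (u : Uˣ) : -(z * u.val) * (u⁻¹ : Uˣ).val = -z := by
  rw [neg_mul, mul_assoc, Units.mul_inv, mul_one]

end Omega

theorem homWithValues_spec {fx fy fk : I → Uq A q} (h : ∃ φ : Uq A q →ₐ[K] Uq A q, ∀ i,
    φ (xGen A q i) = fx i ∧ φ (yGen A q i) = fy i ∧ φ (kGen A q i : Uq A q) = fk i) (i : I) :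
    homWithValues A q fx fy fk (xGen A q i) = fx i ∧
      homWithValues A q fx fy fk (yGen A q i) = fy i ∧
      homWithValues A q fx fy fk (kGen A q i : Uq A q) = fk i := by
  rw [homWithValues, dif_pos h]
  exact h.choose_spec i

/-- An endomorphism commutes with `homWithValues` if it does so for a genuine homomorphism with
the given values. -/
theorem homWithValues_comm {fx fy fk : I → Uq A q} (f : Uq A q →ₐ[K] Uq A q)
    (h : ∀ φ : Uq A q →ₐ[K] Uq A q, (∀ i, φ (xGen A q i) = fx i ∧ φ (yGen A q i) = fy i ∧
      φ (kGen A q i : Uq A q) = fk i) → f.comp φ = φ.comp f) :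
    f.comp (homWithValues A q fx fy fk) = (homWithValues A q fx fy fk).comp f := by
  unfold homWithValues
  split_ifs with hex
  · exact h _ hex.choose_spec
  -- The default value is the identity, which commutes with everything. Hence commutation with T_i
  -- does not require checking that Lusztig's formulas respect the relations.
  · rw [AlgHom.comp_id, AlgHom.id_comp]

theorem units_map_adHom_k (χ : Character I K) (i : I) :
    Units.map (adHom A q χ : Uq A q →* Uq A q) (kGen A q i) = kGen A q i :=
  Units.ext (adHom_k χ i)

theorem adHom_kinv (χ : Character I K) (i : I) :
    adHom A q χ ((kGen A q i)⁻¹ : (Uq A q)ˣ).val = ((kGen A q i)⁻¹ : (Uq A q)ˣ).val := by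
  have h : Units.map (adHom A q χ : Uq A q →* Uq A q) (kGen A q i)⁻¹ = (kGen A q i)⁻¹ := by
    rw [map_inv, units_map_adHom_k]
  exact congrArg Units.val h

theorem adHom_divPow (χ : Character I K) (p : K) (a : Uq A q) (r : ℕ) :
    adHom A q χ (divPow p a r) = divPow p (adHom A q χ a) r := by
  simp [divPow]

/-- `Ad(χ)` commutes with `T_i` if `χ(α_i) = 1`. -/
theorem adHom_comp_lusztigT (χ : Character I K) {i : I} (hi : χ.val i = 1) :
    (adHom A q χ).comp (lusztigT A q i) = (lusztigT A q i).comp (adHom A q χ) := by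
  -- T_i changes the weight of x_j and y_j, for j ≠ i, only by multiples of α_i, on which χ is
  -- trivial.
  refine homWithValues_comm _ fun φ hφ => hom_ext (fun j => ?_) (fun j => ?_) (fun j => ?_)
  · rw [AlgHom.comp_apply, AlgHom.comp_apply, adHom_x, map_smul, (hφ j).1]
    split_ifs with h
    · subst h
      simp [adHom_y, adHom_k, hi]
    · simp only [map_sum, map_smul, map_mul, adHom_divPow, adHom_x, hi, Units.val_one, one_smul,
        Finset.smul_sum, mul_smul_comm, smul_mul_assoc]
      exact Finset.sum_congr rfl fun r _ => smul_comm _ _ _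
  · rw [AlgHom.comp_apply, AlgHom.comp_apply, adHom_y, map_smul, (hφ j).2.1]
    split_ifs with h
    · subst h
      simp [adHom_x, adHom_kinv, hi]
    · simp only [map_sum, map_smul, map_mul, adHom_divPow, adHom_y, hi, inv_one, Units.val_one,
        one_smul, Finset.smul_sum, mul_smul_comm, smul_mul_assoc]
      exact Finset.sum_congr rfl fun r _ => smul_comm _ _ _
  · rw [AlgHom.comp_apply, AlgHom.comp_apply, adHom_k, (hφ j).2.2]
    have h : Units.map (adHom A q χ : Uq A q →* Uq A q) (kGen A q j * kGen A q i ^ (-A i j)) =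
        kGen A q j * kGen A q i ^ (-A i j) := by
      rw [map_mul, map_zpow, units_map_adHom_k, units_map_adHom_k]
    exact congrArg Units.val h

theorem adHom_lusztigWord (χ : Character I K) (ws : List I) (h : ∀ i ∈ ws, χ.val i = 1)
    (z : Uq A q) :
    adHom A q χ (lusztigWord A q ws z) = lusztigWord A q ws (adHom A q χ z) := by
  induction ws with
  | nil => rfl
  | cons i ws ih =>
    have h1 := DFunLike.congr_fun (adHom_comp_lusztigT (A := A) (q := q) χ (h i (by simp)))
      (lusztigWord A q ws z)
    have h2 := ih fun j hj => h j (by simp [hj])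
    simp only [AlgHom.comp_apply] at h1
    change adHom A q χ (lusztigT A q i (lusztigWord A q ws z)) =
      lusztigT A q i (lusztigWord A q ws (adHom A q χ z))
    rw [h1, h2]

theorem exists_character [Fintype I] (f : I → Kˣ) : ∃ χ : Character I K, ∀ i, χ.val i = f i := by
  refine ⟨{ toFun := fun m => ∏ i, f i ^ (Multiplicative.toAdd m i)
            map_one' := by simp
            map_mul' := fun a b => by simp [zpow_add, Finset.prod_mul_distrib] }, fun i => ?_⟩
  simp [Character.val, Pi.single_apply]

end Homs

/-! ### Rescaling the parameters by Ad(χ) -/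

section Equivalence

variable {I : Type*} [Fintype I] [DecidableEq I] {K : Type*} [Field K] {A : Matrix I I ℤ}
  {q : I → K} {X : Finset I} {τ : Equiv.Perm I}

/-- ω_q(y_i k_i) = -x_i. Here ω_q and τ must be genuine homomorphisms, while T_{w_X} stays opaque.
-/
theorem thetaQ_y_mul_k (hq : ∀ i, q i ≠ 0) (hs : ∀ i j, q i ^ A i j = q j ^ A j i)
    (hA : ∀ i j, A (τ i) (τ j) = A i j) (hτ : ∀ i, q (τ i) = q i) (i : I) :
    thetaQ A q X τ (yGen A q i * (kGen A q i).val) =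
      -lusztigWord A q (longestWord A X) (xGen A q (τ i)) := by
  have h1 := homWithValues_spec ((satisfiesRel_generators A q).omega hq hs).exists_hom i
  have h2 := homWithValues_spec ((satisfiesRel_generators A q).perm τ hA hτ).exists_hom i
  simp only [thetaQ, AlgHom.comp_apply]
  have h3 : omegaQ A q (yGen A q i * (kGen A q i).val) = -xGen A q i := by
    rw [map_mul, omegaQ, h1.2.1, h1.2.2]
    exact neg_mul_mul_inv_cancel _ _
  rw [h3, map_neg, map_neg, sigmaQ, h2.1]

/-- The three terms of b_i scale by χ(α_i)⁻¹, χ(α_{τ(i)}) and 1. Extracting χ(α_i)⁻¹ gives the new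
parameters. -/
theorem adHom_bGen (hq : ∀ i, q i ≠ 0) (hs : ∀ i j, q i ^ A i j = q j ^ A j i)
    (hA : ∀ i j, A (τ i) (τ j) = A i j) (hτ : ∀ i, q (τ i) = q i) (χ : Character I K)
    (hχ : ∀ i ∈ X, χ.val i = 1) {c s c' s' : I → K}
    (hc : ∀ i ∉ X, c' i = c i * (χ.val i : K) * (χ.val (τ i) : K))
    (hs' : ∀ i ∉ X, s' i = s i * (χ.val i : K)) (i : I) :
    adHom A q χ (bGen A q X τ c s i) = ((χ.val i)⁻¹ : Kˣ).val • bGen A q X τ c' s' i := by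
  unfold bGen
  split_ifs with hi
  · exact adHom_y χ i
  · have h1 : adHom A q χ (thetaQ A q X τ (yGen A q i * (kGen A q i).val)) =
        (χ.val (τ i) : K) • thetaQ A q X τ (yGen A q i * (kGen A q i).val) := by
      rw [thetaQ_y_mul_k hq hs hA hτ, map_neg,
        adHom_lusztigWord χ _ fun j hj => hχ j (longestWord_mem j hj), adHom_x, map_smul, smul_neg]
    have hu : ((χ.val i)⁻¹ : Kˣ).val * (χ.val i : K) = 1 := Units.inv_mul _
    have e1 : ((χ.val i)⁻¹ : Kˣ).val * (c i * (χ.val i : K) * (χ.val (τ i) : K)) =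
        c i * (χ.val (τ i) : K) := by
      linear_combination (c i * (χ.val (τ i) : K)) * hu
    have e2 : ((χ.val i)⁻¹ : Kˣ).val * (s i * (χ.val i : K)) = s i := by
      linear_combination s i * hu
    rw [map_sub, map_add, map_smul, map_smul, map_mul (adHom A q χ), h1, adHom_y, adHom_kinv,
      hc i hi, hs' i hi, smul_sub, smul_add, smul_smul, smul_smul, smul_mul_assoc, smul_smul, e1, e2]

theorem x_mem_Bcs (c s : I → K) {i : I} (hi : i ∈ X) : xGen A q i ∈ Bcs A q X τ c s :=
  Algebra.subset_adjoin (Or.inl (Or.inl (Set.mem_image_of_mem _ hi)))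

theorem mem_Bcs_of_mem_UhTheta (c s : I → K) {z : Uq A q} (hz : z ∈ UhTheta A q X τ) :
    z ∈ Bcs A q X τ c s :=
  Algebra.subset_adjoin (Or.inl (Or.inr hz))

theorem bGen_mem_Bcs (c s : I → K) (i : I) : bGen A q X τ c s i ∈ Bcs A q X τ c s :=
  Algebra.subset_adjoin (Or.inr (Set.mem_range_self i))

theorem Bcs_le {c s : I → K} {B : Subalgebra K (Uq A q)} (hx : ∀ i ∈ X, xGen A q i ∈ B)
    (hh : ∀ z ∈ UhTheta A q X τ, z ∈ B) (hb : ∀ i, bGen A q X τ c s i ∈ B) :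
    Bcs A q X τ c s ≤ B := by
  refine Algebra.adjoin_le ?_
  rintro z ((⟨i, hi, rfl⟩ | hz) | ⟨i, rfl⟩)
  · exact hx i hi
  · exact hh z hz
  · exact hb i

theorem map_Ad_Bcs (hq : ∀ i, q i ≠ 0) (hs : ∀ i j, q i ^ A i j = q j ^ A j i)
    (hA : ∀ i j, A (τ i) (τ j) = A i j) (hτ : ∀ i, q (τ i) = q i) (χ : Character I K)
    (hχ : ∀ i ∈ X, χ.val i = 1) {c s c' s' : I → K}
    (hc : ∀ i ∉ X, c' i = c i * (χ.val i : K) * (χ.val (τ i) : K))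
    (hs' : ∀ i ∉ X, s' i = s i * (χ.val i : K)) :
    (Bcs A q X τ c s).map (Ad A q χ : Uq A q →ₐ[K] Uq A q) = Bcs A q X τ c' s' := by
  have hAd : (Ad A q χ : Uq A q →ₐ[K] Uq A q) = adHom A q χ := rfl
  have hb := adHom_bGen hq hs hA hτ χ hχ hc hs'
  -- All of U_q(𝔥) is fixed pointwise, so nothing about the θ_q-fixed part has to be known.
  have hUh : ∀ z ∈ Uh A q, adHom A q χ z = z := by
    have : Uh A q ≤ AlgHom.equalizer (adHom A q χ) (AlgHom.id K (Uq A q)) := by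
      refine Algebra.adjoin_le ?_
      rintro z (⟨i, rfl⟩ | ⟨i, rfl⟩)
      · exact adHom_k χ i
      · exact adHom_kinv χ i
    exact fun z hz => this hz
  rw [hAd]
  apply le_antisymm
  · refine Subalgebra.map_le.2 (Bcs_le (fun i hi => ?_) (fun z hz => ?_) fun i => ?_)
    · change adHom A q χ (xGen A q i) ∈ Bcs A q X τ c' s'
      rw [adHom_x]
      exact Subalgebra.smul_mem _ (x_mem_Bcs c' s' hi) _
    · change adHom A q χ z ∈ Bcs A q X τ c' s'
      rw [hUh z hz.1]
      exact mem_Bcs_of_mem_UhTheta c' s' hz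
    · change adHom A q χ (bGen A q X τ c s i) ∈ Bcs A q X τ c' s'
      rw [hb]
      exact Subalgebra.smul_mem _ (bGen_mem_Bcs c' s' i) _
  · refine Bcs_le (fun i hi => ?_) (fun z hz => ?_) fun i => ?_
    · refine ⟨xGen A q i, x_mem_Bcs c s hi, ?_⟩
      change adHom A q χ (xGen A q i) = _
      rw [adHom_x, hχ i hi, Units.val_one, one_smul]
    · exact ⟨z, mem_Bcs_of_mem_UhTheta c s hz, hUh z hz.1⟩
    · refine ⟨(χ.val i : K) • bGen A q X τ c s i,
        Subalgebra.smul_mem _ (bGen_mem_Bcs c s i) _, ?_⟩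
      change adHom A q χ ((χ.val i : K) • bGen A q X τ c s i) = _
      rw [map_smul, hb, smul_smul, Units.mul_inv, one_smul]

variable {Istar : Finset I} {d : I → ℚ}

theorem Idiff_subset {j : I} (hj : j ∈ Idiff A d X τ Istar) : j ∈ Istar ∧ τ j ≠ j := by
  simp only [Idiff, Finset.mem_filter] at hj
  exact ⟨hj.1, fun h => hj.2.1 h.symm⟩

theorem Insf_fixed {j : I} (hj : j ∈ Insf A X τ Istar) : τ j = j := by
  simp only [Insf, Ins, Finset.mem_filter] at hj
  exact hj.1.2.1.symm

/-- Only entries at τ(I_diff) differ from 1. Such an index is not in I^*, since I_diff contains no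
τ-fixed node. -/
theorem FreeParams.cTuple_mem (hinv : ∀ i, τ (τ i) = i) (hI : IsTransversal X τ Istar)
    (p : FreeParams K A d X τ Istar) : p.cTuple ∈ CSet K A d X τ Istar := by
  refine ⟨fun j _ => ?_, fun j hj hne => ?_⟩
  · unfold FreeParams.cTuple
    split_ifs with h
    · exact p.2 _ h
    · exact one_ne_zero
  · by_contra hd
    have h1 : p.cTuple (τ j) = 1 := by
      unfold FreeParams.cTuple
      rw [dif_neg (by rwa [hinv])]
    rw [h1] at hne
    unfold FreeParams.cTuple at hne
    split_ifs at hne with h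
    · have := hI.eq_of_mem j hj (Idiff_subset h).1
      rw [this] at h
      exact hd h
    · exact hne rfl

theorem FreeParams.sTuple_mem (p : FreeParams K A d X τ Istar) :
    p.sTuple ∈ SSet K A X τ Istar := by
  intro j _ hne
  by_contra h
  exact hne (by simp [FreeParams.sTuple, h])

theorem exists_adEquivalent [IsAlgClosed K] (hq : ∀ i, q i ≠ 0)
    (hs : ∀ i j, q i ^ A i j = q j ^ A j i) (hτ : ∀ i, q (τ i) = q i) (hG : IsGSat A X τ)
    (hI : IsTransversal X τ Istar) {c s : I → K} (hc : c ∈ CSet K A d X τ Istar)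
    (hsS : s ∈ SSet K A X τ Istar) :
    ∃ p : FreeParams K A d X τ Istar,
      AdEquivalent (Bcs A q X τ c s) (Bcs A q X τ p.cTuple p.sTuple) := by
  classical
  -- At a τ-fixed node c_i is multiplied by χ(α_i)², so a square root of c_i⁻¹ is needed.
  choose z hz using fun i => IsAlgClosed.exists_pow_nat_eq (c i)⁻¹ (n := 2) (by norm_num)
  have hz0 : ∀ i, c i ≠ 0 → z i ≠ 0 := fun i h e => by
    have := hz i
    rw [e, zero_pow two_ne_zero] at this
    exact inv_ne_zero h this.symm
  obtain ⟨f, hfX, hffix, hfne, hfout⟩ : ∃ f : I → Kˣ, (∀ i ∈ X, f i = 1) ∧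
      (∀ i ∉ X, i ∈ Istar → τ i = i → (f i : K) = z i) ∧
      (∀ i ∉ X, i ∈ Istar → τ i ≠ i → (f i : K) = (c i)⁻¹) ∧
      ∀ i ∉ X, i ∉ Istar → f i = 1 := by
    refine ⟨fun i => if h : i ∉ X then (if i ∈ Istar then (if τ i = i then
      Units.mk0 (z i) (hz0 i (hc.1 i h)) else Units.mk0 (c i)⁻¹ (inv_ne_zero (hc.1 i h))) else 1)
      else 1, ?_, ?_, ?_, ?_⟩
    · intro i hi; simp [hi]
    · intro i hi h1 h2; simp [hi, h1, h2]
    · intro i hi h1 h2; simp [hi, h1, h2]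
    · intro i hi h1; simp [hi, h1]
  obtain ⟨χ, hχ⟩ := exists_character f
  -- These are the entries c_{τ(j)} and s_j that survive the rescaling, for j in I_diff and in I_nsf
  -- respectively.
  let p : FreeParams K A d X τ Istar := ⟨fun j =>
    if (j : I) ∈ Idiff A d X τ Istar then c (τ j) / c j else s j * (f j : K), fun j hj => by
      have hjX := hI.notMem _ (Idiff_subset hj).1
      simp only [if_pos hj]
      exact div_ne_zero (hc.1 _ (hG.map_notMem hjX)) (hc.1 _ hjX)⟩
  refine ⟨p, χ, map_Ad_Bcs hq hs hG.diagramAut hτ χ (fun i hi => by rw [hχ, hfX i hi]) ?_ ?_⟩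
  · intro i hi
    have hτi := hG.map_notMem hi
    rw [hχ, hχ]
    by_cases hiI : i ∈ Istar
    · have h1 : p.cTuple i = 1 := by
        unfold FreeParams.cTuple
        rw [dif_neg]
        intro h
        have := Idiff_subset h
        exact this.2 (by rw [hI.eq_of_mem i hiI this.1, hI.eq_of_mem i hiI this.1])
      rw [h1]
      by_cases hfix : τ i = i
      · rw [hfix, hffix i hi hiI hfix, mul_assoc, ← sq, hz, mul_inv_cancel₀ (hc.1 i hi)]
      · rw [hfne i hi hiI hfix, hfout (τ i) hτi fun h => hfix (hI.eq_of_mem i hiI h),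
          mul_inv_cancel₀ (hc.1 i hi), Units.val_one, one_mul]
    · have hτI : τ i ∈ Istar := (hI.mem_or i hi).resolve_left hiI
      have hne : τ (τ i) ≠ τ i := by
        rw [hG.involutive]; exact fun h => hiI (h ▸ hτI)
      rw [hfout i hi hiI, hfne _ hτi hτI hne, Units.val_one, mul_one, ← div_eq_mul_inv]
      unfold FreeParams.cTuple
      split_ifs with h
      · simp only [p, if_pos h, hG.involutive]
      -- Outside I_diff the definition of 𝒞 forces c_{τ(i)} = c_i, so the quotient is 1.
      · have := hc.2 _ hτI
        rw [hG.involutive] at this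
        have : c (τ i) = c i := by
          by_contra hcon
          exact h (this hcon)
        rw [this, div_self (hc.1 i hi)]
  · intro i hi
    rw [hχ]
    unfold FreeParams.sTuple
    split_ifs with h
    · have : i ∉ Idiff A d X τ Istar := fun h' => (Idiff_subset h').2 (Insf_fixed h)
      simp only [p, if_neg this]
    · have : s i = 0 := by
        by_contra hcon
        exact h (hsS i hi hcon)
      rw [this, zero_mul]

end Equivalence

end QuantumPair

theorem mainTheorem9
    {K : Type*} [Field K] [Algebra (RatFunc ℂ) K] [IsAlgClosure (RatFunc ℂ) K]
    (v : K) (hv : v ^ 2 = algebraMap (RatFunc ℂ) K RatFunc.X)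
    (t : QuantumPair.ClassicalType) (n : ℕ) (hn : t.minRank ≤ n)
    (X : Finset (Fin (n + 1))) (τ : Equiv.Perm (Fin (n + 1)))
    (hXτ : QuantumPair.IsGSat (t.cartan n) X τ)
    (Istar : Finset (Fin (n + 1))) (hIstar : QuantumPair.IsTransversal X τ Istar) :
    (QuantumPair.Idiff (t.cartan n) (t.dNum n) X τ Istar ∪
        QuantumPair.Insf (t.cartan n) X τ Istar).card ≤ 2 ∧
      (∀ p : QuantumPair.FreeParams K (t.cartan n) (t.dNum n) X τ Istar,
        p.cTuple ∈ QuantumPair.CSet K (t.cartan n) (t.dNum n) X τ Istar ∧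
          p.sTuple ∈ QuantumPair.SSet K (t.cartan n) X τ Istar) ∧
      ∀ c ∈ QuantumPair.CSet K (t.cartan n) (t.dNum n) X τ Istar,
        ∀ s ∈ QuantumPair.SSet K (t.cartan n) X τ Istar,
          ∃ p : QuantumPair.FreeParams K (t.cartan n) (t.dNum n) X τ Istar,
            QuantumPair.AdEquivalent
              (QuantumPair.Bcs (t.cartan n) (t.qParam n v) X τ c s)
              (QuantumPair.Bcs (t.cartan n) (t.qParam n v) X τ p.cTuple p.sTuple) := by
  have : IsAlgClosed K := IsAlgClosure.isAlgClosed (RatFunc ℂ)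
  have hv0 : v ≠ 0 := by
    rintro rfl
    rw [zero_pow two_ne_zero] at hv
    exact RatFunc.X_ne_zero ((map_eq_zero_iff _ (algebraMap (RatFunc ℂ) K).injective).1 hv.symm)
  refine ⟨QuantumPair.card_freeNodes_le_two t hn hXτ hIstar _,
    fun p => ⟨p.cTuple_mem hXτ.involutive hIstar, p.sTuple_mem⟩, fun c hc s hs =>
      QuantumPair.exists_adEquivalent (fun i => pow_ne_zero _ hv0) (fun i j => ?_) (fun i => ?_)
        hXτ hIstar hc hs⟩
  -- With q_i = v^{2 d_i}, symmetrisability becomes q_i^{a_ij} = q_j^{a_ji}.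
  · have h := QuantumPair.ClassicalType.twiceD_mul_cartan t n hn i j
    rw [← zpow_natCast, ← zpow_natCast, ← zpow_mul, ← zpow_mul, h]
  · show v ^ _ = v ^ _
    rw [QuantumPair.ClassicalType.twiceD_map t n hn τ hXτ.diagramAut]
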